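/- **Setting.** Let $1\le p\le 6$, $\alpha\ge -1$ real, $\tau>0$. Let the convolution weights $\omega_n$ be the Taylor coefficients at $\xi=0$, $\sum_n\omega_n\xi^n=\omega(\xi)$, of one of the generating functions $$\omega(\xi)=\Big(\tfrac1\tau\sum_{k=1}^p\tfrac1k(1-\xi)^k\Big)^{\alpha}\quad\text{(BDF)}\qquad\text{or}\qquad \omega(\xi)=\Big(\tfrac{1-\xi}{\tau}\Big)^{\alpha}\sum_{k=0}^{p-1}g_k^{(\alpha)}(1-\xi)^k\quad\text{(GNGF)},$$ where $g_0^{(\alpha)},\dots,g_5^{(\alpha)}$ are the first coefficients of the expansion $\big(-\ln(1-u)/u\big)^{\alpha}=\sum_k g^{(\alpha)}_k u^k$. Correspondingly let $$F_\omega(\lambda)=\lambda^\alpha P_p(\tau\lambda)^{\alpha},\quad P_p(z)=\sum_{k=1}^p\tfrac1k z^{k-1},\qquad\text{or}\qquad F_\omega(\lambda)=\lambda^\alpha\sum_{k=0}^{p-1}g^{(\alpha)}_k(\tau\lambda)^k .$$ Here $\lambda^\alpha$ is the principal power and $P_p(z)^\alpha$ is the branch continued along rays from the value $1$ at $z=0$,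 that is $P_p(z)^\alpha=\prod_r(1-z/r)^\alpha$ (principal powers, $r$ running over the zeros of $P_p$). Let $0\le\varphi<\pi/2$ be such that $F_\omega$ is holomorphic in the sector $|\arg\lambda|<\pi-\varphi$ (for every $\tau>0$), and let $\psi,d>0$ with $0<\psi-d<\psi+d<\pi/2-\varphi$. For $\mu_\ell>0$ and $\sigma\ge0$ let $\lambda(w)=\mu_\ell(1-\sin(\psi+iw))+\sigma$. For a step $h>0$ and $N\ge1$ let $\theta_k=(k+\tfrac12)h$, $\lambda_k^{(\ell)}=\lambda(\theta_k)$, $w_k^{(\ell)}=-\tfrac{h}{2\pi}\lambda'(\theta_k)$, and let $$\hat\omega_n=\mathrm{Im}\Big(\tau\sum_{k=-N}^{N-1}w_k^{(\ell)}(1-\lambda_k^{(\ell)}\tau)^{-1-n}F_\omega(\lambda_k^{(\ell)})\Big)$$ be the trapezoidal-rule approximation, on this contour, of $\omega_n=\frac{\tau}{2\pi i}\int(1-\lambda\tau)^{-1-n}F_\omega(\lambda)\,d\lambda$ (contour traversed with increasing imaginary part). **Theorem.** There are positive constants $a_0,a_1,a_2,b,c$, depending only on the choice of (BDF) or (GNGF)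 and on $p,\alpha,\psi,d,\varphi$, such that for all real $Q$ and $K$ there is a constant $C>0$, depending only on these data and on $Q,K$ (in particular independent of $\tau,n,N$, and also of $h,\mu_\ell,\sigma,B,\ell$), with the following property. Let $B\ge2$ and $\ell\ge1$ be integers, $n\in[B^{\ell-1},2B^\ell)$ an integer, $t=n\tau$, and suppose that $$n\ge b\mu_\ell t\ge1,\qquad n>Q,\qquad \sigma\tau\le c,\qquad \sigma t\le K$$ (the last two conditions hold automatically, with $K=0$, if $\sigma=0$), and that $Q$ is such that $$\frac{(\tau\lambda)^{1+\alpha}\lambda^{-\alpha}F_\omega(\lambda)}{(1-\tau\lambda)^{Q+1}}$$ is bounded for $\lambda=\lambda(w)$, $-d\le\mathrm{Im}(w)\le d$. Then $$|\hat\omega_n-\omega_n|\le C\tau^{-\alpha}\left[\frac{e^{a_0\mu_\ell t/2}}{e^{2d\pi/h}-1}+e^{(a_1-a_2\cosh(Nh))\mu_\ell t/2}+e^{a_1\mu_\ell t/2}\Big(1+\frac{b\mu_\ell t}{2(n-Q)}\cosh(Nh)\Big)^{1-n+Q}\right].$$ -/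

import Mathlib

open Real

/-- The two families of generating functions: the fractional backward difference formulas
and the generalized Newton-Gregory formulas. -/
inductive Scheme where
  | bdf
  | gngf

noncomputable section

/-- The coefficients `g_k^{(α)}`, `0 ≤ k ≤ 5`, of the generalized Newton-Gregory formulas. -/
def gngfCoeff (α : ℝ) : ℕ → ℝ
  | 0 => 1
  | 1 => α / 2
  | 2 => α ^ 2 / 8 + 5 * α / 24
  | 3 => α ^ 3 / 48 + 5 * α ^ 2 / 48 + α / 8
  | 4 => α ^ 4 / 384 + 5 * α ^ 3 / 192 + 97 * α ^ 2 / 1152 + 251 * α / 2880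
  | 5 => α ^ 5 / 3840 + 5 * α ^ 4 / 1152 + 61 * α ^ 3 / 2304 + 401 * α ^ 2 / 5760
      + 19 * α / 288
  | _ => 0

/-- The generating function `ω(p, α, τ, ξ)`. Powers are principal: for `ξ` near `0` (and
`τ > 0`) the bases are close to the positive real axis. -/
def genFun (m : Scheme) (p : ℕ) (α τ : ℝ) (ξ : ℂ) : ℂ :=
  match m with
  | .bdf => ((1 / (τ : ℂ)) * ∑ k ∈ Finset.Icc 1 p, (1 / (k : ℂ)) * (1 - ξ) ^ k) ^ (α : ℂ)
  | .gngf => ((1 - ξ) / (τ : ℂ)) ^ (α : ℂ) *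
      ∑ k ∈ Finset.range p, (gngfCoeff α k : ℂ) * (1 - ξ) ^ k

/-- The convolution weight `ω_n`: the `n`-th Taylor coefficient of the generating function
at `ξ = 0`. -/
def convWeight (m : Scheme) (p : ℕ) (α τ : ℝ) (n : ℕ) : ℂ :=
  iteratedDeriv n (genFun m p α τ) 0 / (n.factorial : ℂ)

/-- The polynomial `P_p(z) = ∑_{k=1}^p z^{k-1} / k`. -/
def bdfPoly (p : ℕ) : Polynomial ℂ :=
  ∑ k ∈ Finset.Icc 1 p, Polynomial.C (1 / (k : ℂ)) * Polynomial.X ^ (k - 1)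

/-- The branch of `P_p(z)^α` obtained from the value `1` at `z = 0` by continuation along the
rays from the origin. Since `P_p(z) = ∏ (1 - z / r)` over the zeros `r` of `P_p` (with
multiplicity) this is `∏ (1 - z / r)^α` with principal powers; its branch cuts are the rays from
the zeros `r` radially to infinity, and on the positive axis it is the positive power. -/
def bdfPolyPow (p : ℕ) (α : ℝ) (z : ℂ) : ℂ :=
  ((bdfPoly p).roots.map fun r => (1 - z / r) ^ (α : ℂ)).prod

/-- The function `F_ω(λ) = ω(p, α, τ, 1 - τ λ)`, continued off a neighbourhood of the positive
axis: `λ^α (∑_{k=1}^p (τλ)^{k-1} / k)^α` or `λ^α ∑_{k=0}^{p-1} g_k^{(α)} (τλ)^k`. -/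
def Fomega (m : Scheme) (p : ℕ) (α τ : ℝ) (z : ℂ) : ℂ :=
  match m with
  | .bdf => z ^ (α : ℂ) * bdfPolyPow p α ((τ : ℂ) * z)
  | .gngf => z ^ (α : ℂ) * ∑ k ∈ Finset.range p, (gngfCoeff α k : ℂ) * ((τ : ℂ) * z) ^ k

/-- The open sector `|arg λ| < π - φ`, without its apex. -/
def sector (φ : ℝ) : Set ℂ := {z : ℂ | z ≠ 0 ∧ |z.arg| < π - φ}

/-- The hyperbolic contour `w ↦ μ (1 - sin (ψ + i w)) + σ`. -/
def hyperbola (μ ψ σ : ℝ) (w : ℂ) : ℂ :=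
  (μ : ℂ) * (1 - Complex.sin ((ψ : ℂ) + Complex.I * w)) + (σ : ℂ)

/-- The parameters `θ_k = (k + 1/2) h` of the trapezoidal rule. -/
def nodeParam (h : ℝ) (k : ℤ) : ℝ := ((k : ℝ) + 1 / 2) * h

/-- The quadrature points `λ_k`. -/
def quadPoint (μ ψ σ h : ℝ) (k : ℤ) : ℂ := hyperbola μ ψ σ (nodeParam h k : ℂ)

/-- The quadrature weights `w_k`: the derivative of the contour at `θ_k`, times the normalization
`-h / (2π)` of the trapezoidal rule. The step is `h`; the integral carries the factor
`1 / (2πi)`, of which `1 / i` is accounted for by taking the imaginary part of the sum; the sign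
is there because `θ ↦ λ(θ)` is traversed with decreasing imaginary part, while the integral
for `ω_n` is taken with increasing imaginary part. -/
def quadWeight (μ ψ σ h : ℝ) (k : ℤ) : ℂ :=
  -((h / (2 * π) : ℝ) : ℂ) * deriv (hyperbola μ ψ σ) (nodeParam h k : ℂ)

/-- The trapezoidal approximation `ω̂_n` of
`ω_n = τ / (2πi) ∫ (1 - λτ)^{-1-n} F_ω(λ) dλ` on the hyperbolic contour. -/
def approxWeight (m : Scheme) (p : ℕ) (α τ μ ψ σ h : ℝ) (N n : ℕ) : ℝ :=
  ((τ : ℂ) * ∑ k ∈ Finset.Ico (-(N : ℤ)) (N : ℤ),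
    quadWeight μ ψ σ h k * (1 - quadPoint μ ψ σ h k * (τ : ℂ)) ^ (-1 - (n : ℤ)) *
      Fomega m p α τ (quadPoint μ ψ σ h k)).im

/-- The admissibility condition on `Q`:
`(τλ)^{1+α} λ^{-α} F_ω(λ) / (1 - τλ)^{Q+1}` is bounded for `λ = λ(w)`, `-d ≤ Im w ≤ d`. -/
def QBounded (m : Scheme) (p : ℕ) (α τ μ ψ σ d Q : ℝ) : Prop :=
  ∃ M : ℝ, ∀ w : ℂ, -d ≤ w.im → w.im ≤ d →
    ‖((τ : ℂ) * hyperbola μ ψ σ w) ^ ((1 + α : ℝ) : ℂ) *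
        (hyperbola μ ψ σ w) ^ ((-α : ℝ) : ℂ) * Fomega m p α τ (hyperbola μ ψ σ w) /
        (1 - (τ : ℂ) * hyperbola μ ψ σ w) ^ ((Q + 1 : ℝ) : ℂ)‖ ≤ M

end

/-!
Multiplying `λ`, `μ` and `σ` by `τ` reduces everything to `τ = 1`, at the price of the factor
`τ ^ (-α)`; then `F_ω(z) = Φ(z) = z ^ α ∏ (1 - z / r) ^ β`, with `β = α` and the zeros `r` of `P_p`
for BDF, `β = 1` and the zeros of the truncated expansion for GNGF (`Fomega_eq_rootSymbol`). If
`β < 0`, holomorphy in the sector keeps the `r` out of it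
(`notMem_of_continuousOn_rootSymbol`), so that on the narrower cone that contains the contours
`‖z‖ ‖Φ(z)‖ ≤ C (1 + ‖z‖) ^ (1 + α + β · #r)` (`norm_mul_rootSymbol_le`). Admissibility of `Q` gives
`α + β · #r ≤ Q` (`exponent_le_of_qBounded`), which makes this bound, unlike the one in the
admissibility condition itself, independent of `τ`, `μ` and `σ`. The integrand is therefore
`O(‖1 - λ‖ ^ (Q - n))` uniformly (`norm_integrand_le`).

The weight `ω_n` is the integral over the hyperbola (`integral_hyperbola_eq`): in the plane of the
parameter `w` the line `Im w = ψ + π / 2` is mapped onto a ray of the real axis, covered twice in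
opposite directions, so the integral of the holomorphic part of the integrand vanishes there, and
the principal part is integrated explicitly. The trapezoidal error is controlled by Poisson
summation and a shift of the line of integration by `± d` (`norm_integral_sub_trapezoid_le`).

What remains is the size of `‖1 - λ‖ ^ (Q - n)`, with `x = cosh u` and `μ n ≥ 2 / 3`. Where
`μ x ≤ 12`, `‖1 - λ‖ ≥ exp (-4 (μ + σ) + a₂ μ x)` and the power is at most a constant times
`exp (4 μ n - a₂ μ n x)` (`rpow_neg_le_near`). Where `μ x > 12`, `‖1 - λ‖` exceeds `1 + 3 μ x / 4`
by a fixed factor (`rpow_neg_le_far`). Both bounds leave room for a factor `exp (-q |u|)`, where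
`q = ⌊Q⌋ + 1 - Q` is a positive lower bound of `n - Q`. With `x` replaced by `cosh (N h)` this
gives the two truncation terms, with `x` replaced by `1` the factor of the quadrature term
(`exists_norm_integrand_le`).
-/

noncomputable section

/-! ### The cone and the hyperbola -/

/-- The closed cone that consists of `0` and the points `z` with `cos (arg z) ≥ -k`. -/
def cone (k : ℝ) : Set ℂ := {z : ℂ | -k * ‖z‖ ≤ z.re}

lemma mem_sector_of_mem_cone {φ k : ℝ} (hφ0 : 0 ≤ φ) (hφ : φ < π / 2) (hk : k < Real.cos φ) {z : ℂ}
    (hz : z ∈ cone k) (hz0 : z ≠ 0) : z ∈ sector φ := by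
  refine ⟨hz0, ?_⟩
  by_contra! h
  have h1 : Real.cos |z.arg| ≤ Real.cos (π - φ) :=
    Real.cos_le_cos_of_nonneg_of_le_pi (by linarith) (Complex.abs_arg_le_pi z) h
  rw [Real.cos_abs, Real.cos_pi_sub] at h1
  have h2 := Complex.norm_mul_cos_arg z
  have h3 : 0 < ‖z‖ := norm_pos_iff.2 hz0
  have h4 : -k * ‖z‖ ≤ z.re := hz
  nlinarith

lemma re_le_of_notMem_sector {φ : ℝ} (hφ0 : 0 ≤ φ) (hφ : φ < π / 2) {z : ℂ}
    (hz : z ∉ sector φ) : z.re ≤ -Real.cos φ * ‖z‖ := by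
  rcases eq_or_ne z 0 with rfl | hz0
  · simp
  have h : π - φ ≤ |z.arg| := by
    by_contra! h
    exact hz ⟨hz0, h⟩
  have h1 : Real.cos |z.arg| ≤ Real.cos (π - φ) :=
    Real.cos_le_cos_of_nonneg_of_le_pi (by linarith) (Complex.abs_arg_le_pi z) h
  rw [Real.cos_abs, Real.cos_pi_sub] at h1
  have h2 := Complex.norm_mul_cos_arg z
  have h3 : 0 < ‖z‖ := norm_pos_iff.2 hz0
  nlinarith

lemma isOpen_sector (φ : ℝ) (hφ0 : 0 ≤ φ) (hφ : φ < π / 2) : IsOpen (sector φ) := by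
  have : sector φ = {z : ℂ | -Real.cos φ * ‖z‖ < z.re} := by
    ext z
    constructor
    · rintro ⟨hz0, h⟩
      have h1 : Real.cos (π - φ) < Real.cos |z.arg| :=
        Real.cos_lt_cos_of_nonneg_of_le_pi (abs_nonneg _) (by linarith) h
      rw [Real.cos_abs, Real.cos_pi_sub] at h1
      have h2 := Complex.norm_mul_cos_arg z
      have h3 : 0 < ‖z‖ := norm_pos_iff.2 hz0
      change -Real.cos φ * ‖z‖ < z.re
      nlinarith
    · intro h
      by_contra hc
      exact absurd (re_le_of_notMem_sector hφ0 hφ hc) (not_le.2 h)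
  rw [this]
  exact isOpen_lt (by fun_prop) (by fun_prop)

/-- A point of a cone stays away, relative to its size, from the points outside a larger
sector: adding `‖z‖ - ‖r‖ ≤ ‖z - r‖`, `k` times, to `k₀‖r‖ - k‖z‖ ≤ Re (z - r) ≤ ‖z - r‖` leaves
`(k₀ - k)‖r‖`. -/
lemma norm_sub_ge_of_mem_cone {k k₀ : ℝ} (hk0 : 0 ≤ k) (hk : k < k₀) {z r : ℂ} (hz : z ∈ cone k)
    (hr : r.re ≤ -k₀ * ‖r‖) :
    ‖z‖ + ‖r‖ ≤ (1 + 2 * (1 + k) / (k₀ - k)) * ‖z - r‖ := by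
  have h1 : -k * ‖z‖ ≤ z.re := hz
  have h2 : (z - r).re ≤ ‖z - r‖ := Complex.re_le_norm _
  have h3 := norm_sub_norm_le z r
  rw [Complex.sub_re] at h2
  have h4 : (k₀ - k) * ‖r‖ ≤ (1 + k) * ‖z - r‖ := by nlinarith
  have h5 : ‖r‖ ≤ (1 + k) / (k₀ - k) * ‖z - r‖ := by
    rw [div_mul_eq_mul_div, le_div_iff₀ (by linarith)]
    linarith
  calc ‖z‖ + ‖r‖ ≤ ‖z - r‖ + 2 * ‖r‖ := by linarith
    _ ≤ ‖z - r‖ + 2 * ((1 + k) / (k₀ - k) * ‖z - r‖) := by linarith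
    _ = _ := by ring

lemma sq_norm_eq_add_sq (z : ℂ) : ‖z‖ ^ 2 = z.re ^ 2 + z.im ^ 2 := by
  rw [← Complex.normSq_eq_norm_sq, Complex.normSq_apply]
  ring

lemma hyperbola_re (μ ψ σ : ℝ) (w : ℂ) : (hyperbola μ ψ σ w).re =
    μ * (1 - Real.sin (ψ - w.im) * Real.cosh w.re) + σ := by
  have h : (ψ : ℂ) + Complex.I * w = ((ψ - w.im : ℝ) : ℂ) + ((w.re : ℝ) : ℂ) * Complex.I := by
    apply Complex.ext <;> simp [sub_eq_add_neg]
  rw [hyperbola, h, Complex.sin_add_mul_I, ← Complex.ofReal_sin, ← Complex.ofReal_cos,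
    ← Complex.ofReal_sinh, ← Complex.ofReal_cosh]
  simp [-Complex.ofReal_sin, -Complex.ofReal_cos, -Complex.ofReal_sinh, -Complex.ofReal_cosh]

lemma hyperbola_im (μ ψ σ : ℝ) (w : ℂ) : (hyperbola μ ψ σ w).im =
    -(μ * (Real.cos (ψ - w.im) * Real.sinh w.re)) := by
  have h : (ψ : ℂ) + Complex.I * w = ((ψ - w.im : ℝ) : ℂ) + ((w.re : ℝ) : ℂ) * Complex.I := by
    apply Complex.ext <;> simp [sub_eq_add_neg]
  rw [hyperbola, h, Complex.sin_add_mul_I, ← Complex.ofReal_sin, ← Complex.ofReal_cos,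
    ← Complex.ofReal_sinh, ← Complex.ofReal_cosh]
  simp [-Complex.ofReal_sin, -Complex.ofReal_cos, -Complex.ofReal_sinh, -Complex.ofReal_cosh]

lemma hyperbola_eq_add (μ ψ σ : ℝ) (w : ℂ) :
    hyperbola μ ψ σ w = hyperbola μ ψ 0 w + σ := by
  simp [hyperbola]

lemma norm_hyperbola_zero {μ : ℝ} (hμ : 0 ≤ μ) (ψ : ℝ) (w : ℂ) :
    ‖hyperbola μ ψ 0 w‖ = μ * (Real.cosh w.re - Real.sin (ψ - w.im)) := by
  have h1 : ‖hyperbola μ ψ 0 w‖ ^ 2 = _ := sq_norm_eq_add_sq _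
  rw [hyperbola_re, hyperbola_im] at h1
  have h2 : 0 ≤ μ * (Real.cosh w.re - Real.sin (ψ - w.im)) :=
    mul_nonneg hμ (by linarith [Real.one_le_cosh w.re, Real.sin_le_one (ψ - w.im)])
  have h3 := Real.cosh_sq w.re
  have h4 := Real.sin_sq_add_cos_sq (ψ - w.im)
  rw [← sq_eq_sq₀ (norm_nonneg _) h2, h1]
  have h5 : Real.cos (ψ - w.im) ^ 2 = 1 - Real.sin (ψ - w.im) ^ 2 := by linarith
  have h6 : Real.sinh w.re ^ 2 = Real.cosh w.re ^ 2 - 1 := by linarith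
  calc _ = μ ^ 2 * ((1 - Real.sin (ψ - w.im) * Real.cosh w.re) ^ 2
        + Real.cos (ψ - w.im) ^ 2 * Real.sinh w.re ^ 2) := by ring
    _ = _ := by rw [h5, h6]; ring

lemma hyperbola_zero_mem_cone {μ : ℝ} (hμ : 0 ≤ μ) {ψ k : ℝ} {w : ℂ}
    (hk : Real.sin (ψ - w.im) ≤ k) : hyperbola μ ψ 0 w ∈ cone k := by
  change -k * ‖hyperbola μ ψ 0 w‖ ≤ _
  rw [norm_hyperbola_zero hμ, hyperbola_re]
  have h1 := Real.sin_sq_add_cos_sq (ψ - w.im)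
  have h2 : 0 ≤ Real.cosh w.re - Real.sin (ψ - w.im) := by
    linarith [Real.one_le_cosh w.re, Real.sin_le_one (ψ - w.im)]
  have h3 : 0 ≤ (k - Real.sin (ψ - w.im)) * (Real.cosh w.re - Real.sin (ψ - w.im)) :=
    mul_nonneg (by linarith) h2
  have h4 : -k * (Real.cosh w.re - Real.sin (ψ - w.im)) ≤
      1 - Real.sin (ψ - w.im) * Real.cosh w.re := by
    nlinarith [sq_nonneg (Real.cos (ψ - w.im))]
  nlinarith [mul_le_mul_of_nonneg_left h4 hμ]

lemma hyperbola_mem_cone {μ σ : ℝ} (hμ : 0 ≤ μ) (hσ : 0 ≤ σ) {ψ k : ℝ} {w : ℂ} (hk0 : 0 ≤ k)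
    (hk1 : k ≤ 1) (hk : Real.sin (ψ - w.im) ≤ k) : hyperbola μ ψ σ w ∈ cone k := by
  have h : -k * ‖hyperbola μ ψ 0 w‖ ≤ (hyperbola μ ψ 0 w).re := hyperbola_zero_mem_cone hμ hk
  change -k * ‖hyperbola μ ψ σ w‖ ≤ (hyperbola μ ψ σ w).re
  have h1 : ‖hyperbola μ ψ 0 w‖ ≤ ‖hyperbola μ ψ σ w‖ + σ := by
    have := norm_sub_le (hyperbola μ ψ σ w) (σ : ℂ)
    rwa [hyperbola_eq_add, add_sub_cancel_right, ← hyperbola_eq_add, Complex.norm_real,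
      Real.norm_of_nonneg hσ] at this
  have h2 : (hyperbola μ ψ σ w).re = (hyperbola μ ψ 0 w).re + σ := by
    rw [hyperbola_eq_add]; simp
  rw [h2]
  nlinarith

/-- On the part `sin (ψ - Im w) ≤ k` of the parameter plane, `‖λ(w)‖` is bounded below by a
multiple of `σ + μ cosh (Re w)`. -/
lemma norm_hyperbola_ge {μ σ : ℝ} (hμ : 0 ≤ μ) (hσ : 0 ≤ σ) {ψ k : ℝ} {w : ℂ} (hk0 : 0 ≤ k)
    (hk1 : k < 1) (hk : Real.sin (ψ - w.im) ≤ k) :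
    (1 - k) * (σ + μ * Real.cosh w.re) ≤ (1 + 2 * (1 + k) / (1 - k)) * ‖hyperbola μ ψ σ w‖ := by
  have h := norm_sub_ge_of_mem_cone hk0 hk1 (hyperbola_zero_mem_cone (μ := μ) hμ hk)
    (r := ((-σ : ℝ) : ℂ)) (by
      rw [Complex.norm_real, Real.norm_eq_abs, abs_neg, abs_of_nonneg hσ, Complex.ofReal_re]
      linarith)
  rw [Complex.norm_real, Real.norm_eq_abs, abs_neg, abs_of_nonneg hσ, norm_hyperbola_zero hμ,
    Complex.ofReal_neg, sub_neg_eq_add, ← hyperbola_eq_add] at h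
  refine le_trans ?_ h
  have h1 : (1 - k) * Real.cosh w.re ≤ Real.cosh w.re - Real.sin (ψ - w.im) := by
    nlinarith [Real.one_le_cosh w.re]
  nlinarith [mul_le_mul_of_nonneg_left h1 hμ]

lemma norm_hyperbola_le {μ σ : ℝ} (hμ : 0 ≤ μ) (hσ : 0 ≤ σ) (ψ : ℝ) (w : ℂ) :
    ‖hyperbola μ ψ σ w‖ ≤ σ + 2 * μ * Real.cosh w.re := by
  rw [hyperbola_eq_add]
  refine (norm_add_le _ _).trans ?_
  rw [norm_hyperbola_zero hμ, Complex.norm_real, Real.norm_of_nonneg hσ]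
  nlinarith [Real.one_le_cosh w.re, Real.neg_one_le_sin (ψ - w.im)]

lemma hasDerivAt_hyperbola (μ ψ σ : ℝ) (w : ℂ) : HasDerivAt (hyperbola μ ψ σ)
    (-(μ * Complex.I) * Complex.cos (ψ + Complex.I * w)) w := by
  have h1 : HasDerivAt (fun w : ℂ => (ψ : ℂ) + Complex.I * w) Complex.I w := by
    simpa using ((hasDerivAt_id w).const_mul Complex.I).const_add (ψ : ℂ)
  have h2 := ((((Complex.hasDerivAt_sin _).comp w h1).const_sub 1).const_mul (μ : ℂ)).add_const
    (σ : ℂ)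
  refine h2.congr_deriv ?_
  ring

lemma deriv_hyperbola (μ ψ σ : ℝ) (w : ℂ) : deriv (hyperbola μ ψ σ) w =
    -(μ * Complex.I) * Complex.cos (ψ + Complex.I * w) :=
  (hasDerivAt_hyperbola μ ψ σ w).deriv

lemma differentiable_hyperbola (μ ψ σ : ℝ) : Differentiable ℂ (hyperbola μ ψ σ) :=
  fun w => (hasDerivAt_hyperbola μ ψ σ w).differentiableAt

lemma differentiable_deriv_hyperbola (μ ψ σ : ℝ) :
    Differentiable ℂ (deriv (hyperbola μ ψ σ)) := by
  have : deriv (hyperbola μ ψ σ) =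
      fun w => -(μ * Complex.I) * Complex.cos (ψ + Complex.I * w) :=
    funext (deriv_hyperbola μ ψ σ)
  rw [this]
  fun_prop

lemma norm_deriv_hyperbola_le {μ : ℝ} (hμ : 0 ≤ μ) (ψ σ : ℝ) (w : ℂ) :
    ‖deriv (hyperbola μ ψ σ) w‖ ≤ μ * Real.cosh w.re := by
  have h : (ψ : ℂ) + Complex.I * w = ((ψ - w.im : ℝ) : ℂ) + ((w.re : ℝ) : ℂ) * Complex.I := by
    apply Complex.ext <;> simp [sub_eq_add_neg]
  rw [deriv_hyperbola, norm_mul, norm_neg, norm_mul, Complex.norm_I, mul_one, Complex.norm_real,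
    Real.norm_of_nonneg hμ]
  refine mul_le_mul_of_nonneg_left ?_ hμ
  have h1 := sq_norm_eq_add_sq (Complex.cos (ψ + Complex.I * w))
  rw [h, Complex.cos_add_mul_I, ← Complex.ofReal_sin, ← Complex.ofReal_cos,
    ← Complex.ofReal_sinh, ← Complex.ofReal_cosh] at h1
  rw [h, Complex.cos_add_mul_I, ← Complex.ofReal_sin, ← Complex.ofReal_cos,
    ← Complex.ofReal_sinh, ← Complex.ofReal_cosh]
  simp only [Complex.sub_re, Complex.sub_im, Complex.re_ofReal_mul, Complex.im_ofReal_mul,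
    Complex.mul_I_re, Complex.mul_I_im, Complex.ofReal_re, Complex.ofReal_im,
    mul_zero, neg_zero, sub_zero, zero_sub] at h1
  refine (sq_le_sq₀ (norm_nonneg _) (Real.cosh_pos _).le).1 ?_
  rw [h1]
  have h3 := Real.cosh_sq w.re
  have h4 := Real.sin_sq_add_cos_sq (ψ - w.im)
  have h5 : Real.sin (ψ - w.im) ^ 2 = 1 - Real.cos (ψ - w.im) ^ 2 := by linarith
  have h6 : Real.sinh w.re ^ 2 = Real.cosh w.re ^ 2 - 1 := by linarith
  rw [neg_sq, mul_pow, mul_pow, h5, h6]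
  nlinarith [sq_nonneg (Real.cos (ψ - w.im)), Real.cos_sq_le_one (ψ - w.im)]

lemma exp_abs_le_two_mul_cosh (u : ℝ) : Real.exp |u| ≤ 2 * Real.cosh u := by
  rw [← Real.cosh_abs, Real.cosh_eq]
  linarith [Real.exp_pos (-|u|)]

/-! ### Products of powers of linear factors -/

lemma rpow_le_of_comparable {a x B : ℝ} (ha : 0 < a) (hB : 1 ≤ B) (h1 : a ≤ B * x)
    (h2 : x ≤ B * a) (e : ℝ) : x ^ e ≤ B ^ |e| * a ^ e := by
  have hB0 : 0 < B := by linarith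
  have hx : 0 < x := by
    by_contra! h
    nlinarith
  rcases le_total 0 e with he | he
  · rw [abs_of_nonneg he, ← Real.mul_rpow hB0.le ha.le]
    exact Real.rpow_le_rpow hx.le h2 he
  · rw [abs_of_nonpos he]
    have h3 : (B * x) ^ e ≤ a ^ e := Real.rpow_le_rpow_of_nonpos ha h1 he
    rw [Real.mul_rpow hB0.le hx.le] at h3
    calc x ^ e = B ^ (-e) * (B ^ e * x ^ e) := by
          rw [← mul_assoc, ← Real.rpow_add hB0]; simp
      _ ≤ _ := mul_le_mul_of_nonneg_left h3 (by positivity)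

lemma le_rpow_of_comparable {a x B : ℝ} (ha : 0 < a) (hB : 1 ≤ B) (h1 : a ≤ B * x)
    (h2 : x ≤ B * a) (e : ℝ) : B ^ (-|e|) * a ^ e ≤ x ^ e := by
  have hB0 : 0 < B := by linarith
  have hx : 0 < x := by
    by_contra! h
    nlinarith
  have h3 := rpow_le_of_comparable hx hB h2 h1 e
  calc B ^ (-|e|) * a ^ e ≤ B ^ (-|e|) * (B ^ |e| * x ^ e) :=
        mul_le_mul_of_nonneg_left h3 (by positivity)
    _ = x ^ e := by rw [← mul_assoc, ← Real.rpow_add hB0]; simp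

/-- The product `∏ (1 - z / r) ^ β` of principal powers over a multiset of complex numbers. -/
def rootProd (s : Multiset ℂ) (β : ℝ) (z : ℂ) : ℂ :=
  (s.map fun r => (1 - z / r) ^ (β : ℂ)).prod

@[simp] lemma rootProd_zero (β : ℝ) (z : ℂ) : rootProd 0 β z = 1 := by simp [rootProd]

lemma rootProd_cons (r : ℂ) (s : Multiset ℂ) (β : ℝ) (z : ℂ) :
    rootProd (r ::ₘ s) β z = (1 - z / r) ^ (β : ℂ) * rootProd s β z := by simp [rootProd]

lemma norm_rootProd_cons (r : ℂ) (s : Multiset ℂ) (β : ℝ) (z : ℂ) :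
    ‖rootProd (r ::ₘ s) β z‖ = ‖1 - z / r‖ ^ β * ‖rootProd s β z‖ := by
  rw [rootProd_cons, norm_mul, Complex.norm_cpow_real]

lemma norm_one_sub_div {r : ℂ} (hr : r ≠ 0) (z : ℂ) : ‖1 - z / r‖ = ‖z - r‖ / ‖r‖ := by
  rw [← norm_div, ← norm_neg]
  congr 1
  field_simp
  ring

lemma norm_one_sub_div_le {r : ℂ} (hr : r ≠ 0) (z : ℂ) :
    ‖1 - z / r‖ ≤ (1 + 1 / ‖r‖) * (1 + ‖z‖) := by
  have h0 : 0 < ‖r‖ := norm_pos_iff.2 hr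
  rw [norm_one_sub_div hr, div_le_iff₀ h0]
  have := norm_sub_le z r
  have h1 : (1 + 1 / ‖r‖) * (1 + ‖z‖) * ‖r‖ = (‖r‖ + 1) * (1 + ‖z‖) := by field_simp
  rw [h1]
  nlinarith [norm_nonneg z]

lemma norm_rootProd_le {k k₀ β : ℝ} (hk0 : 0 ≤ k) (hk : k < k₀) (s : Multiset ℂ)
    (hs : ∀ r ∈ s, r ≠ 0) (h : 0 ≤ β ∨ ∀ r ∈ s, r.re ≤ -k₀ * ‖r‖) :
    ∃ C : ℝ, 0 < C ∧ ∀ z ∈ cone k, ‖rootProd s β z‖ ≤ C * (1 + ‖z‖) ^ (β * s.card) := by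
  induction s using Multiset.induction_on with
  | empty => exact ⟨1, one_pos, fun z _ => by simp⟩
  | cons r s ih =>
    obtain ⟨C, hC, hb⟩ := ih (fun r' h' => hs r' (Multiset.mem_cons_of_mem h'))
      (h.imp_right fun h r' h' => h r' (Multiset.mem_cons_of_mem h'))
    have hr : r ≠ 0 := hs r (Multiset.mem_cons_self r s)
    have hr0 : 0 < ‖r‖ := norm_pos_iff.2 hr
    have key : ∃ B : ℝ, 0 < B ∧ ∀ z ∈ cone k, ‖1 - z / r‖ ^ β ≤ B * (1 + ‖z‖) ^ β := by
      rcases h with h | h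
      · refine ⟨(1 + 1 / ‖r‖) ^ β, by positivity, fun z _ => ?_⟩
        rw [← Real.mul_rpow (by positivity) (by positivity)]
        exact Real.rpow_le_rpow (norm_nonneg _) (norm_one_sub_div_le hr z) h
      · set c := 1 + 2 * (1 + k) / (k₀ - k) with hc
        have hc1 : 1 ≤ c := by
          rw [hc]
          have : 0 ≤ 2 * (1 + k) / (k₀ - k) := div_nonneg (by linarith) (by linarith)
          linarith
        have hm : 1 ≤ max (c * (1 + ‖r‖)) (1 + 1 / ‖r‖) :=
          le_max_of_le_right (by simp)
        refine ⟨(max (c * (1 + ‖r‖)) (1 + 1 / ‖r‖)) ^ |β|, by positivity, fun z hz => ?_⟩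
        refine rpow_le_of_comparable (by positivity) hm ?_ ?_ β
        · refine le_trans ?_ (mul_le_mul_of_nonneg_right (le_max_left _ _) (norm_nonneg _))
          have h1 := norm_sub_ge_of_mem_cone hk0 hk hz (h r (Multiset.mem_cons_self r s))
          rw [norm_one_sub_div hr, ← mul_div_assoc, le_div_iff₀ hr0]
          have h2 : (1 + ‖z‖) * ‖r‖ ≤ (1 + ‖r‖) * (‖z‖ + ‖r‖) := by
            nlinarith [norm_nonneg z, sq_nonneg ‖r‖]
          calc _ ≤ _ := h2
            _ ≤ (1 + ‖r‖) * (c * ‖z - r‖) := by gcongr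
            _ = _ := by ring
        · exact (norm_one_sub_div_le hr z).trans
            (mul_le_mul_of_nonneg_right (le_max_right _ _) (by positivity))
    obtain ⟨B, hB, hBb⟩ := key
    refine ⟨B * C, by positivity, fun z hz => ?_⟩
    rw [norm_rootProd_cons, Multiset.card_cons]
    have : (1 + ‖z‖) ^ (β * ((s.card + 1 : ℕ) : ℝ)) =
        (1 + ‖z‖) ^ β * (1 + ‖z‖) ^ (β * s.card) := by
      rw [← Real.rpow_add (by positivity)]
      congr 1
      push_cast
      ring
    rw [this]
    calc _ ≤ (B * (1 + ‖z‖) ^ β) * (C * (1 + ‖z‖) ^ (β * s.card)) :=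
          mul_le_mul (hBb z hz) (hb z hz) (norm_nonneg _) (by positivity)
      _ = _ := by ring

lemma norm_rootProd_ge (β : ℝ) (s : Multiset ℂ) (hs : ∀ r ∈ s, r ≠ 0) :
    ∃ c R : ℝ, 0 < c ∧ 1 ≤ R ∧ ∀ z : ℂ, R ≤ ‖z‖ →
      c * ‖z‖ ^ (β * s.card) ≤ ‖rootProd s β z‖ := by
  induction s using Multiset.induction_on with
  | empty => exact ⟨1, 1, one_pos, le_rfl, fun z _ => by simp⟩
  | cons r s ih =>
    obtain ⟨c, R, hc, hR, hb⟩ := ih (fun r' h' => hs r' (Multiset.mem_cons_of_mem h'))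
    have hr : r ≠ 0 := hs r (Multiset.mem_cons_self r s)
    have hr0 : 0 < ‖r‖ := norm_pos_iff.2 hr
    have hm : 1 ≤ max 1 (max (2 * ‖r‖) (2 / ‖r‖)) := le_max_left _ _
    refine ⟨max 1 (max (2 * ‖r‖) (2 / ‖r‖)) ^ (-|β|) * c, max R (2 * ‖r‖), by positivity,
      le_max_of_le_left hR, fun z hz => ?_⟩
    have hz1 : R ≤ ‖z‖ := (le_max_left _ _).trans hz
    have hz2 : 2 * ‖r‖ ≤ ‖z‖ := (le_max_right _ _).trans hz
    have hz0 : 0 < ‖z‖ := by linarith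
    rw [norm_rootProd_cons, Multiset.card_cons]
    have : ‖z‖ ^ (β * ((s.card + 1 : ℕ) : ℝ)) = ‖z‖ ^ β * ‖z‖ ^ (β * s.card) := by
      rw [← Real.rpow_add (by positivity)]
      congr 1
      push_cast
      ring
    rw [this]
    have h1 : max 1 (max (2 * ‖r‖) (2 / ‖r‖)) ^ (-|β|) * ‖z‖ ^ β ≤ ‖1 - z / r‖ ^ β := by
      refine le_rpow_of_comparable hz0 hm ?_ ?_ β
      · refine le_trans ?_ (mul_le_mul_of_nonneg_right
          ((le_max_left (2 * ‖r‖) (2 / ‖r‖)).trans (le_max_right 1 _)) (norm_nonneg _))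
        rw [norm_one_sub_div hr, ← mul_div_assoc, le_div_iff₀ hr0]
        have := norm_sub_norm_le z r
        nlinarith
      · refine le_trans ?_ (mul_le_mul_of_nonneg_right
          ((le_max_right (2 * ‖r‖) (2 / ‖r‖)).trans (le_max_right 1 _)) (norm_nonneg _))
        rw [norm_one_sub_div hr, div_mul_eq_mul_div]
        gcongr
        have := norm_sub_le z r
        linarith
    calc _ = (max 1 (max (2 * ‖r‖) (2 / ‖r‖)) ^ (-|β|) * ‖z‖ ^ β) *
          (c * ‖z‖ ^ (β * s.card)) := by ring
      _ ≤ _ := mul_le_mul h1 (hb z hz1) (by positivity) (by positivity)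

lemma continuous_norm_rootProd {β : ℝ} (hβ : 0 ≤ β) (s : Multiset ℂ) :
    Continuous fun z => ‖rootProd s β z‖ := by
  induction s using Multiset.induction_on with
  | empty => simpa using continuous_const
  | cons r s ih =>
    simp_rw [norm_rootProd_cons]
    refine Continuous.mul (Continuous.rpow_const (by fun_prop) fun _ => Or.inr hβ) ih

lemma norm_rootProd_mul_neg (β : ℝ) (s : Multiset ℂ) (z : ℂ) (h : ∀ r ∈ s, r ≠ 0 ∧ z ≠ r) :
    ‖rootProd s β z‖ * ‖rootProd s (-β) z‖ = 1 := by
  induction s using Multiset.induction_on with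
  | empty => simp
  | cons r s ih =>
    have h1 := ih fun r' h' => h r' (Multiset.mem_cons_of_mem h')
    obtain ⟨hr, hzr⟩ := h r (Multiset.mem_cons_self r s)
    have h2 : 0 < ‖1 - z / r‖ := by
      rw [norm_one_sub_div hr]
      exact div_pos (norm_pos_iff.2 (sub_ne_zero.2 hzr)) (norm_pos_iff.2 hr)
    rw [norm_rootProd_cons, norm_rootProd_cons]
    calc _ = (‖1 - z / r‖ ^ β * ‖1 - z / r‖ ^ (-β)) *
          (‖rootProd s β z‖ * ‖rootProd s (-β) z‖) := by ring
      _ = 1 := by rw [h1, ← Real.rpow_add h2]; simp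

lemma norm_rootProd_eq_zero {β : ℝ} (hβ : 0 < β) {s : Multiset ℂ} {r : ℂ} (hr : r ∈ s)
    (hr0 : r ≠ 0) : ‖rootProd s β r‖ = 0 := by
  obtain ⟨t, rfl⟩ := Multiset.exists_cons_of_mem hr
  rw [norm_rootProd_cons, div_self hr0]
  simp [Real.zero_rpow hβ.ne']

/-- The function `z ^ α * ∏ (1 - z / r) ^ β`. Up to the factor `τ ^ (-α)`, and with the right
`s` and `β`, it is `F_ω` as a function of `z = τ λ`. -/
def rootSymbol (α : ℝ) (s : Multiset ℂ) (β : ℝ) (z : ℂ) : ℂ := z ^ (α : ℂ) * rootProd s β z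

/-- If `z ^ α * ∏ (1 - z / r) ^ β` is continuous in an open set and `β < 0`, then none of the `r`
lies in this set: the function would be unbounded near it. -/
lemma notMem_of_continuousOn_rootSymbol {α β : ℝ} {s : Multiset ℂ} {U : Set ℂ} (hU : IsOpen U)
    (hβ : β < 0) (hs : ∀ r ∈ s, r ≠ 0) (h : ContinuousOn (rootSymbol α s β) U) {r : ℂ}
    (hr : r ∈ s) : r ∉ U := by
  intro hrU
  have hr0 := hs r hr
  have h1 : ContinuousAt (rootSymbol α s β) r := h.continuousAt (hU.mem_nhds hrU)
  have h2 : Filter.Tendsto (fun z => ‖rootSymbol α s β z‖ * ‖rootProd s (-β) z‖)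
      (nhdsWithin r {r}ᶜ) (nhds (‖rootSymbol α s β r‖ * ‖rootProd s (-β) r‖)) :=
    (h1.norm.mul (continuous_norm_rootProd (by linarith) s).continuousAt).mono_left
      nhdsWithin_le_nhds
  rw [norm_rootProd_eq_zero (by linarith) hr hr0, mul_zero] at h2
  have h3 : Filter.Tendsto (fun z : ℂ => ‖z‖ ^ α) (nhdsWithin r {r}ᶜ) (nhds (‖r‖ ^ α)) := by
    refine Filter.Tendsto.mono_left ?_ nhdsWithin_le_nhds
    exact (continuous_norm.tendsto r).rpow_const (Or.inl (norm_pos_iff.2 hr0).ne')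
  have h4 : ∀ᶠ z in nhdsWithin r {r}ᶜ, ∀ r' ∈ s, r' ≠ 0 ∧ z ≠ r' := by
    have hfin : IsClosed ((s.toFinset.erase r : Finset ℂ) : Set ℂ) :=
      (Finset.finite_toSet _).isClosed
    have h5 : ∀ᶠ z in nhds r, z ∉ ((s.toFinset.erase r : Finset ℂ) : Set ℂ) :=
      hfin.isOpen_compl.mem_nhds (by simp)
    filter_upwards [nhdsWithin_le_nhds h5, self_mem_nhdsWithin] with z hz hz' r' hr'
    refine ⟨hs r' hr', fun heq => ?_⟩
    apply hz
    simp only [Finset.coe_erase, Set.mem_sdiff, Finset.mem_coe, Multiset.mem_toFinset]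
    exact ⟨heq ▸ hr', hz'⟩
  have h6 : (fun z => ‖rootSymbol α s β z‖ * ‖rootProd s (-β) z‖) =ᶠ[nhdsWithin r {r}ᶜ]
      fun z => ‖z‖ ^ α := by
    filter_upwards [h4] with z hz
    rw [rootSymbol, norm_mul, mul_assoc, norm_rootProd_mul_neg β s z hz, mul_one,
      Complex.norm_cpow_real]
  have h7 := tendsto_nhds_unique (h2.congr' h6) h3
  have h8 : 0 < ‖r‖ ^ α := Real.rpow_pos_of_pos (norm_pos_iff.2 hr0) _
  linarith

lemma norm_mul_rootSymbol_le {α β k k₀ Q : ℝ} (hα : -1 ≤ α) (hk0 : 0 ≤ k) (hk : k < k₀)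
    (s : Multiset ℂ) (hs : ∀ r ∈ s, r ≠ 0) (h : 0 ≤ β ∨ ∀ r ∈ s, r.re ≤ -k₀ * ‖r‖)
    (hQ : α + β * s.card ≤ Q) :
    ∃ C : ℝ, 0 < C ∧ ∀ z ∈ cone k, z ≠ 0 →
      ‖z‖ * ‖rootSymbol α s β z‖ ≤ C * (1 + ‖z‖) ^ (1 + Q) := by
  obtain ⟨C, hC, hb⟩ := norm_rootProd_le hk0 hk s hs h
  refine ⟨C, hC, fun z hz hz0 => ?_⟩
  have hz1 : 0 < ‖z‖ := norm_pos_iff.2 hz0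
  rw [rootSymbol, norm_mul, Complex.norm_cpow_real]
  calc ‖z‖ * (‖z‖ ^ α * ‖rootProd s β z‖) = ‖z‖ ^ (1 + α) * ‖rootProd s β z‖ := by
        rw [Real.rpow_add hz1, Real.rpow_one]; ring
    _ ≤ (1 + ‖z‖) ^ (1 + α) * (C * (1 + ‖z‖) ^ (β * s.card)) := by
        refine mul_le_mul ?_ (hb z hz) (norm_nonneg _) (by positivity)
        exact Real.rpow_le_rpow hz1.le (by linarith) (by linarith)
    _ = C * (1 + ‖z‖) ^ (1 + α + β * s.card) := by
        rw [Real.rpow_add (by positivity : 0 < 1 + ‖z‖) (1 + α)]; ring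
    _ ≤ _ := by
        refine mul_le_mul_of_nonneg_left ?_ hC.le
        exact Real.rpow_le_rpow_of_exponent_le (by linarith) (by linarith)

/-! ### The generating function near the origin -/

/-- The polynomial `∑_{k < p} g_k^{(α)} z ^ k`. -/
def gngfPoly (p : ℕ) (α : ℝ) : Polynomial ℂ :=
  ∑ k ∈ Finset.range p, Polynomial.C (gngfCoeff α k : ℂ) * Polynomial.X ^ k

/-- The zeros of the polynomial factor of `F_ω`. -/
def schemeRoots (m : Scheme) (p : ℕ) (α : ℝ) : Multiset ℂ :=
  match m with
  | .bdf => (bdfPoly p).roots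
  | .gngf => (gngfPoly p α).roots

/-- The exponent of the polynomial factor of `F_ω`. -/
def schemeExp (m : Scheme) (α : ℝ) : ℝ :=
  match m with
  | .bdf => α
  | .gngf => 1

lemma eval_eq_prod_one_sub_div {P : Polynomial ℂ} (h : P.coeff 0 = 1) (z : ℂ) :
    P.eval z = (P.roots.map fun r => 1 - z / r).prod := by
  have hP : P ≠ 0 := by
    rintro rfl
    simp at h
  have h0 : ∀ r ∈ P.roots, r ≠ 0 := by
    rintro r hr rfl
    have := (Polynomial.mem_roots hP).1 hr
    rw [Polynomial.IsRoot, ← Polynomial.coeff_zero_eq_eval_zero, h] at this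
    exact one_ne_zero this
  have h1 := (IsAlgClosed.splits P).eval_eq_prod_roots z
  have h2 := (IsAlgClosed.splits P).eval_eq_prod_roots 0
  rw [← Polynomial.coeff_zero_eq_eval_zero, h] at h2
  have h3 : P.roots.map (fun r => z - r) = P.roots.map (fun r => (0 - r) * (1 - z / r)) := by
    refine Multiset.map_congr rfl fun r hr => ?_
    have := h0 r hr
    field_simp
    ring
  rw [h1, h3, Multiset.prod_map_mul, ← mul_assoc, ← h2, one_mul]

lemma coeff_zero_bdfPoly {p : ℕ} (hp : 1 ≤ p) : (bdfPoly p).coeff 0 = 1 := by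
  rw [bdfPoly, Polynomial.finsetSum_coeff,
    Finset.sum_eq_single_of_mem 1 (by simpa using hp)]
  · simp
  · intro k hk hk1
    have : 0 ≠ k - 1 := by
      have := (Finset.mem_Icc.1 hk).1
      omega
    rw [Polynomial.coeff_C_mul, Polynomial.coeff_X_pow, if_neg this, mul_zero]

lemma coeff_zero_gngfPoly {p : ℕ} (hp : 1 ≤ p) (α : ℝ) : (gngfPoly p α).coeff 0 = 1 := by
  rw [gngfPoly, Polynomial.finsetSum_coeff,
    Finset.sum_eq_single_of_mem 0 (Finset.mem_range.2 hp)]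
  · simp [gngfCoeff]
  · intro k hk hk1
    rw [Polynomial.coeff_C_mul, Polynomial.coeff_X_pow, if_neg (Ne.symm hk1), mul_zero]

lemma ne_zero_of_mem_roots {P : Polynomial ℂ} (h : P.coeff 0 = 1) {r : ℂ} (hr : r ∈ P.roots) :
    r ≠ 0 := by
  rintro rfl
  have := Polynomial.isRoot_of_mem_roots hr
  rw [Polynomial.IsRoot, ← Polynomial.coeff_zero_eq_eval_zero, h] at this
  exact one_ne_zero this

lemma ne_zero_of_mem_schemeRoots {m : Scheme} {p : ℕ} (hp : 1 ≤ p) {α : ℝ} {r : ℂ}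
    (hr : r ∈ schemeRoots m p α) : r ≠ 0 := by
  cases m
  · exact ne_zero_of_mem_roots (coeff_zero_bdfPoly hp) hr
  · exact ne_zero_of_mem_roots (coeff_zero_gngfPoly hp α) hr

lemma eval_bdfPoly (p : ℕ) (z : ℂ) :
    (bdfPoly p).eval z = ∑ k ∈ Finset.Icc 1 p, (1 / (k : ℂ)) * z ^ (k - 1) := by
  simp [bdfPoly, Polynomial.eval_finsetSum]

lemma Fomega_eq {m : Scheme} {p : ℕ} (hp : 1 ≤ p) (α τ : ℝ) (z : ℂ) : Fomega m p α τ z =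
    z ^ (α : ℂ) * rootProd (schemeRoots m p α) (schemeExp m α) (τ * z) := by
  cases m
  · rfl
  · change _ * _ = _ * rootProd _ 1 _
    have h := eval_eq_prod_one_sub_div (coeff_zero_gngfPoly hp α) ((τ : ℂ) * z)
    rw [gngfPoly, Polynomial.eval_finsetSum] at h
    simp only [Polynomial.eval_mul, Polynomial.eval_C, Polynomial.eval_pow,
      Polynomial.eval_X] at h
    rw [h]
    simp [rootProd, schemeRoots, gngfPoly]

lemma ofReal_mul_cpow {a : ℝ} (ha : 0 < a) (z : ℂ) (b : ℂ) :
    ((a : ℂ) * z) ^ b = (a : ℂ) ^ b * z ^ b := by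
  have ha' : (a : ℂ) ≠ 0 := Complex.ofReal_ne_zero.2 ha.ne'
  rcases eq_or_ne z 0 with rfl | hz
  · rcases eq_or_ne b 0 with rfl | hb
    · simp
    · simp [Complex.zero_cpow hb]
  · rw [Complex.cpow_def_of_ne_zero (mul_ne_zero ha' hz), Complex.log_ofReal_mul ha hz,
      Complex.cpow_def_of_ne_zero ha', Complex.cpow_def_of_ne_zero hz, ← Complex.exp_add,
      Complex.ofReal_log ha.le, add_mul]

lemma Fomega_eq_rootSymbol {m : Scheme} {p : ℕ} (hp : 1 ≤ p) (α : ℝ) {τ : ℝ} (hτ : 0 < τ)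
    (z : ℂ) : Fomega m p α τ z =
      (τ ^ (-α) : ℝ) * rootSymbol α (schemeRoots m p α) (schemeExp m α) (τ * z) := by
  rw [Fomega_eq hp, rootSymbol]
  have h1 : ((τ : ℂ) * z) ^ (α : ℂ) = (τ : ℂ) ^ (α : ℂ) * z ^ (α : ℂ) := by
    exact ofReal_mul_cpow hτ z α
  have h2 : ((τ ^ (-α) : ℝ) : ℂ) * (τ : ℂ) ^ (α : ℂ) = 1 := by
    rw [← Complex.ofReal_cpow hτ.le, ← Complex.ofReal_mul, ← Real.rpow_add hτ]
    simp
  rw [h1]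
  calc _ = 1 * (z ^ (α : ℂ) * rootProd (schemeRoots m p α) (schemeExp m α) (τ * z)) := by
        rw [one_mul]
    _ = _ := by rw [← h2]; ring

lemma bdfPoly_ofReal_pos {p : ℕ} (hp : 1 ≤ p) {x : ℝ} (hx : 0 ≤ x) :
    ∃ y : ℝ, 0 < y ∧ (bdfPoly p).eval (x : ℂ) = y := by
  refine ⟨∑ k ∈ Finset.Icc 1 p, (1 / (k : ℝ)) * x ^ (k - 1), ?_, ?_⟩
  · refine Finset.sum_pos' (fun k _ => by positivity) ⟨1, by simpa using hp, by simp⟩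
  · rw [eval_bdfPoly]
    push_cast
    rfl

/-- Along the segment from `0` to `1` the branch of `P_p(z)^α` obtained by continuation is the
principal power: `∑ log (1 - z / r) - log P_p(z)` is a continuous function with values in
`2πiℤ` that vanishes at `0`. -/
lemma bdfPolyPow_eq_cpow {p : ℕ} (hp : 1 ≤ p) (α : ℝ) :
    ∀ᶠ z in nhds (1 : ℂ), bdfPolyPow p α z = (bdfPoly p).eval z ^ (α : ℂ) := by
  set s := (bdfPoly p).roots with hs
  have hs0 : ∀ r ∈ s, r ≠ 0 := fun r hr => ne_zero_of_mem_roots (coeff_zero_bdfPoly hp) hr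
  set U : Set ℂ := {z | (bdfPoly p).eval z ∈ Complex.slitPlane} ∩
    ⋂ r ∈ s.toFinset, {z | 1 - z / r ∈ Complex.slitPlane} with hU
  have hUo : IsOpen U := by
    refine IsOpen.inter (Complex.isOpen_slitPlane.preimage (bdfPoly p).continuous) ?_
    refine isOpen_biInter_finset fun r _ => ?_
    exact Complex.isOpen_slitPlane.preimage (by fun_prop)
  set K : Set ℂ := (fun x : ℝ => (x : ℂ)) '' Set.Icc 0 1 with hK
  have hKc : IsCompact K := isCompact_Icc.image Complex.continuous_ofReal
  have hKconv : Convex ℝ K := (convex_Icc (0 : ℝ) 1).linear_image Complex.ofRealCLM.toLinearMap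
  have hKU : K ⊆ U := by
    rintro _ ⟨x, hx, rfl⟩
    refine ⟨?_, Set.mem_iInter₂.2 fun r hr => ?_⟩
    · obtain ⟨y, hy, h⟩ := bdfPoly_ofReal_pos hp hx.1
      simp [h, hy]
    · rw [Multiset.mem_toFinset] at hr
      have hr0 := hs0 r hr
      by_contra hc
      rw [Set.mem_ofPred_eq, Complex.mem_slitPlane_iff_not_le_zero, not_not] at hc
      have hxr := Complex.le_def.1 hc
      simp only [Complex.zero_re, Complex.zero_im] at hxr
      set y := 1 - (x : ℂ) / r with hy
      have hyr : y = (y.re : ℂ) := by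
        apply Complex.ext <;> simp [hxr.2]
      have h1 : (x : ℂ) = (1 - y) * r := by
        rw [hy]; field_simp; ring
      have hy1 : 0 < 1 - y.re := by linarith [hxr.1]
      have h2 : r = ((x / (1 - y.re) : ℝ) : ℂ) := by
        rw [Complex.ofReal_div, h1, hyr]
        have : (1 - (y.re : ℂ)) ≠ 0 := by exact_mod_cast hy1.ne'
        simp only [Complex.ofReal_re, Complex.ofReal_sub, Complex.ofReal_one]
        field_simp
      obtain ⟨v, hv, hv'⟩ := bdfPoly_ofReal_pos hp (div_nonneg hx.1 hy1.le)
      have h3 : (bdfPoly p).eval r = 0 := Polynomial.isRoot_of_mem_roots hr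
      rw [h2, hv'] at h3
      exact hv.ne' (by exact_mod_cast h3)
  obtain ⟨δ, hδ, hδU⟩ := hKc.exists_thickening_subset_open hUo hKU
  set V := Metric.thickening δ K with hV
  have hVo : IsOpen V := Metric.isOpen_thickening
  have hVc : IsPreconnected V := (hKconv.thickening δ).isPreconnected
  have hKV : K ⊆ V := Metric.self_subset_thickening hδ K
  set D : ℂ → ℂ := fun z => (s.map fun r => Complex.log (1 - z / r)).sum -
    Complex.log ((bdfPoly p).eval z) with hD
  have hexp : ∀ z ∈ V, Complex.exp (s.map fun r => Complex.log (1 - z / r)).sum =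
      (bdfPoly p).eval z := by
    intro z hz
    rw [Complex.exp_multiset_sum, Multiset.map_map,
      eval_eq_prod_one_sub_div (coeff_zero_bdfPoly hp)]
    congr 1
    refine Multiset.map_congr rfl fun r hr => ?_
    have h1 : 1 - z / r ∈ Complex.slitPlane :=
      Set.mem_iInter₂.1 (hδU hz).2 r (Multiset.mem_toFinset.2 hr)
    exact Complex.exp_log (Complex.slitPlane_ne_zero h1)
  have hDc : ContinuousOn D V := by
    refine ContinuousOn.sub ?_ ?_
    · refine continuousOn_multiset_sum _ fun r hr => ?_
      refine ContinuousOn.clog (by fun_prop) fun z hz => ?_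
      exact Set.mem_iInter₂.1 (hδU hz).2 r (Multiset.mem_toFinset.2 hr)
    · exact ContinuousOn.clog (bdfPoly p).continuous.continuousOn fun z hz => (hδU hz).1
  have hDm : Set.MapsTo (fun z => D z / (2 * π * Complex.I)) V
      (Set.range ((↑) : ℤ → ℂ)) := by
    intro z hz
    have h1 : Complex.exp (D z) = 1 := by
      rw [hD, Complex.exp_sub, hexp z hz, Complex.exp_log (Complex.slitPlane_ne_zero (hδU hz).1),
        div_self (Complex.slitPlane_ne_zero (hδU hz).1)]
    obtain ⟨n, hn⟩ := Complex.exp_eq_one_iff.1 h1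
    refine ⟨n, ?_⟩
    have : (2 * π * Complex.I : ℂ) ≠ 0 := by simp [Real.pi_ne_zero]
    simp only [hn]
    field_simp
  have hdisc : IsDiscrete (Set.range ((↑) : ℤ → ℂ)) :=
    Complex.isClosedEmbedding_intCast.isEmbedding.isDiscrete_range
  have hDz : ∀ z ∈ V, D z = 0 := by
    intro z hz
    have h0 : (0 : ℂ) ∈ V := hKV ⟨0, by simp, by simp⟩
    have h1 := hVc.constant_of_mapsTo hdisc (hDc.div_const _) hDm hz h0
    have h2 : D 0 = 0 := by
      rw [hD]
      simp [← Polynomial.coeff_zero_eq_eval_zero, coeff_zero_bdfPoly hp]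
    simpa [h2, Real.pi_ne_zero] using h1
  filter_upwards [hVo.mem_nhds (hKV ⟨1, by simp, by simp⟩)] with z hz
  have h1 := hDz z hz
  have h2 : (bdfPoly p).eval z ≠ 0 := Complex.slitPlane_ne_zero (hδU hz).1
  rw [Complex.cpow_def_of_ne_zero h2, ← sub_eq_zero.1 h1, bdfPolyPow,
    ← Multiset.sum_map_mul_right, Complex.exp_multiset_sum, Multiset.map_map]
  congr 1
  refine Multiset.map_congr rfl fun r hr => ?_
  have h3 : 1 - z / r ∈ Complex.slitPlane :=
    Set.mem_iInter₂.1 (hδU hz).2 r (Multiset.mem_toFinset.2 hr)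
  rw [Complex.cpow_def_of_ne_zero (Complex.slitPlane_ne_zero h3)]
  rfl

lemma ofReal_rpow_neg_eq_inv_cpow {τ : ℝ} (hτ : 0 < τ) (α : ℝ) :
    ((τ ^ (-α) : ℝ) : ℂ) = ((τ⁻¹ : ℝ) : ℂ) ^ (α : ℂ) := by
  rw [← Complex.ofReal_cpow (by positivity), Real.inv_rpow hτ.le, Real.rpow_neg hτ.le]

lemma genFun_bdf_eq {p : ℕ} (α τ : ℝ) (ξ : ℂ) : genFun .bdf p α τ ξ =
    (((τ⁻¹ : ℝ) : ℂ) * ((1 - ξ) * (bdfPoly p).eval (1 - ξ))) ^ (α : ℂ) := by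
  have h : ∑ k ∈ Finset.Icc 1 p, (1 / (k : ℂ)) * (1 - ξ) ^ k =
      (1 - ξ) * ∑ k ∈ Finset.Icc 1 p, (1 / (k : ℂ)) * (1 - ξ) ^ (k - 1) := by
    rw [Finset.mul_sum]
    refine Finset.sum_congr rfl fun k hk => ?_
    obtain ⟨j, rfl⟩ : ∃ j, k = j + 1 := ⟨k - 1, by have := (Finset.mem_Icc.1 hk).1; omega⟩
    rw [Nat.add_sub_cancel, pow_succ]
    ring
  rw [genFun, eval_bdfPoly, h]
  simp

/-- Near `ξ = 0` the generating function is `τ ^ (-α)` times the rescaled `F_ω` at `1 - ξ`. -/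
lemma genFun_eventuallyEq {m : Scheme} {p : ℕ} (hp : 1 ≤ p) (α : ℝ) {τ : ℝ} (hτ : 0 < τ) :
    genFun m p α τ =ᶠ[nhds 0] fun ξ => ((τ ^ (-α) : ℝ) : ℂ) *
      rootSymbol α (schemeRoots m p α) (schemeExp m α) (1 - ξ) := by
  have hτ' : 0 < τ⁻¹ := by positivity
  have hlim : Filter.Tendsto (fun ξ : ℂ => 1 - ξ) (nhds 0) (nhds 1) := by
    have : Continuous fun ξ : ℂ => 1 - ξ := by fun_prop
    simpa using this.tendsto 0
  cases m
  · have h1 : ∀ᶠ z in nhds (1 : ℂ), 0 < z.re :=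
      (isOpen_lt continuous_const Complex.continuous_re).mem_nhds (by simp)
    have h2 : ∀ᶠ z in nhds (1 : ℂ), 0 < ((bdfPoly p).eval z).re := by
      refine (isOpen_lt continuous_const
        (Complex.continuous_re.comp (bdfPoly p).continuous)).mem_nhds ?_
      obtain ⟨y, hy, h⟩ := bdfPoly_ofReal_pos hp zero_le_one
      rw [Complex.ofReal_one] at h
      simp [h, hy]
    filter_upwards [hlim.eventually h1, hlim.eventually h2,
      hlim.eventually (bdfPolyPow_eq_cpow hp α)] with ξ h1 h2 h3
    rw [genFun_bdf_eq, ofReal_mul_cpow hτ', ofReal_rpow_neg_eq_inv_cpow hτ]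
    congr 1
    change _ = _ * bdfPolyPow p α (1 - ξ)
    rw [h3]
    have hz : (1 - ξ) ≠ 0 := fun h => by simp [h] at h1
    have hP : (bdfPoly p).eval (1 - ξ) ≠ 0 := fun h => by simp [h] at h2
    have ha1 := abs_lt.1 (Complex.abs_arg_lt_pi_div_two_iff.2 (Or.inl h1))
    have ha2 := abs_lt.1 (Complex.abs_arg_lt_pi_div_two_iff.2 (Or.inl h2))
    have hl := (Complex.log_mul_eq_add_log_iff hz hP).2 ⟨by linarith, by linarith⟩
    rw [Complex.cpow_def_of_ne_zero (mul_ne_zero hz hP), hl, Complex.cpow_def_of_ne_zero hz,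
      Complex.cpow_def_of_ne_zero hP, ← Complex.exp_add, add_mul]
  · refine Filter.Eventually.of_forall fun ξ => ?_
    have h := Fomega_eq (m := .gngf) hp α 1 (1 - ξ)
    rw [Complex.ofReal_one, one_mul, ← rootSymbol] at h
    simp only
    rw [← h, ofReal_rpow_neg_eq_inv_cpow hτ]
    simp only [genFun, Fomega, Complex.ofReal_one, one_mul]
    rw [← mul_assoc, ← ofReal_mul_cpow hτ']
    congr 3
    push_cast
    field_simp

lemma genFun_conj_eventuallyEq {m : Scheme} {p : ℕ} (hp : 1 ≤ p) (α : ℝ) {τ : ℝ} (hτ : 0 < τ) :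
    (starRingEnd ℂ ∘ genFun m p α τ ∘ starRingEnd ℂ) =ᶠ[nhds 0] genFun m p α τ := by
  have hτ' : 0 < τ⁻¹ := by positivity
  cases m
  · have h2 : ∀ᶠ ξ in nhds (0 : ℂ), (1 / (τ : ℂ)) *
        ∑ k ∈ Finset.Icc 1 p, (1 / (k : ℂ)) * (1 - ξ) ^ k ∈ Complex.slitPlane := by
      refine (Complex.isOpen_slitPlane.preimage (by fun_prop)).mem_nhds ?_
      have hs : 0 < ∑ k ∈ Finset.Icc 1 p, (1 / (k : ℝ)) :=
        Finset.sum_pos' (fun k _ => by positivity) ⟨1, by simpa using hp, by simp⟩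
      have : (1 / (τ : ℂ)) * ∑ k ∈ Finset.Icc 1 p, (1 / (k : ℂ)) * (1 - 0) ^ k =
          ((1 / τ * ∑ k ∈ Finset.Icc 1 p, (1 / (k : ℝ)) : ℝ) : ℂ) := by
        push_cast
        simp
      rw [Set.mem_preimage, this, Complex.ofReal_mem_slitPlane]
      positivity
    filter_upwards [h2] with ξ hξ
    have h3 := Complex.conj_cpow _ α (Complex.slitPlane_arg_ne_pi hξ)
    have h4 := congrArg (starRingEnd ℂ) h3
    simp only [Function.comp_apply, genFun, map_mul, map_sum, map_pow, map_sub, map_one,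
      Complex.conj_ofReal, Complex.conj_conj, map_div₀, map_natCast] at h4 ⊢
    rw [h4]
  · have h2 : ∀ᶠ ξ in nhds (0 : ℂ), (1 - ξ) / (τ : ℂ) ∈ Complex.slitPlane := by
      refine (Complex.isOpen_slitPlane.preimage (by fun_prop)).mem_nhds ?_
      have : (1 - 0) / (τ : ℂ) = ((τ⁻¹ : ℝ) : ℂ) := by simp
      rw [Set.mem_preimage, this, Complex.ofReal_mem_slitPlane]
      positivity
    filter_upwards [h2] with ξ hξ
    have h3 := Complex.conj_cpow ((1 - ξ) / (τ : ℂ)) α (Complex.slitPlane_arg_ne_pi hξ)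
    have h4 := congrArg (starRingEnd ℂ) h3
    simp only [Function.comp_apply, genFun, map_mul, map_sum, map_pow, map_sub, map_one,
      Complex.conj_ofReal, Complex.conj_conj, map_div₀] at h4 ⊢
    rw [h4]

lemma iteratedDeriv_conj_conj (f : ℂ → ℂ) (n : ℕ) :
    iteratedDeriv n (starRingEnd ℂ ∘ f ∘ starRingEnd ℂ) =
      starRingEnd ℂ ∘ iteratedDeriv n f ∘ starRingEnd ℂ := by
  induction n with
  | zero => simp
  | succ n ih => rw [iteratedDeriv_succ, ih, deriv_conj_conj, iteratedDeriv_succ]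

lemma convWeight_im {m : Scheme} {p : ℕ} (hp : 1 ≤ p) (α : ℝ) {τ : ℝ} (hτ : 0 < τ) (n : ℕ) :
    (convWeight m p α τ n).im = 0 := by
  have h := (genFun_conj_eventuallyEq (m := m) hp α hτ).iteratedDeriv_eq n
  rw [iteratedDeriv_conj_conj] at h
  simp only [Function.comp_apply, map_zero] at h
  rw [← Complex.conj_eq_iff_im, convWeight, map_div₀, h]
  simp

lemma convWeight_eq {m : Scheme} {p : ℕ} (hp : 1 ≤ p) (α : ℝ) {τ : ℝ} (hτ : 0 < τ) (n : ℕ) :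
    convWeight m p α τ n = ((τ ^ (-α) : ℝ) : ℂ) * (iteratedDeriv n (fun ξ =>
      rootSymbol α (schemeRoots m p α) (schemeExp m α) (1 - ξ)) 0 / (n.factorial : ℂ)) := by
  rw [convWeight, (genFun_eventuallyEq hp α hτ).iteratedDeriv_eq n]
  simp only [iteratedDeriv_const_mul_field]
  ring

/-! ### Growth exponent and admissibility of `Q` -/

lemma differentiableOn_rootSymbol {m : Scheme} {p : ℕ} (hp : 1 ≤ p) {α φ : ℝ}
    (hF : DifferentiableOn ℂ (Fomega m p α 1) (sector φ)) : DifferentiableOn ℂ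
      (rootSymbol α (schemeRoots m p α) (schemeExp m α)) (sector φ) := by
  refine hF.congr fun z _ => ?_
  rw [Fomega_eq hp, rootSymbol, Complex.ofReal_one, one_mul]

lemma schemeExp_nonneg_or_roots {m : Scheme} {p : ℕ} (hp : 1 ≤ p) {α φ : ℝ}
    (hφ0 : 0 ≤ φ) (hφ : φ < π / 2)
    (hF : DifferentiableOn ℂ (Fomega m p α 1) (sector φ)) :
    0 ≤ schemeExp m α ∨ ∀ r ∈ schemeRoots m p α, r.re ≤ -Real.cos φ * ‖r‖ := by
  rcases le_or_gt 0 (schemeExp m α) with h | h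
  · exact Or.inl h
  · refine Or.inr fun r hr => re_le_of_notMem_sector hφ0 hφ ?_
    exact notMem_of_continuousOn_rootSymbol (isOpen_sector φ hφ0 hφ) h
      (fun r hr => ne_zero_of_mem_schemeRoots hp hr)
      (differentiableOn_rootSymbol hp hF).continuousOn hr

lemma smul_hyperbola (τ μ ψ σ : ℝ) (w : ℂ) :
    (τ : ℂ) * hyperbola μ ψ σ w = hyperbola (τ * μ) ψ (τ * σ) w := by
  simp only [hyperbola]
  push_cast
  ring

lemma smul_deriv_hyperbola (τ μ ψ σ : ℝ) (w : ℂ) :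
    (τ : ℂ) * deriv (hyperbola μ ψ σ) w = deriv (hyperbola (τ * μ) ψ (τ * σ)) w := by
  rw [deriv_hyperbola, deriv_hyperbola]
  push_cast
  ring

lemma tendsto_cosh_atTop : Filter.Tendsto Real.cosh Filter.atTop Filter.atTop := by
  refine Filter.tendsto_atTop_mono (fun u => ?_)
    (Filter.Tendsto.atTop_div_const (zero_lt_two) Real.tendsto_exp_atTop)
  rw [Real.cosh_eq]
  linarith [Real.exp_pos (-u)]

/-- The lower bound for `Q` that admissibility implies: on the contour, as `z = τ λ` tends to
infinity, the quotient in the condition is of order `‖z‖ ^ (α + β · card s - Q)`, where `s` are the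
zeros and `β` is the exponent of the polynomial factor of `F_ω`. -/
lemma exponent_le_of_qBounded {m : Scheme} {p : ℕ} (hp : 1 ≤ p) {α τ μ ψ σ d Q : ℝ}
    (hτ : 0 < τ) (hμ : 0 < μ) (hψ0 : 0 < ψ) (hψ : ψ < π / 2) (hσ : 0 ≤ σ) (hd : 0 ≤ d)
    (h : QBounded m p α τ μ ψ σ d Q) :
    α + schemeExp m α * (schemeRoots m p α).card ≤ Q := by
  by_contra! hlt
  obtain ⟨M, hM⟩ := h
  obtain ⟨c, R, hc, hR, hge⟩ := norm_rootProd_ge (schemeExp m α) (schemeRoots m p α)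
    fun r hr => ne_zero_of_mem_schemeRoots hp hr
  set D := schemeExp m α * (schemeRoots m p α).card with hD
  set k := Real.sin ψ with hk
  have hk0 : 0 ≤ k := Real.sin_nonneg_of_nonneg_of_le_pi hψ0.le (by linarith)
  have hk1 : k < 1 := by
    rw [hk, ← Real.sin_pi_div_two]
    exact Real.sin_lt_sin_of_lt_of_le_pi_div_two (by linarith) le_rfl hψ
  have hlim : Filter.Tendsto (fun u : ℝ => ‖(τ : ℂ) * hyperbola μ ψ σ (u : ℂ)‖) Filter.atTop
      Filter.atTop := by
    have hc1 : 0 < 1 + 2 * (1 + k) / (1 - k) := by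
      have : 0 ≤ 2 * (1 + k) / (1 - k) := div_nonneg (by linarith) (by linarith)
      linarith
    have hc2 : 0 < τ * ((1 - k) * μ / (1 + 2 * (1 + k) / (1 - k))) :=
      mul_pos hτ (div_pos (mul_pos (by linarith) hμ) hc1)
    refine Filter.tendsto_atTop_mono (fun u => ?_) (tendsto_cosh_atTop.const_mul_atTop hc2)
    have h1 := norm_hyperbola_ge hμ.le hσ (w := (u : ℂ)) hk0 hk1
      (ψ := ψ) (by simp [hk])
    rw [norm_mul, Complex.norm_real, Real.norm_of_nonneg hτ.le, mul_assoc]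
    refine mul_le_mul_of_nonneg_left ?_ hτ.le
    rw [div_mul_eq_mul_div, div_le_iff₀ hc1]
    rw [Complex.ofReal_re] at h1
    nlinarith [mul_nonneg (sub_nonneg.2 hk1.le) hσ]
  have hlim2 : Filter.Tendsto (fun u : ℝ => (2 ^ (-|Q + 1|) * c) *
      ‖(τ : ℂ) * hyperbola μ ψ σ (u : ℂ)‖ ^ (α + D - Q)) Filter.atTop Filter.atTop :=
    ((tendsto_rpow_atTop (by linarith)).comp hlim).const_mul_atTop (by positivity)
  obtain ⟨u, hu1, hu2⟩ := ((hlim2.eventually_gt_atTop M).and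
    (hlim.eventually_ge_atTop (max R 2))).exists
  have hu3 := hM (u : ℂ) (by simpa using hd) (by simpa using hd)
  refine absurd hu3 (not_le.2 (hu1.trans_le ?_))
  set l := hyperbola μ ψ σ (u : ℂ) with hl
  set z := (τ : ℂ) * l with hz
  have hz2 : 2 ≤ ‖z‖ := (le_max_right _ _).trans hu2
  have hzR : R ≤ ‖z‖ := (le_max_left _ _).trans hu2
  have hz0 : 0 < ‖z‖ := by linarith
  have hl0 : 0 < ‖l‖ := by
    refine norm_pos_iff.2 fun h => ?_
    rw [hz, h, mul_zero, norm_zero] at hz0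
    exact lt_irrefl _ hz0
  have hFo : Fomega m p α τ l =
      l ^ (α : ℂ) * rootProd (schemeRoots m p α) (schemeExp m α) z := Fomega_eq hp α τ l
  rw [hFo]
  clear_value z
  rw [norm_div, norm_mul, norm_mul, norm_mul, Complex.norm_cpow_real, Complex.norm_cpow_real,
    Complex.norm_cpow_real, Complex.norm_cpow_real]
  have h1 : ‖z‖ ^ (1 + α) * ‖l‖ ^ (-α) *
      (‖l‖ ^ α * ‖rootProd (schemeRoots m p α) (schemeExp m α) z‖) =
      ‖z‖ ^ (1 + α) * ‖rootProd (schemeRoots m p α) (schemeExp m α) z‖ := by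
    have : ‖l‖ ^ (-α) * ‖l‖ ^ α = 1 := by rw [← Real.rpow_add hl0]; simp
    calc _ = ‖z‖ ^ (1 + α) * ‖rootProd (schemeRoots m p α) (schemeExp m α) z‖ *
          (‖l‖ ^ (-α) * ‖l‖ ^ α) := by ring
      _ = _ := by rw [this, mul_one]
  rw [h1]
  have h2 : ‖1 - z‖ ≤ 2 * ‖z‖ := by
    have := norm_sub_le (1 : ℂ) z
    rw [norm_one] at this
    linarith
  have h3 : ‖z‖ ≤ 2 * ‖1 - z‖ := by
    have := norm_sub_norm_le z 1
    rw [norm_one, norm_sub_rev] at this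
    linarith
  have h4 := rpow_le_of_comparable hz0 one_le_two h3 h2 (Q + 1)
  have h5 : 0 < ‖1 - z‖ := by linarith
  rw [le_div_iff₀ (by positivity)]
  calc 2 ^ (-|Q + 1|) * c * ‖z‖ ^ (α + D - Q) * ‖1 - z‖ ^ (Q + 1)
      ≤ 2 ^ (-|Q + 1|) * c * ‖z‖ ^ (α + D - Q) * (2 ^ |Q + 1| * ‖z‖ ^ (Q + 1)) := by
        gcongr
    _ = (2 ^ (-|Q + 1|) * 2 ^ |Q + 1|) * c * (‖z‖ ^ (α + D - Q) * ‖z‖ ^ (Q + 1)) := by ring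
    _ = c * (‖z‖ ^ (α + D - Q) * ‖z‖ ^ (Q + 1)) := by
        rw [← Real.rpow_add two_pos]; simp
    _ = ‖z‖ ^ (1 + α) * (c * ‖z‖ ^ D) := by
        rw [← Real.rpow_add hz0]
        have : α + D - Q + (Q + 1) = (1 + α) + D := by ring
        rw [this, Real.rpow_add hz0]
        ring
    _ ≤ _ := by
        gcongr
        exact hge z hzR

/-! ### The trapezoidal rule in a strip -/

lemma integrable_exp_neg_mul_abs {q : ℝ} (hq : 0 < q) :
    MeasureTheory.Integrable fun u : ℝ => Real.exp (-q * |u|) := by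
  have h1 : MeasureTheory.IntegrableOn (fun u : ℝ => Real.exp (-q * |u|)) (Set.Ioi 0) := by
    refine (exp_neg_integrableOn_Ioi 0 hq).congr_fun (fun u hu => ?_) measurableSet_Ioi
    simp only
    rw [abs_of_pos hu]
  have h2 : MeasureTheory.IntegrableOn (fun u : ℝ => Real.exp (-q * |u|)) (Set.Iic 0) := by
    rw [integrableOn_Iic_iff_integrableOn_Iio]
    have h3 := h1.comp_neg
    simpa using h3
  have := h2.union h1
  rwa [Set.Iic_union_Ioi, MeasureTheory.integrableOn_univ] at this

lemma integral_exp_neg_mul_abs {q : ℝ} (hq : 0 < q) :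
    ∫ u : ℝ, Real.exp (-q * |u|) = 2 / q := by
  rw [integral_comp_abs (f := fun u => Real.exp (-q * u)), integral_exp_mul_Ioi (by linarith)]
  simp
  ring

/-- Cauchy's theorem for a horizontal strip: the integral of an exponentially decaying
holomorphic function does not change when the line of integration is shifted. -/
lemma integral_eq_integral_add_mul_I {g : ℂ → ℂ} {v E q : ℝ} (hq : 0 < q)
    (hg : ∀ w : ℂ, w.im ∈ Set.uIcc 0 v → DifferentiableAt ℂ g w)
    (hb : ∀ w : ℂ, w.im ∈ Set.uIcc 0 v → ‖g w‖ ≤ E * Real.exp (-q * |w.re|)) :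
    ∫ u : ℝ, g u = ∫ u : ℝ, g (u + v * Complex.I) := by
  have hint : ∀ v' ∈ Set.uIcc 0 v,
      MeasureTheory.Integrable fun u : ℝ => g (u + v' * Complex.I) := by
    intro v' hv'
    refine ((integrable_exp_neg_mul_abs hq).const_mul E).mono' ?_
      (Filter.Eventually.of_forall fun u => ?_)
    · refine Continuous.aestronglyMeasurable (continuous_iff_continuousAt.2 fun u => ?_)
      have : ContinuousAt g (u + v' * Complex.I) := (hg _ (by simpa using hv')).continuousAt
      exact this.comp (f := fun u : ℝ => (u : ℂ) + v' * Complex.I) (by fun_prop)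
    · simpa using hb (u + v' * Complex.I) (by simpa using hv')
  have h0 : MeasureTheory.Integrable fun u : ℝ => g u := by
    simpa using hint 0 Set.left_mem_uIcc
  have hside : ∀ s : ℝ, |s| = 1 → Filter.Tendsto
      (fun R : ℝ => ∫ y in (0 : ℝ)..v, g ((s * R : ℝ) + y * Complex.I)) Filter.atTop
      (nhds 0) := by
    intro s hs
    have hlim : Filter.Tendsto (fun R : ℝ => E * Real.exp (-q * |s * R|) * |v - 0|) Filter.atTop
        (nhds 0) := by
      have h1 : Filter.Tendsto (fun R : ℝ => Real.exp (-q * |s * R|)) Filter.atTop (nhds 0) := by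
        refine Real.tendsto_exp_atBot.comp ?_
        simp only [abs_mul, hs, one_mul]
        exact Filter.tendsto_abs_atTop_atTop.const_mul_atTop_of_neg (by linarith)
      simpa using (h1.const_mul E).mul_const |v - 0|
    refine squeeze_zero_norm (fun R => ?_) hlim
    refine intervalIntegral.norm_integral_le_of_norm_le_const fun y hy => ?_
    have := hb ((s * R : ℝ) + y * Complex.I) (by simpa using Set.uIoc_subset_uIcc hy)
    simpa using this
  have hbot := MeasureTheory.intervalIntegral_tendsto_integral h0 Filter.tendsto_neg_atTop_atBot
    Filter.tendsto_id
  have htop := MeasureTheory.intervalIntegral_tendsto_integral (hint v Set.right_mem_uIcc)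
    Filter.tendsto_neg_atTop_atBot Filter.tendsto_id
  have hsum := (((hbot.sub htop).add ((hside 1 (by simp)).const_smul Complex.I)).sub
    ((hside (-1) (by simp)).const_smul Complex.I))
  have hzero : ∀ R : ℝ, ((∫ u in (-R)..(id R), g u) - (∫ u in (-R)..(id R),
      g (u + v * Complex.I)) + Complex.I • ∫ y in (0 : ℝ)..v, g ((1 * R : ℝ) + y * Complex.I)) -
      Complex.I • ∫ y in (0 : ℝ)..v, g ((-1 * R : ℝ) + y * Complex.I) = 0 := by
    intro R
    have h := Complex.integral_boundary_rect_eq_zero_of_differentiableOn g (-R : ℂ)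
      (R + v * Complex.I) (fun w hw => (hg w (by simpa using hw.2)).differentiableWithinAt)
    simpa using h
  have hsum' := hsum.congr hzero
  have := tendsto_nhds_unique hsum' tendsto_const_nhds
  simp only [smul_zero, add_zero, sub_zero] at this
  exact sub_eq_zero.1 this

/-- The trapezoidal rule with nodes `(k + 1/2) h` converges exponentially for functions
holomorphic in the strip `|Im w| ≤ d`. By Poisson summation the error is a sum of Fourier
coefficients at the nonzero multiples of `1 / h`; shifting the line of integration by `∓ d`, each
of them gains the factor `exp (-2π d |j| / h)`. -/
theorem norm_integral_sub_trapezoid_le {g : ℂ → ℂ} {d h q E : ℝ} (hd : 0 < d) (hh : 0 < h)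
    (hq : 0 < q) (hg : ∀ w : ℂ, |w.im| ≤ d → DifferentiableAt ℂ g w)
    (hb : ∀ w : ℂ, |w.im| ≤ d → ‖g w‖ ≤ E * Real.exp (-q * |w.re|)) :
    ‖(∫ u : ℝ, g u) - h * ∑' k : ℤ, g (nodeParam h k : ℝ)‖ ≤
      (4 * E / q) / (Real.exp (2 * d * π / h) - 1) := by
  have hE : 0 ≤ E := by
    have h1 := hb 0 (by simpa using hd.le)
    simp only [Complex.zero_re, abs_zero, mul_zero, Real.exp_zero, mul_one] at h1
    exact (norm_nonneg _).trans h1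
  set f : ℝ → ℂ := fun y => g ((h * y : ℝ) : ℂ) with hf
  have hfourier : ∀ (s : ℝ), |s| = 1 → ∀ j : ℝ, 0 ≤ j →
      ‖FourierTransform.fourier f (s * j)‖ ≤
        1 / h * (2 * E / q) * Real.exp (-(2 * d * π / h) * j) := by
    intro s hs j hj
    set G : ℂ → ℂ := fun w => Complex.exp ((-2 * π * (s * j) / h : ℝ) * Complex.I * w) * g w
      with hG
    have h1 : FourierTransform.fourier f (s * j) = (1 / h : ℝ) • ∫ u : ℝ, G u := by
      rw [Real.fourier_real_eq_integral_exp_smul, one_div, ← abs_of_pos (inv_pos.2 hh),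
        ← MeasureTheory.Measure.integral_comp_mul_left (fun u : ℝ => G u)]
      congr 1
      ext y
      rw [hG, hf, smul_eq_mul]
      simp only
      congr 2
      have hh' : (h : ℂ) ≠ 0 := Complex.ofReal_ne_zero.2 hh.ne'
      push_cast
      field_simp
    have him : ∀ w : ℂ, w.im ∈ Set.uIcc 0 (-(s * d)) → |w.im| ≤ d := by
      intro w hw
      have h2 := Set.abs_sub_left_of_mem_uIcc hw
      rw [sub_zero, sub_zero, abs_neg, abs_mul, hs, one_mul, abs_of_pos hd] at h2
      exact h2
    have hGb : ∀ w : ℂ, |w.im| ≤ d → ‖G w‖ =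
        Real.exp (2 * π * (s * j) / h * w.im) * ‖g w‖ := by
      intro w _
      rw [hG, norm_mul, Complex.norm_exp]
      congr 2
      simp
      ring
    have h2 : ∫ u : ℝ, G u = ∫ u : ℝ, G (u + (-(s * d) : ℝ) * Complex.I) := by
      refine integral_eq_integral_add_mul_I (E := Real.exp (2 * π * j / h * d) * E) hq
        (fun w hw => ?_) (fun w hw => ?_)
      · exact DifferentiableAt.mul (by fun_prop) (hg w (him w hw))
      · rw [hGb w (him w hw), mul_assoc (Real.exp _)]
        refine mul_le_mul ?_ (hb w (him w hw)) (norm_nonneg _) (by positivity)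
        refine Real.exp_le_exp.2 ?_
        have h3 : 2 * π * (s * j) / h * w.im = 2 * π * j / h * (s * w.im) := by ring
        rw [h3]
        refine mul_le_mul_of_nonneg_left ?_ (by positivity)
        refine (le_abs_self _).trans ?_
        rw [abs_mul, hs, one_mul]
        exact him w hw
    have hss : s * s = 1 := by rw [← sq, ← sq_abs, hs, one_pow]
    have h3 : ‖∫ u : ℝ, G (u + (-(s * d) : ℝ) * Complex.I)‖ ≤
        ∫ u : ℝ, Real.exp (-(2 * d * π / h) * j) * E * Real.exp (-q * |u|) := by
      refine MeasureTheory.norm_integral_le_of_norm_le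
        ((integrable_exp_neg_mul_abs hq).const_mul _) (Filter.Eventually.of_forall fun u => ?_)
      have hw : |((u : ℂ) + (-(s * d) : ℝ) * Complex.I).im| ≤ d := by
        simp [abs_mul, hs, abs_of_pos hd]
      have h4 := hb _ hw
      rw [hGb _ hw]
      have h5 : 2 * π * (s * j) / h * ((u : ℂ) + (-(s * d) : ℝ) * Complex.I).im =
          -(2 * d * π / h) * j := by
        simp
        linear_combination (2 * π * j * d / h) * hss
      rw [h5, mul_assoc (Real.exp _)]
      simp only [Complex.add_re, Complex.ofReal_re, Complex.mul_re, Complex.I_re, mul_zero,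
        Complex.ofReal_im, Complex.I_im, mul_one, sub_self, add_zero] at h4
      exact mul_le_mul_of_nonneg_left h4 (Real.exp_pos _).le
    rw [MeasureTheory.integral_const_mul, integral_exp_neg_mul_abs hq] at h3
    rw [h1, norm_smul, Real.norm_of_nonneg (by positivity), h2]
    calc _ ≤ 1 / h * (Real.exp (-(2 * d * π / h) * j) * E * (2 / q)) := by gcongr
      _ = _ := by ring
  have h0 : FourierTransform.fourier f 0 = (1 / h : ℝ) • ∫ u : ℝ, g u := by
    rw [Real.fourier_real_eq_integral_exp_smul, one_div, ← abs_of_pos (inv_pos.2 hh),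
      ← MeasureTheory.Measure.integral_comp_mul_left (fun u : ℝ => g u)]
    simp [hf]
  set ρ := Real.exp (-(2 * d * π / h)) with hρ
  have hρ1 : ρ < 1 := by
    rw [hρ, Real.exp_lt_one_iff]
    have : 0 < 2 * d * π / h := by positivity
    linarith
  have hρ0 : 0 < ρ := Real.exp_pos _
  have hgeo : HasSum (fun n : ℕ => 1 / h * (2 * E / q) * ρ ^ (n + 1))
      (1 / h * (2 * E / q) * (ρ / (1 - ρ))) := by
    have := ((hasSum_geometric_of_lt_one hρ0.le hρ1).mul_left ρ).mul_left (1 / h * (2 * E / q))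
    simpa [pow_succ', div_eq_mul_inv] using this
  have hb1 : ∀ n : ℕ, ‖FourierTransform.fourier f (((n : ℤ) + 1 : ℤ) : ℝ)‖ ≤
      1 / h * (2 * E / q) * ρ ^ (n + 1) := by
    intro n
    have := hfourier 1 (by simp) (n + 1) (by positivity)
    rw [hρ, ← Real.exp_nat_mul]
    push_cast
    rw [one_mul] at this
    refine this.trans_eq ?_
    ring_nf
  have hb2 : ∀ n : ℕ, ‖FourierTransform.fourier f ((-((n : ℤ) + 1) : ℤ) : ℝ)‖ ≤
      1 / h * (2 * E / q) * ρ ^ (n + 1) := by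
    intro n
    have := hfourier (-1) (by simp) (n + 1) (by positivity)
    rw [hρ, ← Real.exp_nat_mul]
    push_cast
    rw [neg_one_mul] at this
    refine (this.trans_eq ?_)
    ring_nf
  have hsum : Summable fun n : ℤ => FourierTransform.fourier f (n : ℝ) :=
    Summable.of_add_one_of_neg_add_one (Summable.of_norm_bounded hgeo.summable hb1)
      (Summable.of_norm_bounded hgeo.summable hb2)
  have hcont : Continuous f := by
    refine continuous_iff_continuousAt.2 fun y => ?_
    have : ContinuousAt g ((h * y : ℝ) : ℂ) := (hg _ (by simpa using hd.le)).continuousAt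
    exact this.comp (f := fun y : ℝ => ((h * y : ℝ) : ℂ)) (by fun_prop)
  have hdecay : f =O[Filter.cocompact ℝ] fun x => |x| ^ (-2 : ℝ) := by
    have h1 : f =O[Filter.cocompact ℝ] fun x => Real.exp (-(q * h) * |x|) := by
      refine Asymptotics.IsBigO.of_bound E (Filter.Eventually.of_forall fun x => ?_)
      have h2 := hb ((h * x : ℝ) : ℂ) (by simpa using hd.le)
      rw [Complex.ofReal_re, abs_mul, abs_of_pos hh] at h2
      rw [Real.norm_of_nonneg (Real.exp_pos _).le]
      refine h2.trans_eq ?_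
      ring_nf
    refine h1.trans ?_
    have := (isLittleO_exp_neg_mul_rpow_atTop (mul_pos hq hh) (-2)).isBigO
    exact this.comp_tendsto (tendsto_norm_cocompact_atTop (E := ℝ))
  have hpoisson := Real.tsum_eq_tsum_fourier_of_rpow_decay_of_summable hcont one_lt_two hdecay
    hsum (1 / 2)
  have hnode : ∑' k : ℤ, f (1 / 2 + k) = ∑' k : ℤ, g (nodeParam h k : ℝ) := by
    refine tsum_congr fun k => ?_
    rw [hf, nodeParam]
    simp only
    congr 2
    ring
  have hnorm : ∀ n : ℤ, ‖fourier n ((1 / 2 : ℝ) : UnitAddCircle)‖ = 1 := by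
    intro n
    rw [fourier_apply]
    exact Circle.norm_coe _
  have hb1' : ∀ n : ℕ, ‖FourierTransform.fourier f (((n : ℤ) + 1 : ℤ) : ℝ) *
      fourier ((n : ℤ) + 1) ((1 / 2 : ℝ) : UnitAddCircle)‖ ≤
        1 / h * (2 * E / q) * ρ ^ (n + 1) := by
    intro n
    rw [norm_mul, hnorm, mul_one]
    exact hb1 n
  have hb2' : ∀ n : ℕ, ‖FourierTransform.fourier f ((-((n : ℤ) + 1) : ℤ) : ℝ) *
      fourier (-((n : ℤ) + 1)) ((1 / 2 : ℝ) : UnitAddCircle)‖ ≤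
        1 / h * (2 * E / q) * ρ ^ (n + 1) := by
    intro n
    rw [norm_mul, hnorm, mul_one]
    exact hb2 n
  have hsplit := tsum_of_add_one_of_neg_add_one (f := fun n : ℤ =>
      FourierTransform.fourier f (n : ℝ) * fourier n ((1 / 2 : ℝ) : UnitAddCircle))
    (Summable.of_norm_bounded hgeo.summable hb1') (Summable.of_norm_bounded hgeo.summable hb2')
  rw [hnode, hsplit, Int.cast_zero, h0, fourier_zero, mul_one] at hpoisson
  have hB1 := tsum_of_norm_bounded hgeo hb1'
  have hB2 := tsum_of_norm_bounded hgeo hb2'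
  rw [hpoisson]
  set A₁ := ∑' n : ℕ, FourierTransform.fourier f (((n : ℤ) + 1 : ℤ) : ℝ) *
      fourier ((n : ℤ) + 1) ((1 / 2 : ℝ) : UnitAddCircle)
  set A₂ := ∑' n : ℕ, FourierTransform.fourier f ((-((n : ℤ) + 1) : ℤ) : ℝ) *
      fourier (-((n : ℤ) + 1)) ((1 / 2 : ℝ) : UnitAddCircle)
  have hh' : (h : ℂ) ≠ 0 := Complex.ofReal_ne_zero.2 hh.ne'
  have e1 : (∫ u : ℝ, g u) - h * (A₁ + (1 / h : ℝ) • (∫ u : ℝ, g u) + A₂) =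
      -(h * (A₁ + A₂)) := by
    rw [Complex.real_smul]
    push_cast
    field_simp
    ring
  rw [e1, norm_neg, norm_mul, Complex.norm_real, Real.norm_of_nonneg hh.le]
  have e2 : ρ / (1 - ρ) = 1 / (Real.exp (2 * d * π / h) - 1) := by
    have h3 : Real.exp (2 * d * π / h) = ρ⁻¹ := by rw [hρ, Real.exp_neg, inv_inv]
    have h4 : 1 - ρ ≠ 0 := by linarith
    rw [h3]
    field_simp
  rw [e2] at hB1 hB2
  calc h * ‖A₁ + A₂‖ ≤ h * (1 / h * (2 * E / q) * (1 / (Real.exp (2 * d * π / h) - 1)) +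
        1 / h * (2 * E / q) * (1 / (Real.exp (2 * d * π / h) - 1))) := by
        refine mul_le_mul_of_nonneg_left ((norm_add_le _ _).trans (add_le_add hB1 hB2)) hh.le
    _ = _ := by
        field_simp
        ring

/-! ### Contour representation of the Taylor coefficients -/

lemma iterate_dslope_eq {f : ℂ → ℂ} (hf : AnalyticAt ℂ f 0) (n : ℕ) :
    ((Function.swap dslope 0)^[n] f) 0 = iteratedDeriv n f 0 / n.factorial := by
  have h := hf.hasFPowerSeriesAt.has_fpower_series_iterate_dslope_fslope n
  have h1 := h.coeff_zero 1
  have h2 := FormalMultilinearSeries.coeff_iterate_fslope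
    (p := FormalMultilinearSeries.ofScalars ℂ fun n => iteratedDeriv n f 0 / n.factorial) n 0
  rw [zero_add, FormalMultilinearSeries.coeff_ofScalars] at h2
  rw [← h1, ← h2]
  rfl

/-- The contour in the variable `ξ = 1 - λ`. -/
def xiPath (μ ψ σ : ℝ) (w : ℂ) : ℂ := 1 - hyperbola μ ψ σ w

section Loop

variable {μ ψ σ : ℝ}

lemma xiPath_re (w : ℂ) : (xiPath μ ψ σ w).re =
    1 - μ - σ + μ * (Real.sin (ψ - w.im) * Real.cosh w.re) := by
  rw [xiPath, Complex.sub_re, hyperbola_re, Complex.one_re]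
  ring

lemma xiPath_im (w : ℂ) : (xiPath μ ψ σ w).im =
    μ * (Real.cos (ψ - w.im) * Real.sinh w.re) := by
  rw [xiPath, Complex.sub_im, hyperbola_im, Complex.one_im]
  ring

lemma hasDerivAt_xiPath (w : ℂ) :
    HasDerivAt (xiPath μ ψ σ) (-deriv (hyperbola μ ψ σ) w) w :=
  (differentiable_hyperbola μ ψ σ w).hasDerivAt.const_sub 1

lemma continuous_xiPath : Continuous (xiPath μ ψ σ) :=
  continuous_iff_continuousAt.2 fun w => (hasDerivAt_xiPath w).continuousAt

lemma deriv_xiPath (w : ℂ) : deriv (xiPath μ ψ σ) w = -deriv (hyperbola μ ψ σ) w :=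
  (hasDerivAt_xiPath w).deriv

lemma hasDerivAt_xiPath' (w : ℂ) :
    HasDerivAt (xiPath μ ψ σ) (deriv (xiPath μ ψ σ) w) w := by
  rw [deriv_xiPath]
  exact hasDerivAt_xiPath w

lemma continuous_deriv_xiPath : Continuous (deriv (xiPath μ ψ σ)) := by
  have : deriv (xiPath μ ψ σ) = fun w => -deriv (hyperbola μ ψ σ) w := funext deriv_xiPath
  rw [this]
  exact (differentiable_deriv_hyperbola μ ψ σ).continuous.neg

/-- On the line `Im w = ψ + π / 2` the contour is a ray of the real axis, covered twice. -/
lemma xiPath_top (u : ℝ) : xiPath μ ψ σ (u + (ψ + π / 2 : ℝ) * Complex.I) =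
    ((1 - μ - σ - μ * Real.cosh u : ℝ) : ℂ) := by
  have h : ψ - (ψ + π / 2) = -(π / 2) := by ring
  apply Complex.ext
  · rw [xiPath_re]
    simp only [Complex.add_im, Complex.ofReal_im, Complex.mul_im, Complex.ofReal_re,
      Complex.I_im, mul_one, Complex.I_re, mul_zero, add_zero, zero_add, Complex.add_re,
      Complex.mul_re, sub_self, h, Real.sin_neg, Real.sin_pi_div_two]
    ring
  · rw [xiPath_im]
    simp only [Complex.add_im, Complex.ofReal_im, Complex.mul_im, Complex.ofReal_re,
      Complex.I_im, mul_one, Complex.I_re, mul_zero, add_zero, zero_add, Complex.add_re,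
      Complex.mul_re, sub_self, h, Real.cos_neg, Real.cos_pi_div_two, zero_mul]

lemma deriv_xiPath_top (u : ℝ) : deriv (xiPath μ ψ σ) (u + (ψ + π / 2 : ℝ) * Complex.I) =
    ((-μ * Real.sinh u : ℝ) : ℂ) := by
  have h : (ψ : ℂ) + Complex.I * (u + (ψ + π / 2 : ℝ) * Complex.I) =
      -(π / 2 : ℂ) + u * Complex.I := by
    push_cast
    linear_combination ((ψ : ℂ) + π / 2) * Complex.I_mul_I
  rw [deriv_xiPath, deriv_hyperbola, h, Complex.cos_add_mul_I, Complex.cos_neg,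
    Complex.sin_neg, Complex.cos_pi_div_two, Complex.sin_pi_div_two]
  push_cast
  linear_combination ((μ : ℂ) * Complex.sinh u) * Complex.I_mul_I

/-- The integral of `H` along the image under `ξ = 1 - λ` of the three sides, other than the top,
of the rectangle `[-R, R] × [0, ψ + π / 2]`. Both endpoints have the same image and, for large `R`,
this image lies on the negative axis and the path is a loop around `0`. -/
def loopIntegral (μ ψ σ : ℝ) (H : ℂ → ℂ) (R : ℝ) : ℂ :=
  (∫ u in (-R)..R, H (xiPath μ ψ σ u) * deriv (xiPath μ ψ σ) u) +
    Complex.I * (∫ y in (0 : ℝ)..(ψ + π / 2), H (xiPath μ ψ σ ((R : ℝ) + y * Complex.I)) *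
      deriv (xiPath μ ψ σ) ((R : ℝ) + y * Complex.I)) -
    Complex.I * ∫ y in (0 : ℝ)..(ψ + π / 2), H (xiPath μ ψ σ ((-R : ℝ) + y * Complex.I)) *
      deriv (xiPath μ ψ σ) ((-R : ℝ) + y * Complex.I)

/-- For a function holomorphic on the region the loop integral is the integral over the top side,
which vanishes by symmetry. -/
lemma loopIntegral_eq_zero {H : ℂ → ℂ} {R : ℝ} (hψ : 0 < ψ)
    (hH : ∀ w : ℂ, 0 ≤ w.im → w.im ≤ ψ + π / 2 → DifferentiableAt ℂ H (xiPath μ ψ σ w)) :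
    loopIntegral μ ψ σ H R = 0 := by
  have hT : 0 ≤ ψ + π / 2 := by positivity
  have h := Complex.integral_boundary_rect_eq_zero_of_differentiableOn
    (fun w => H (xiPath μ ψ σ w) * deriv (xiPath μ ψ σ) w) (-R : ℝ)
    (R + (ψ + π / 2 : ℝ) * Complex.I) (fun w hw => by
      have hw2 := hw.2
      simp only [Set.mem_preimage, Complex.ofReal_im, Complex.add_im, Complex.mul_im,
        Complex.ofReal_re, Complex.I_im, mul_one, Complex.I_re, mul_zero, add_zero, zero_add,
        Set.uIcc_of_le hT, Set.mem_Icc] at hw2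
      refine DifferentiableAt.differentiableWithinAt (DifferentiableAt.mul ?_ ?_)
      · exact (hH w hw2.1 hw2.2).comp w (hasDerivAt_xiPath w).differentiableAt
      · have : deriv (xiPath μ ψ σ) = fun w => -deriv (hyperbola μ ψ σ) w :=
          funext deriv_xiPath
        rw [this]
        exact (differentiable_deriv_hyperbola μ ψ σ w).neg)
  have htop : ∫ u in (-R)..R, H (xiPath μ ψ σ (u + (ψ + π / 2 : ℝ) * Complex.I)) *
      deriv (xiPath μ ψ σ) (u + (ψ + π / 2 : ℝ) * Complex.I) = 0 := by
    simp only [xiPath_top, deriv_xiPath_top]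
    have h1 := intervalIntegral.integral_comp_neg (a := -R) (b := R) (fun u : ℝ =>
      H ((1 - μ - σ - μ * Real.cosh u : ℝ) : ℂ) * ((-μ * Real.sinh u : ℝ) : ℂ))
    simp only [Real.cosh_neg, Real.sinh_neg, neg_neg, mul_neg, neg_mul,
      Complex.ofReal_neg, intervalIntegral.integral_neg] at h1 ⊢
    linear_combination (-1 / 2 : ℂ) * h1
  simp only [Complex.ofReal_re, Complex.ofReal_im, Complex.add_re, Complex.add_im,
    Complex.mul_re, Complex.mul_im, Complex.I_re, Complex.I_im, mul_zero, mul_one, sub_self,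
    add_zero, zero_add, Complex.ofReal_zero, zero_mul, smul_eq_mul] at h
  rw [htop, sub_zero] at h
  exact h

lemma loopIntegral_add {H₁ H₂ : ℂ → ℂ} {R : ℝ} {P : Set ℂ} (hT : 0 < ψ)
    (hP : ∀ w : ℂ, 0 ≤ w.im → w.im ≤ ψ + π / 2 → (w.im = 0 ∨ |w.re| = R) →
      xiPath μ ψ σ w ∈ P) (hR : 0 ≤ R)
    (h₁ : ∀ z ∈ P, ContinuousAt H₁ z) (h₂ : ∀ z ∈ P, ContinuousAt H₂ z) :
    loopIntegral μ ψ σ (fun z => H₁ z + H₂ z) R =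
      loopIntegral μ ψ σ H₁ R + loopIntegral μ ψ σ H₂ R := by
  have hT' : 0 ≤ ψ + π / 2 := by positivity
  have hbot : ∀ H : ℂ → ℂ, (∀ z ∈ P, ContinuousAt H z) → IntervalIntegrable
      (fun u : ℝ => H (xiPath μ ψ σ u) * deriv (xiPath μ ψ σ) u) MeasureTheory.volume (-R) R := by
    intro H hH
    refine ContinuousOn.intervalIntegrable fun u _ => ContinuousAt.continuousWithinAt ?_
    refine ContinuousAt.mul ?_ (continuous_deriv_xiPath.comp Complex.continuous_ofReal).continuousAt
    have := hH _ (hP u (by simp) (by simpa using hT') (by simp))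
    exact this.comp (f := fun u : ℝ => xiPath μ ψ σ u)
      (continuous_xiPath.comp Complex.continuous_ofReal).continuousAt
  have hside : ∀ H : ℂ → ℂ, (∀ z ∈ P, ContinuousAt H z) → ∀ s : ℝ, |s| = R → IntervalIntegrable
      (fun y : ℝ => H (xiPath μ ψ σ (s + y * Complex.I)) *
        deriv (xiPath μ ψ σ) (s + y * Complex.I)) MeasureTheory.volume 0 (ψ + π / 2) := by
    intro H hH s hs
    refine ContinuousOn.intervalIntegrable fun y hy => ContinuousAt.continuousWithinAt ?_
    rw [Set.uIcc_of_le hT'] at hy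
    refine ContinuousAt.mul ?_ (continuous_deriv_xiPath.comp
      (by fun_prop : Continuous fun y : ℝ => (s : ℂ) + y * Complex.I)).continuousAt
    have := hH _ (hP (s + y * Complex.I) (by simpa using hy.1) (by simpa using hy.2)
      (by simp [hs]))
    exact this.comp (f := fun y : ℝ => xiPath μ ψ σ (s + y * Complex.I))
      (continuous_xiPath.comp (by fun_prop)).continuousAt
  have hR1 : |R| = R := abs_of_nonneg hR
  have hR2 : |-R| = R := by rw [abs_neg, hR1]
  simp only [loopIntegral, add_mul]
  rw [intervalIntegral.integral_add (hbot _ h₁) (hbot _ h₂),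
    intervalIntegral.integral_add (hside _ h₁ R hR1) (hside _ h₂ R hR1),
    intervalIntegral.integral_add (hside _ h₁ (-R) hR2) (hside _ h₂ (-R) hR2)]
  ring

lemma loopIntegral_const_mul (c : ℂ) (H : ℂ → ℂ) (R : ℝ) :
    loopIntegral μ ψ σ (fun z => c * H z) R = c * loopIntegral μ ψ σ H R := by
  simp only [loopIntegral, mul_assoc, intervalIntegral.integral_const_mul]
  ring

lemma integral_bottom_eq_sub {P H : ℂ → ℂ} {a b : ℝ}
    (hP : ∀ u ∈ Set.uIcc a b, HasDerivAt P (H (xiPath μ ψ σ (u : ℝ))) (xiPath μ ψ σ (u : ℝ)))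
    (hH : ∀ u ∈ Set.uIcc a b, ContinuousAt H (xiPath μ ψ σ (u : ℝ))) :
    ∫ u in a..b, H (xiPath μ ψ σ (u : ℝ)) * deriv (xiPath μ ψ σ) (u : ℝ) =
      P (xiPath μ ψ σ b) - P (xiPath μ ψ σ a) := by
  refine intervalIntegral.integral_eq_sub_of_hasDerivAt (f := fun u : ℝ => P (xiPath μ ψ σ u))
    (fun u hu => ?_) ?_
  · exact ((hP u hu).comp (u : ℂ) (hasDerivAt_xiPath' _)).comp_ofReal
  · refine ContinuousOn.intervalIntegrable fun u hu => ContinuousAt.continuousWithinAt ?_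
    refine ContinuousAt.mul ?_ (continuous_deriv_xiPath.comp Complex.continuous_ofReal).continuousAt
    exact (hH u hu).comp (f := fun u : ℝ => xiPath μ ψ σ u)
      (continuous_xiPath.comp Complex.continuous_ofReal).continuousAt

lemma integral_side_eq_sub {P H : ℂ → ℂ} {s b : ℝ} (hb : 0 ≤ b)
    (hP : ∀ y ∈ Set.Icc 0 b, HasDerivAt P (H (xiPath μ ψ σ (s + (y : ℝ) * Complex.I)))
      (xiPath μ ψ σ (s + (y : ℝ) * Complex.I)))
    (hH : ∀ y ∈ Set.Icc 0 b, ContinuousAt H (xiPath μ ψ σ (s + (y : ℝ) * Complex.I))) :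
    Complex.I * ∫ y in (0 : ℝ)..b, H (xiPath μ ψ σ (s + (y : ℝ) * Complex.I)) *
      deriv (xiPath μ ψ σ) (s + (y : ℝ) * Complex.I) =
      P (xiPath μ ψ σ (s + b * Complex.I)) - P (xiPath μ ψ σ s) := by
  have hline : ∀ y : ℝ, HasDerivAt (fun y : ℝ => (s : ℂ) + y * Complex.I) Complex.I y := by
    intro y
    simpa using ((Complex.ofRealCLM.hasDerivAt (x := y)).mul_const Complex.I).const_add (s : ℂ)
  rw [← intervalIntegral.integral_const_mul]
  have := intervalIntegral.integral_eq_sub_of_hasDerivAt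
    (f := fun y : ℝ => P (xiPath μ ψ σ (s + y * Complex.I)))
    (f' := fun y : ℝ => Complex.I * (H (xiPath μ ψ σ (s + (y : ℝ) * Complex.I)) *
      deriv (xiPath μ ψ σ) (s + (y : ℝ) * Complex.I))) (a := 0) (b := b)
    (fun y hy => ?_) ?_
  · simpa using this
  · rw [Set.uIcc_of_le hb] at hy
    have h1 := ((hP y hy).comp _ (hasDerivAt_xiPath' _)).scomp y (hline y)
    exact h1
  · refine ContinuousOn.intervalIntegrable fun y hy => ContinuousAt.continuousWithinAt ?_
    rw [Set.uIcc_of_le hb] at hy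
    refine continuousAt_const.mul (ContinuousAt.mul ?_ (continuous_deriv_xiPath.comp
      (by fun_prop : Continuous fun y : ℝ => (s : ℂ) + y * Complex.I)).continuousAt)
    exact (hH y hy).comp (f := fun y : ℝ => xiPath μ ψ σ (s + y * Complex.I))
      (continuous_xiPath.comp (by fun_prop)).continuousAt

/-- The path of `loopIntegral` avoids the origin. -/
lemma xiPath_ne_zero (hμ : 0 < μ) (hψ : 0 < ψ) (hψ2 : ψ < π / 2) (hμσ : μ + σ < 1) {R : ℝ}
    (hR : 0 < R) (hR1 : 1 - μ - σ < μ * Real.cosh R) {w : ℂ} (h0 : 0 ≤ w.im)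
    (h1 : w.im ≤ ψ + π / 2) (h2 : w.im = 0 ∨ |w.re| = R) : xiPath μ ψ σ w ≠ 0 := by
  intro h
  have hre := xiPath_re (μ := μ) (ψ := ψ) (σ := σ) w
  have him := xiPath_im (μ := μ) (ψ := ψ) (σ := σ) w
  rw [h, Complex.zero_re] at hre
  rw [h, Complex.zero_im] at him
  rcases h2 with h2 | h2
  · rw [h2, sub_zero] at hre
    have := mul_pos hμ (mul_pos (Real.sin_pos_of_pos_of_lt_pi hψ (by linarith))
      (Real.cosh_pos w.re))
    linarith
  · have hs : Real.sinh w.re ≠ 0 := by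
      rw [Ne, Real.sinh_eq_zero]
      rintro h3
      rw [h3, abs_zero] at h2
      exact hR.ne h2
    have hc : Real.cos (ψ - w.im) = 0 := by
      rcases mul_eq_zero.1 him.symm with h3 | h3
      · exact absurd h3 hμ.ne'
      · exact (mul_eq_zero.1 h3).resolve_right hs
    have hT : ψ - w.im = -(π / 2) := by
      by_contra hne
      have : -(π / 2) < ψ - w.im := lt_of_le_of_ne (by linarith) (Ne.symm hne)
      exact (Real.cos_pos_of_mem_Ioo ⟨this, by linarith⟩).ne' hc
    rw [hT, Real.sin_neg, Real.sin_pi_div_two, ← Real.cosh_abs, h2] at hre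
    linarith

lemma loopIntegral_inv_pow (hμ : 0 < μ) (hψ : 0 < ψ) (hψ2 : ψ < π / 2) (hμσ : μ + σ < 1) {R : ℝ}
    (hR : 0 < R) (hR1 : 1 - μ - σ < μ * Real.cosh R) (k : ℕ) :
    loopIntegral μ ψ σ (fun z => (z ^ (k + 2))⁻¹) R = 0 := by
  have hT' : 0 ≤ ψ + π / 2 := by positivity
  have hk : ((k : ℂ) + 1) ≠ 0 := Nat.cast_add_one_ne_zero k
  have hd : ∀ z : ℂ, z ≠ 0 →
      HasDerivAt (fun z : ℂ => -((k : ℂ) + 1)⁻¹ * (z ^ (k + 1))⁻¹) ((z ^ (k + 2))⁻¹) z := by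
    intro z hz
    have := ((hasDerivAt_pow (k + 1) z).inv (pow_ne_zero _ hz)).const_mul (-((k : ℂ) + 1)⁻¹)
    refine this.congr_deriv ?_
    push_cast
    field_simp
    ring
  have hc : ∀ z : ℂ, z ≠ 0 → ContinuousAt (fun z : ℂ => (z ^ (k + 2))⁻¹) z := fun z hz =>
    (continuousAt_id.pow _).inv₀ (pow_ne_zero _ hz)
  have hn := fun w => xiPath_ne_zero hμ hψ hψ2 hμσ hR hR1 (w := w)
  have hR2 : |R| = R := abs_of_pos hR
  have hb : ∀ u : ℝ, xiPath μ ψ σ u ≠ 0 := fun u => hn _ (by simp) (by simpa using hT') (by simp)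
  have hs : ∀ s : ℝ, |s| = R → ∀ y ∈ Set.Icc 0 (ψ + π / 2),
      xiPath μ ψ σ (s + (y : ℝ) * Complex.I) ≠ 0 := fun s hs y hy =>
    hn _ (by simpa using hy.1) (by simpa using hy.2) (by simp [hs])
  rw [loopIntegral, integral_bottom_eq_sub (fun u _ => hd _ (hb u)) (fun u _ => hc _ (hb u)),
    integral_side_eq_sub hT' (fun y hy => hd _ (hs R hR2 y hy))
      (fun y hy => hc _ (hs R hR2 y hy)),
    integral_side_eq_sub hT' (fun y hy => hd _ (hs (-R) (by simpa using hR2) y hy))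
      (fun y hy => hc _ (hs (-R) (by simpa using hR2) y hy)), xiPath_top, xiPath_top,
    Real.cosh_neg]
  push_cast
  ring

/-- The loop winds once around the origin: on the half with `Im ξ ≥ 0` the function
`log (-iξ)` is a primitive of `1 / ξ`, on the half with `Im ξ ≤ 0` the function `log (iξ)` is. -/
lemma loopIntegral_inv (hμ : 0 < μ) (hψ : 0 < ψ) (hψ2 : ψ < π / 2) (hμσ : μ + σ < 1) {R : ℝ}
    (hR : 0 < R) (hR1 : 1 - μ - σ < μ * Real.cosh R) :
    loopIntegral μ ψ σ (fun z => z⁻¹) R = 2 * π * Complex.I := by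
  have hT' : 0 ≤ ψ + π / 2 := by positivity
  have hd : ∀ s : ℝ, s ≠ 0 → ∀ z : ℂ, z ≠ 0 → 0 ≤ s * z.im →
      HasDerivAt (fun z : ℂ => Complex.log (-(s * Complex.I) * z)) z⁻¹ z := by
    intro s hs0 z hz hs
    have hsI : -((s : ℂ) * Complex.I) ≠ 0 := by simp [hs0]
    have h1 : -((s : ℂ) * Complex.I) * z ∈ Complex.slitPlane := by
      rw [Complex.mem_slitPlane_iff]
      simp only [Complex.mul_re, Complex.neg_re, Complex.neg_im, Complex.mul_im,
        Complex.ofReal_re, Complex.ofReal_im, Complex.I_re, Complex.I_im]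
      by_contra! hcon
      apply hz
      have h2 : z.re = 0 := by
        have := hcon.2
        simpa [hs0] using this
      have h3 : s * z.im = 0 := le_antisymm (by simpa using hcon.1) hs
      exact Complex.ext h2 ((mul_eq_zero.1 h3).resolve_left hs0)
    have h2 := ((hasDerivAt_id z).const_mul (-((s : ℂ) * Complex.I))).clog h1
    refine h2.congr_deriv ?_
    simp only [id]
    have hs0' : (s : ℂ) ≠ 0 := Complex.ofReal_ne_zero.2 hs0
    field_simp
  have hc : ∀ z : ℂ, z ≠ 0 → ContinuousAt (fun z : ℂ => z⁻¹) z := fun z hz =>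
    continuousAt_id.inv₀ hz
  have hn := fun w => xiPath_ne_zero hμ hψ hψ2 hμσ hR hR1 (w := w)
  have hR2 : |R| = R := abs_of_pos hR
  have hb : ∀ u : ℝ, xiPath μ ψ σ u ≠ 0 := fun u => hn _ (by simp) (by simpa using hT') (by simp)
  have hs : ∀ s : ℝ, |s| = R → ∀ y ∈ Set.Icc 0 (ψ + π / 2),
      xiPath μ ψ σ (s + (y : ℝ) * Complex.I) ≠ 0 := fun s hs y hy =>
    hn _ (by simpa using hy.1) (by simpa using hy.2) (by simp [hs])
  have him : ∀ w : ℂ, 0 ≤ w.im → w.im ≤ ψ + π / 2 → 0 ≤ w.re → 0 ≤ (xiPath μ ψ σ w).im := by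
    intro w h0 h1 h2
    rw [xiPath_im]
    have := Real.cos_nonneg_of_mem_Icc (x := ψ - w.im) ⟨by linarith, by linarith⟩
    have := Real.sinh_nonneg_iff.2 h2
    positivity
  have him' : ∀ w : ℂ, 0 ≤ w.im → w.im ≤ ψ + π / 2 → w.re ≤ 0 → (xiPath μ ψ σ w).im ≤ 0 := by
    intro w h0 h1 h2
    rw [xiPath_im]
    have h3 := Real.cos_nonneg_of_mem_Icc (x := ψ - w.im) ⟨by linarith, by linarith⟩
    have h4 := Real.sinh_nonpos_iff.2 h2
    exact mul_nonpos_of_nonneg_of_nonpos hμ.le (mul_nonpos_of_nonneg_of_nonpos h3 h4)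
  have hint : ∀ a b : ℝ, IntervalIntegrable (fun u : ℝ => (xiPath μ ψ σ u)⁻¹ *
      deriv (xiPath μ ψ σ) u) MeasureTheory.volume a b := by
    intro a b
    refine ContinuousOn.intervalIntegrable fun u _ => ContinuousAt.continuousWithinAt ?_
    refine ContinuousAt.mul ?_ (continuous_deriv_xiPath.comp Complex.continuous_ofReal).continuousAt
    exact (hc _ (hb u)).comp (f := fun u : ℝ => xiPath μ ψ σ u)
      (continuous_xiPath.comp Complex.continuous_ofReal).continuousAt
  have hbR := integral_bottom_eq_sub (a := 0) (b := R)
    (P := fun z : ℂ => Complex.log (-((1 : ℝ) * Complex.I) * z)) (H := fun z => z⁻¹)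
    (μ := μ) (ψ := ψ) (σ := σ) (fun u hu => hd 1 one_ne_zero _ (hb u) (by
      rw [Set.uIcc_of_le hR.le] at hu
      simpa using him u (by simp) (by simpa using hT') (by simpa using hu.1)))
    (fun u _ => hc _ (hb u))
  have hbL := integral_bottom_eq_sub (a := -R) (b := 0)
    (P := fun z : ℂ => Complex.log (-((-1 : ℝ) * Complex.I) * z)) (H := fun z => z⁻¹)
    (μ := μ) (ψ := ψ) (σ := σ) (fun u hu => hd (-1) (by norm_num) _ (hb u) (by
      rw [Set.uIcc_of_le (by linarith)] at hu
      simpa using him' u (by simp) (by simpa using hT') (by simpa using hu.2)))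
    (fun u _ => hc _ (hb u))
  have hsR := integral_side_eq_sub (s := R) hT'
    (P := fun z : ℂ => Complex.log (-((1 : ℝ) * Complex.I) * z)) (H := fun z => z⁻¹)
    (μ := μ) (ψ := ψ) (σ := σ) (fun y hy => hd 1 one_ne_zero _ (hs R hR2 y hy) (by
      simpa using him (R + y * Complex.I) (by simpa using hy.1) (by simpa using hy.2)
        (by simpa using hR.le)))
    (fun y hy => hc _ (hs R hR2 y hy))
  have hsL := integral_side_eq_sub (s := -R) hT'
    (P := fun z : ℂ => Complex.log (-((-1 : ℝ) * Complex.I) * z)) (H := fun z => z⁻¹)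
    (μ := μ) (ψ := ψ) (σ := σ)
    (fun y hy => hd (-1) (by norm_num) _ (hs (-R) (by simpa using hR2) y hy) (by
      have := him' ((-R : ℝ) + y * Complex.I) (by simpa using hy.1) (by simpa using hy.2)
        (by simpa using hR.le)
      simpa using this))
    (fun y hy => hc _ (hs (-R) (by simpa using hR2) y hy))
  have h0 : xiPath μ ψ σ ((0 : ℝ) : ℂ) = ((1 - μ - σ + μ * Real.sin ψ : ℝ) : ℂ) := by
    apply Complex.ext
    · rw [xiPath_re, Complex.ofReal_re, Complex.ofReal_re, Complex.ofReal_im, sub_zero,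
        Real.cosh_zero, mul_one]
    · rw [xiPath_im]; simp
  rw [loopIntegral, ← intervalIntegral.integral_add_adjacent_intervals (hint (-R) 0) (hint 0 R),
    hbR, hbL, hsR, hsL, xiPath_top, xiPath_top, Real.cosh_neg, h0]
  have hx : 0 < -(1 - μ - σ - μ * Real.cosh R) := by linarith
  have hy : 0 < 1 - μ - σ + μ * Real.sin ψ := by
    have := mul_pos hμ (Real.sin_pos_of_pos_of_lt_pi hψ (by linarith))
    linarith
  set x := -(1 - μ - σ - μ * Real.cosh R) with hxdef
  set y := 1 - μ - σ + μ * Real.sin ψ with hydef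
  have hxx : 1 - μ - σ - μ * Real.cosh R = -x := by rw [hxdef]; ring
  have l1 : Complex.log (-(((1 : ℝ) : ℂ) * Complex.I) * ((-x : ℝ) : ℂ)) =
      Real.log x + π / 2 * Complex.I := by
    have : -(((1 : ℝ) : ℂ) * Complex.I) * ((-x : ℝ) : ℂ) = x * Complex.I := by
      push_cast; ring
    rw [this, Complex.log_ofReal_mul hx Complex.I_ne_zero, Complex.log_I]
  have l2 : Complex.log (-(((1 : ℝ) : ℂ) * Complex.I) * (y : ℂ)) =
      Real.log y - π / 2 * Complex.I := by
    have : -(((1 : ℝ) : ℂ) * Complex.I) * (y : ℂ) = y * -Complex.I := by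
      push_cast; ring
    rw [this, Complex.log_ofReal_mul hy (neg_ne_zero.2 Complex.I_ne_zero), Complex.log_neg_I]
    ring
  have l3 : Complex.log (-(((-1 : ℝ) : ℂ) * Complex.I) * (y : ℂ)) =
      Real.log y + π / 2 * Complex.I := by
    have : -(((-1 : ℝ) : ℂ) * Complex.I) * (y : ℂ) = y * Complex.I := by
      push_cast; ring
    rw [this, Complex.log_ofReal_mul hy Complex.I_ne_zero, Complex.log_I]
  have l4 : Complex.log (-(((-1 : ℝ) : ℂ) * Complex.I) * ((-x : ℝ) : ℂ)) =
      Real.log x - π / 2 * Complex.I := by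
    have : -(((-1 : ℝ) : ℂ) * Complex.I) * ((-x : ℝ) : ℂ) = x * -Complex.I := by
      push_cast; ring
    rw [this, Complex.log_ofReal_mul hx (neg_ne_zero.2 Complex.I_ne_zero), Complex.log_neg_I]
    ring
  rw [hxx, l1, l2, l3, l4]
  ring

/-- The residue at a pole of order `n + 1`, by induction on `n`: write `f ξ = f 0 + ξ g ξ`. -/
lemma loopIntegral_div_pow (hμ : 0 < μ) (hψ : 0 < ψ) (hψ2 : ψ < π / 2) (hμσ : μ + σ < 1) {R : ℝ}
    (hR : 0 < R) (hR1 : 1 - μ - σ < μ * Real.cosh R) {S : Set ℂ} (hS : IsOpen S) (hS0 : 0 ∈ S)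
    (hmem : ∀ w : ℂ, 0 ≤ w.im → w.im ≤ ψ + π / 2 → xiPath μ ψ σ w ∈ S) (n : ℕ) :
    ∀ f : ℂ → ℂ, DifferentiableOn ℂ f S →
      loopIntegral μ ψ σ (fun z => f z * (z ^ (n + 1))⁻¹) R =
        2 * π * Complex.I * (Function.swap dslope 0)^[n] f 0 := by
  have hP : ∀ w : ℂ, 0 ≤ w.im → w.im ≤ ψ + π / 2 → (w.im = 0 ∨ |w.re| = R) →
      xiPath μ ψ σ w ∈ S \ {0} := fun w h0 h1 h2 =>
    ⟨hmem w h0 h1, xiPath_ne_zero hμ hψ hψ2 hμσ hR hR1 h0 h1 h2⟩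
  have hpow : ∀ j : ℕ, ∀ z ∈ S \ {0}, ContinuousAt (fun z : ℂ => (z ^ j)⁻¹) z := fun j z hz =>
    (continuousAt_id.pow _).inv₀ (pow_ne_zero _ hz.2)
  have hcongr : ∀ H₁ H₂ : ℂ → ℂ, (∀ z ≠ 0, H₁ z = H₂ z) →
      loopIntegral μ ψ σ H₁ R = loopIntegral μ ψ σ H₂ R := by
    intro H₁ H₂ h
    have hT' : 0 ≤ ψ + π / 2 := by positivity
    have h1 : ∀ w : ℂ, 0 ≤ w.im → w.im ≤ ψ + π / 2 → (w.im = 0 ∨ |w.re| = R) →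
        H₁ (xiPath μ ψ σ w) = H₂ (xiPath μ ψ σ w) := fun w h0 h1 h2 => h _ (hP w h0 h1 h2).2
    simp only [loopIntegral]
    congr 1
    · congr 1
      · refine intervalIntegral.integral_congr fun u _ => ?_
        rw [h1 u (by simp) (by simpa using hT') (by simp)]
      · congr 1
        refine intervalIntegral.integral_congr fun y hy => ?_
        rw [Set.uIcc_of_le hT'] at hy
        rw [h1 _ (by simpa using hy.1) (by simpa using hy.2) (by simp [abs_of_pos hR])]
    · congr 1
      refine intervalIntegral.integral_congr fun y hy => ?_
      rw [Set.uIcc_of_le hT'] at hy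
      rw [h1 _ (by simpa using hy.1) (by simpa using hy.2) (by simp [abs_of_pos hR])]
  have hsplit : ∀ (f : ℂ → ℂ) (j : ℕ), DifferentiableOn ℂ f S →
      loopIntegral μ ψ σ (fun z => f z * (z ^ (j + 1))⁻¹) R =
        f 0 * loopIntegral μ ψ σ (fun z => (z ^ (j + 1))⁻¹) R +
          loopIntegral μ ψ σ (fun z => dslope f 0 z * (z ^ j)⁻¹) R := by
    intro f j hf
    have hg : DifferentiableOn ℂ (dslope f 0) S :=
      (Complex.differentiableOn_dslope (hS.mem_nhds hS0)).2 hf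
    rw [← loopIntegral_const_mul, ← loopIntegral_add hψ hP hR.le]
    · refine hcongr _ _ fun z hz => ?_
      have h1 := sub_smul_dslope f 0 z
      rw [sub_zero, smul_eq_mul] at h1
      have h2 : f z = f 0 + z * dslope f 0 z := by rw [h1]; ring
      rw [h2, pow_succ]
      field_simp
    · exact fun z hz => continuousAt_const.mul (hpow _ z hz)
    · exact fun z hz =>
        ((hg.continuousOn.continuousAt (hS.mem_nhds hz.1))).mul (hpow _ z hz)
  induction n with
  | zero =>
    intro f hf
    have hg : DifferentiableOn ℂ (dslope f 0) S :=
      (Complex.differentiableOn_dslope (hS.mem_nhds hS0)).2 hf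
    have h1 : loopIntegral μ ψ σ (fun z => dslope f 0 z * (z ^ 0)⁻¹) R = 0 := by
      simp only [pow_zero, inv_one, mul_one]
      exact loopIntegral_eq_zero hψ fun w h0 h1 =>
        hg.differentiableAt (hS.mem_nhds (hmem w h0 h1))
    rw [hsplit f 0 hf, h1]
    simp only [zero_add, pow_one, loopIntegral_inv hμ hψ hψ2 hμσ hR hR1, add_zero,
      Function.iterate_zero, id]
    ring
  | succ n ih =>
    intro f hf
    have hg : DifferentiableOn ℂ (dslope f 0) S :=
      (Complex.differentiableOn_dslope (hS.mem_nhds hS0)).2 hf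
    rw [hsplit f (n + 1) hf, loopIntegral_inv_pow hμ hψ hψ2 hμσ hR hR1, mul_zero, zero_add,
      ih _ hg, Function.iterate_succ_apply]

/-- **Contour representation of the Taylor coefficients.** The small circle of Cauchy's formula is
replaced by the hyperbola. The closing arc is carried in the parameter plane by the two vertical
sides of a rectangle, on which the integrand decays. -/
theorem integral_hyperbola_eq (hμ : 0 < μ) (hψ : 0 < ψ) (hψ2 : ψ < π / 2) (hμσ : μ + σ < 1)
    {Φ : ℂ → ℂ} {S : Set ℂ} (hS : IsOpen S) (hS1 : 1 ∈ S) (hΦ : DifferentiableOn ℂ Φ S)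
    (hmem : ∀ w : ℂ, 0 ≤ w.im → w.im ≤ ψ + π / 2 → hyperbola μ ψ σ w ∈ S) (n : ℕ)
    (hint : MeasureTheory.Integrable fun u : ℝ => deriv (hyperbola μ ψ σ) u *
      (1 - hyperbola μ ψ σ u) ^ (-1 - (n : ℤ)) * Φ (hyperbola μ ψ σ u))
    {E q R₀ : ℝ} (hq : 0 < q)
    (hdecay : ∀ w : ℂ, 0 ≤ w.im → w.im ≤ ψ + π / 2 → R₀ ≤ |w.re| →
      ‖deriv (hyperbola μ ψ σ) w * (1 - hyperbola μ ψ σ w) ^ (-1 - (n : ℤ)) *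
        Φ (hyperbola μ ψ σ w)‖ ≤ E * Real.exp (-q * |w.re|)) :
    ∫ u : ℝ, deriv (hyperbola μ ψ σ) u * (1 - hyperbola μ ψ σ u) ^ (-1 - (n : ℤ)) *
      Φ (hyperbola μ ψ σ u) =
        -(2 * π * Complex.I * (iteratedDeriv n (fun ξ => Φ (1 - ξ)) 0 / n.factorial)) := by
  have hT' : 0 ≤ ψ + π / 2 := by positivity
  set G : ℂ → ℂ := fun w => deriv (hyperbola μ ψ σ) w *
    (1 - hyperbola μ ψ σ w) ^ (-1 - (n : ℤ)) * Φ (hyperbola μ ψ σ w) with hG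
  set S' : Set ℂ := (fun ξ : ℂ => 1 - ξ) ⁻¹' S with hS'
  have hS'o : IsOpen S' := hS.preimage (by fun_prop)
  have hS'0 : (0 : ℂ) ∈ S' := by simpa [hS'] using hS1
  set f : ℂ → ℂ := fun ξ => Φ (1 - ξ) with hf
  have hfd : DifferentiableOn ℂ f S' :=
    hΦ.comp (by fun_prop) fun ξ hξ => hξ
  have hcoeff := iterate_dslope_eq ((hfd.analyticOnNhd hS'o) 0 hS'0) n
  have hGH : ∀ w, (fun z => f z * (z ^ (n + 1))⁻¹) (xiPath μ ψ σ w) * deriv (xiPath μ ψ σ) w =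
      -G w := by
    intro w
    have h1 : (-1 - (n : ℤ)) = -((n + 1 : ℕ) : ℤ) := by push_cast; ring
    simp only [hG, hf, deriv_xiPath, xiPath, sub_sub_cancel]
    rw [h1, zpow_neg, zpow_natCast]
    ring
  have hloop : ∀ R : ℝ, loopIntegral μ ψ σ (fun z => f z * (z ^ (n + 1))⁻¹) R =
      -((∫ u in (-R)..R, G (u : ℝ)) +
        Complex.I * (∫ y in (0 : ℝ)..(ψ + π / 2), G ((1 * R : ℝ) + (y : ℝ) * Complex.I)) -
        Complex.I * ∫ y in (0 : ℝ)..(ψ + π / 2), G ((-1 * R : ℝ) + (y : ℝ) * Complex.I)) := by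
    intro R
    rw [loopIntegral]
    simp only [hGH, intervalIntegral.integral_neg, one_mul, neg_one_mul]
    ring
  have hside : ∀ s : ℝ, |s| = 1 → Filter.Tendsto
      (fun R : ℝ => ∫ y in (0 : ℝ)..(ψ + π / 2), G ((s * R : ℝ) + (y : ℝ) * Complex.I))
      Filter.atTop (nhds 0) := by
    intro s hs
    have hlim : Filter.Tendsto (fun R : ℝ => E * Real.exp (-q * |s * R|) * |ψ + π / 2 - 0|)
        Filter.atTop (nhds 0) := by
      have h1 : Filter.Tendsto (fun R : ℝ => Real.exp (-q * |s * R|)) Filter.atTop (nhds 0) := by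
        refine Real.tendsto_exp_atBot.comp ?_
        simp only [abs_mul, hs, one_mul]
        exact Filter.tendsto_abs_atTop_atTop.const_mul_atTop_of_neg (by linarith)
      simpa using (h1.const_mul E).mul_const |ψ + π / 2 - 0|
    refine squeeze_zero_norm' ?_ hlim
    filter_upwards [Filter.eventually_ge_atTop R₀, Filter.eventually_ge_atTop 0] with R hR hR0
    refine intervalIntegral.norm_integral_le_of_norm_le_const fun y hy => ?_
    rw [Set.uIoc_of_le hT'] at hy
    have : ‖G ((s * R : ℝ) + (y : ℝ) * Complex.I)‖ ≤ _ := hdecay ((s * R : ℝ) + y * Complex.I) (by simpa using hy.1.le)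
      (by simpa using hy.2) (by simpa [abs_mul, hs, abs_of_nonneg hR0] using hR)
    simpa using this
  have hbot := MeasureTheory.intervalIntegral_tendsto_integral hint
    Filter.tendsto_neg_atTop_atBot Filter.tendsto_id
  have hsum := ((hbot.add ((hside 1 (by simp)).const_mul Complex.I)).sub
    ((hside (-1) (by simp)).const_mul Complex.I))
  simp only [mul_zero, add_zero, sub_zero] at hsum
  refine tendsto_nhds_unique hsum (tendsto_const_nhds.congr' ?_)
  have hcosh : ∀ᶠ R in Filter.atTop, 1 - μ - σ < μ * Real.cosh R :=
    (tendsto_cosh_atTop.const_mul_atTop hμ).eventually_gt_atTop _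
  filter_upwards [hcosh, Filter.eventually_gt_atTop 0] with R hR1 hR
  have h1 := loopIntegral_div_pow hμ hψ hψ2 hμσ hR hR1 hS'o hS'0 (fun w h0 h1 => by
    simpa [hS', xiPath] using hmem w h0 h1) n f hfd
  rw [hcoeff, hloop R] at h1
  rw [← h1, neg_neg]
  rfl

end Loop

/-! ### Pointwise bounds of the integrand -/

/-- The bound `‖Φ z‖ ≤ C (1 + ‖z‖) ^ (1 + Q) / ‖z‖` turns into a bound of the integrand by a power
of `‖1 - λ‖` wherever `‖1 - λ‖` is of the order of `1 + ‖λ‖`, because `‖λ'‖` is at most a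
multiple of `‖λ‖`. -/
lemma norm_integrand_le {μ ψ σ k Q C B : ℝ} (hμ : 0 < μ) (hσ : 0 ≤ σ) (hk0 : 0 ≤ k) (hk1 : k < 1)
    {Φ : ℂ → ℂ} (hΦ : ∀ z ∈ cone k, z ≠ 0 → ‖z‖ * ‖Φ z‖ ≤ C * (1 + ‖z‖) ^ (1 + Q)) (hC : 0 ≤ C)
    (hB : 1 ≤ B) {w : ℂ} (hw : Real.sin (ψ - w.im) ≤ k)
    (hw1 : 1 + ‖hyperbola μ ψ σ w‖ ≤ B * ‖1 - hyperbola μ ψ σ w‖) (n : ℕ) :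
    ‖deriv (hyperbola μ ψ σ) w * (1 - hyperbola μ ψ σ w) ^ (-1 - (n : ℤ)) *
      Φ (hyperbola μ ψ σ w)‖ ≤
      ((1 + 2 * (1 + k) / (1 - k)) / (1 - k) * C * B ^ |1 + Q|) *
        ‖1 - hyperbola μ ψ σ w‖ ^ (-((n : ℝ) - Q)) := by
  set l := hyperbola μ ψ σ w with hl
  set c := 1 + 2 * (1 + k) / (1 - k) with hc
  have hk2 : 0 < 1 - k := by linarith
  have hc0 : 0 < c := by positivity
  have hx := Real.one_le_cosh w.re
  have h1 := norm_hyperbola_ge hμ.le hσ hk0 hk1 hw (μ := μ) (σ := σ)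
  rw [← hl, ← hc] at h1
  have h2 : μ * Real.cosh w.re ≤ c / (1 - k) * ‖l‖ := by
    rw [div_mul_eq_mul_div, le_div_iff₀ hk2]
    nlinarith
  have hl0 : 0 < ‖l‖ := by
    have : 0 < μ * Real.cosh w.re := by positivity
    by_contra! h
    have h3 : ‖l‖ = 0 := le_antisymm h (norm_nonneg _)
    rw [h3, mul_zero] at h2
    linarith
  have hcone : l ∈ cone k := hyperbola_mem_cone hμ.le hσ hk0 hk1.le hw
  have h3 := hΦ l hcone (norm_pos_iff.1 hl0)
  have hA : 0 < ‖1 - l‖ := by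
    by_contra! h
    have : B * ‖1 - l‖ ≤ 0 := mul_nonpos_of_nonneg_of_nonpos (by linarith) h
    linarith
  have h4 : (1 + ‖l‖) ^ (1 + Q) ≤ B ^ |1 + Q| * ‖1 - l‖ ^ (1 + Q) := by
    refine rpow_le_of_comparable hA hB ?_ hw1 _
    have := norm_sub_le (1 : ℂ) l
    rw [norm_one] at this
    nlinarith
  have h5 : ‖(1 - l) ^ (-1 - (n : ℤ))‖ = ‖1 - l‖ ^ (-1 - (n : ℝ)) := by
    rw [norm_zpow, ← Real.rpow_intCast]
    push_cast
    rfl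
  rw [norm_mul, norm_mul, h5]
  calc ‖deriv (hyperbola μ ψ σ) w‖ * ‖1 - l‖ ^ (-1 - (n : ℝ)) * ‖Φ l‖
      ≤ (c / (1 - k) * ‖l‖) * ‖1 - l‖ ^ (-1 - (n : ℝ)) * ‖Φ l‖ := by
        gcongr
        exact (norm_deriv_hyperbola_le hμ.le ψ σ w).trans h2
    _ = c / (1 - k) * ‖1 - l‖ ^ (-1 - (n : ℝ)) * (‖l‖ * ‖Φ l‖) := by ring
    _ ≤ c / (1 - k) * ‖1 - l‖ ^ (-1 - (n : ℝ)) *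
        (C * (B ^ |1 + Q| * ‖1 - l‖ ^ (1 + Q))) := by
        refine mul_le_mul_of_nonneg_left (h3.trans ?_) (by positivity)
        exact mul_le_mul_of_nonneg_left h4 hC
    _ = (c / (1 - k) * C * B ^ |1 + Q|) * (‖1 - l‖ ^ (-1 - (n : ℝ)) * ‖1 - l‖ ^ (1 + Q)) := by
        ring
    _ = _ := by
        rw [← Real.rpow_add hA]
        congr 2
        ring

section Strip

variable {μ ψ σ d : ℝ}

/-- Two lower bounds for `1 - λ(w)` in the strip `|Im w| ≤ d`: by its real part, which is sharp
near the vertex, and by its modulus, which is sharp far out. -/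
lemma strip_bounds (hμ : 0 < μ) (hμ1 : μ ≤ 2 / 3) (hσ1 : σ ≤ 1 / 12)
    (hψd : 0 < ψ - d) (hψd2 : ψ + d < π / 2) {w : ℂ} (hw : |w.im| ≤ d) :
    1 - μ - σ + Real.sin (ψ - d) * (μ * Real.cosh w.re) ≤ (1 - hyperbola μ ψ σ w).re ∧
      (μ * Real.cosh w.re) ^ 2 - 1 ≤ ‖1 - hyperbola μ ψ σ w‖ ^ 2 := by
  have hw' := abs_le.1 hw
  have h1 : Real.sin (ψ - d) ≤ Real.sin (ψ - w.im) :=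
    Real.sin_le_sin_of_le_of_le_pi_div_two (by linarith) (by linarith) (by linarith)
  have h0 : 0 < Real.sin (ψ - d) := Real.sin_pos_of_pos_of_lt_pi hψd (by linarith)
  have hx := Real.one_le_cosh w.re
  have hre : (1 - hyperbola μ ψ σ w).re =
      1 - μ - σ + μ * (Real.sin (ψ - w.im) * Real.cosh w.re) := xiPath_re w
  have him : (1 - hyperbola μ ψ σ w).im = μ * (Real.cos (ψ - w.im) * Real.sinh w.re) :=
    xiPath_im w
  have hmx : 0 < μ * Real.cosh w.re := by positivity
  constructor
  · rw [hre]
    nlinarith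
  · rw [sq_norm_eq_add_sq, hre, him]
    have h3 := Real.cosh_sq w.re
    have h4 := Real.sin_sq_add_cos_sq (ψ - w.im)
    have h6 : Real.sinh w.re ^ 2 = Real.cosh w.re ^ 2 - 1 := by linarith
    have h5 : (μ * (Real.cos (ψ - w.im) * Real.sinh w.re)) ^ 2 =
        μ ^ 2 * (1 - Real.sin (ψ - w.im) ^ 2) * (Real.cosh w.re ^ 2 - 1) := by
      rw [mul_pow, mul_pow, h6, ← h4]
      ring
    rw [h5]
    have h7 : 0 ≤ μ * (Real.sin (ψ - w.im) * Real.cosh w.re) := by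
      have : 0 ≤ Real.sin (ψ - w.im) := by linarith
      positivity
    have h8 : (μ * (Real.sin (ψ - w.im) * Real.cosh w.re)) ^ 2 ≤
        (1 - μ - σ + μ * (Real.sin (ψ - w.im) * Real.cosh w.re)) ^ 2 :=
      pow_le_pow_left₀ h7 (by linarith) 2
    have h9 : μ ^ 2 * (1 - Real.sin (ψ - w.im) ^ 2) ≤ 1 := by
      nlinarith [sq_nonneg (Real.sin (ψ - w.im))]
    nlinarith

lemma one_add_norm_le_strip (hμ : 0 < μ) (hμ1 : μ ≤ 2 / 3) (hσ : 0 ≤ σ) (hσ1 : σ ≤ 1 / 12)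
    (hψd : 0 < ψ - d) (hψd2 : ψ + d < π / 2) {w : ℂ} (hw : |w.im| ≤ d) :
    1 + ‖hyperbola μ ψ σ w‖ ≤ 5 / Real.sin (ψ - d) * ‖1 - hyperbola μ ψ σ w‖ := by
  have h0 : 0 < Real.sin (ψ - d) :=
    Real.sin_pos_of_pos_of_lt_pi hψd (by linarith [(abs_nonneg w.im).trans hw])
  have h1 := (strip_bounds hμ hμ1 hσ1 hψd hψd2 hw).1
  have h2 := Complex.re_le_norm (1 - hyperbola μ ψ σ w)
  have h3 := norm_hyperbola_le hμ.le hσ ψ w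
  have h4 := Real.sin_le_one (ψ - d)
  have hmx : 0 < μ * Real.cosh w.re := mul_pos hμ (Real.cosh_pos _)
  rw [div_mul_eq_mul_div, le_div_iff₀ h0]
  nlinarith [mul_pos h0 hmx]

end Strip

lemma exp_div_one_add_le {a z : ℝ} (hz : 0 ≤ z) (hza : z ≤ a) :
    Real.exp (z / (1 + a)) ≤ 1 + z := by
  have h1 : z / (1 + a) ≤ z / (1 + z) := div_le_div_of_nonneg_left hz (by linarith) (by linarith)
  have h2 := Real.add_one_le_exp (-(z / (1 + z)))
  have h3 : -(z / (1 + z)) + 1 = (1 + z)⁻¹ := by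
    field_simp
    ring
  rw [h3, Real.exp_neg] at h2
  exact (Real.exp_le_exp.2 h1).trans ((inv_le_inv₀ (by positivity) (Real.exp_pos _)).1 h2)

/-- Decay of the integrand where `μ cosh u ≤ 12`: here `‖1 - λ‖` is at least
`exp (-4 (μ + σ) + k₂ μ cosh u)`. -/
lemma rpow_neg_le_near {a Q K : ℝ} (ha : 0 < a) {μ σ A x X u : ℝ} {n : ℕ}
    {q : ℝ} (hq1 : q ≤ 1)
    (hμ : 0 < μ) (hμ1 : μ ≤ 2 / 3) (hσ : 0 ≤ σ) (hσ1 : σ ≤ 1 / 12)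
    (hs : 1 ≤ 3 / 2 * (μ * n)) (hK : n * σ ≤ K) (hQ : Q < n) (hX : X ≤ x)
    (hx : 1 ≤ x) (hu : Real.exp |u| ≤ 2 * x) (hA : 1 - μ - σ + a * (μ * x) ≤ A)
    (hL : μ * x ≤ 12) :
    A ^ (-((n : ℝ) - Q)) ≤ (Real.exp (4 * (|K| + |Q|) + 12 * |Q|) * (6 * (1 + 12 * a) / a)) *
      Real.exp (-q * |u|) * Real.exp ((8 - a / (1 + 12 * a) * X) * (μ * n) / 2) := by
  set k := a / (1 + 12 * a) with hk
  have hk0 : 0 < k := by positivity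
  have hk1 : k ≤ 1 := by
    rw [hk, div_le_one (by positivity)]
    linarith
  have hmx : 0 < μ * x := by positivity
  have hAexp : Real.exp (-4 * (μ + σ) + k * (μ * x)) ≤ A := by
    have h1 : Real.exp (k * (μ * x)) ≤ 1 + a * (μ * x) := by
      have := exp_div_one_add_le (a := 12 * a) (z := a * (μ * x)) (by positivity) (by nlinarith)
      convert this using 2
      rw [hk]
      ring
    have h2 : Real.exp (-4 * (μ + σ)) ≤ 1 - (μ + σ) := by
      have h3 := Real.add_one_le_exp (4 * (μ + σ))
      have h4 : 0 < 1 - (μ + σ) := by linarith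
      have h5 : -4 * (μ + σ) = -(4 * (μ + σ)) := by ring
      rw [h5, Real.exp_neg, inv_le_comm₀ (Real.exp_pos _) h4]
      refine le_trans ?_ h3
      rw [inv_le_iff_one_le_mul₀ h4]
      nlinarith
    rw [Real.exp_add]
    calc _ ≤ (1 - (μ + σ)) * (1 + a * (μ * x)) :=
          mul_le_mul h2 h1 (Real.exp_pos _).le (by linarith)
      _ ≤ 1 - μ - σ + a * (μ * x) := by
          have : 0 ≤ (μ + σ) * (a * (μ * x)) := by positivity
          linarith
      _ ≤ A := hA
  have hM : 0 < (n : ℝ) - Q := by linarith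
  have h1 : A ^ (-((n : ℝ) - Q)) ≤
      Real.exp (-4 * (μ + σ) + k * (μ * x)) ^ (-((n : ℝ) - Q)) :=
    Real.rpow_le_rpow_of_nonpos (Real.exp_pos _) hAexp (by linarith)
  rw [← Real.exp_mul] at h1
  have h2 : (-4 * (μ + σ) + k * (μ * x)) * (-((n : ℝ) - Q)) ≤
      (4 * (|K| + |Q|) + 12 * |Q|) + (8 - k * X) * (μ * n) / 2 - k * x / 3 := by
    have e1 : (μ + σ) * ((n : ℝ) - Q) ≤ μ * n + |K| + |Q| := by
      have h3 : (μ + σ) * (-Q) ≤ (μ + σ) * |Q| :=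
        mul_le_mul_of_nonneg_left (neg_le_abs Q) (by linarith)
      have h4 : (μ + σ) * |Q| ≤ 1 * |Q| :=
        mul_le_mul_of_nonneg_right (by linarith) (abs_nonneg Q)
      have h5 := le_abs_self K
      linarith
    have e2 : k * (μ * x) * Q ≤ 12 * |Q| := by
      have h3 : k * (μ * x) ≤ 12 := by nlinarith
      calc _ ≤ k * (μ * x) * |Q| := mul_le_mul_of_nonneg_left (le_abs_self Q) (by positivity)
        _ ≤ _ := mul_le_mul_of_nonneg_right h3 (abs_nonneg Q)
    have e3 : k * x / 3 ≤ k * x * (μ * n) / 2 := by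
      have : 0 < k * x := by positivity
      nlinarith
    have e4 : k * X * (μ * n) / 2 ≤ k * x * (μ * n) / 2 := by
      have : 0 < μ * n := by linarith
      gcongr
    nlinarith
  have h3 : Real.exp (-(k * x / 3)) ≤ 6 * (1 + 12 * a) / a * Real.exp (-q * |u|) := by
    have h4 : k * x / 3 ≤ Real.exp (k * x / 3) := by linarith [Real.add_one_le_exp (k * x / 3)]
    have h5 : Real.exp (q * |u|) ≤ 2 * x := by
      refine le_trans (Real.exp_le_exp.2 ?_) hu
      nlinarith [abs_nonneg u]
    have h6 : 6 * (1 + 12 * a) / a = 6 / k := by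
      rw [hk]
      field_simp
    rw [h6, Real.exp_neg, neg_mul, Real.exp_neg, ← div_eq_mul_inv, le_div_iff₀ (Real.exp_pos _),
      inv_mul_le_iff₀ (Real.exp_pos _)]
    calc Real.exp (q * |u|) ≤ 2 * x := h5
      _ = k * x / 3 * (6 / k) := by field_simp; norm_num
      _ ≤ _ := by gcongr
  calc _ ≤ _ := h1
    _ ≤ _ := Real.exp_le_exp.2 h2
    _ = Real.exp (4 * (|K| + |Q|) + 12 * |Q|) * Real.exp ((8 - k * X) * (μ * n) / 2) *
        Real.exp (-(k * x / 3)) := by rw [← Real.exp_add, ← Real.exp_add]; congr 1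
    _ ≤ Real.exp (4 * (|K| + |Q|) + 12 * |Q|) * Real.exp ((8 - k * X) * (μ * n) / 2) *
        (6 * (1 + 12 * a) / a * Real.exp (-q * |u|)) := by gcongr
    _ = _ := by ring

/-- Decay of the integrand where `μ cosh u > 12`: here `‖1 - λ‖` exceeds
`1 + 3/4 μ cosh u` by a constant factor larger than `1`. When the exponent is at least `1` the
powers of this factor compensate for the smallness of `μ ≥ 2 / (3 n)`; otherwise `n` is bounded in
terms of `Q`. -/
lemma rpow_neg_le_far {Q : ℝ} {μ A x X u : ℝ} {n : ℕ} {q : ℝ} (hq0 : 0 < q) (hq1 : q ≤ 1)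
    (hμ : 0 < μ) (hs : 1 ≤ 3 / 2 * (μ * n)) (hQ : q ≤ n - Q) (hX0 : 0 ≤ X) (hX : X ≤ x)
    (hu : Real.exp |u| ≤ 2 * x) (hA0 : 0 < A) (hA : (μ * x) ^ 2 - 1 ≤ A ^ 2) (hL : 12 < μ * x) :
    A ^ (-((n : ℝ) - Q)) ≤ ((7 / 6) ^ |Q| * 24 * Real.exp |Q| + 4 * (|Q| + 1)) *
      Real.exp (-q * |u|) *
        (1 + 3 / 2 * (μ * n) / (2 * (n - Q)) * X) ^ (1 - (n : ℝ) + Q) := by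
  set M := (n : ℝ) - Q with hM
  set y := 3 / 4 * (μ * x) with hy
  have hM0 : 0 < M := by linarith
  have hx0 : 0 < x := by
    by_contra! h
    nlinarith
  have hy0 : 0 < y := by positivity
  have hn : 0 < (n : ℝ) := by
    by_contra! h
    nlinarith
  have hAy : 7 / 6 * (1 + y) ≤ A := by
    refine (sq_le_sq₀ (by positivity) hA0.le).1 (le_trans ?_ hA)
    rw [hy]
    nlinarith
  have hqu : Real.exp (q * |u|) ≤ 2 * x :=
    (Real.exp_le_exp.2 (by nlinarith [abs_nonneg u])).trans hu
  have hbase : 1 ≤ 1 + 3 / 2 * (μ * n) / (2 * M) * X := by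
    have : 0 ≤ 3 / 2 * (μ * n) / (2 * M) * X := by positivity
    linarith
  have hexp : 1 - (n : ℝ) + Q = 1 - M := by rw [hM]; ring
  rw [hexp]
  have hAM : A ^ (-M) ≤ (7 / 6 * (1 + y)) ^ (-M) :=
    Real.rpow_le_rpow_of_nonpos (by positivity) hAy (by linarith)
  refine hAM.trans ?_
  rcases le_or_gt 1 M with h1M | h1M
  · have h1 : (7 / 6 : ℝ) ^ (-M) ≤ (7 / 6) ^ |Q| * (9 * μ) := by
      have e1 : (7 / 6 : ℝ) ^ (-M) = (7 / 6) ^ Q * ((7 / 6) ^ n)⁻¹ := by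
        rw [hM, neg_sub, Real.rpow_sub (by norm_num), Real.rpow_natCast, div_eq_mul_inv]
      have e2 : (n : ℝ) / 6 ≤ (7 / 6) ^ n := by
        have := one_add_mul_le_pow (a := (1 / 6 : ℝ)) (by norm_num) n
        norm_num at this
        linarith
      have e3 : ((7 / 6 : ℝ) ^ n)⁻¹ ≤ 9 * μ := by
        rw [inv_le_iff_one_le_mul₀ (by positivity)]
        nlinarith
      rw [e1]
      refine mul_le_mul ?_ e3 (by positivity) (by positivity)
      exact Real.rpow_le_rpow_of_exponent_le (by norm_num) (le_abs_self Q)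
    have h2 : (1 + y) ^ (-M) ≤ (1 + y) ^ (1 - M) * (y⁻¹) := by
      have e1 : -M = (1 - M) + (-1) := by ring
      rw [e1, Real.rpow_add (by positivity), Real.rpow_neg_one]
      gcongr
      linarith
    have h3 : (1 + y) ^ (1 - M) ≤ Real.exp |Q| *
        (1 + 3 / 2 * (μ * n) / (2 * M) * X) ^ (1 - M) := by
      have e0 : 1 + 3 / 2 * (μ * n) / (2 * M) * X ≤ (1 + |Q| / M) * (1 + y) := by
        have e1 : (n : ℝ) / M ≤ 1 + |Q| / M := by
          rw [← sub_le_iff_le_add', ← div_self hM0.ne', ← sub_div]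
          gcongr
          linarith [le_abs_self Q]
        have e2 : 3 / 2 * (μ * n) / (2 * M) * X = (n / M) * (3 / 4 * (μ * X)) := by
          field_simp
          ring
        have e3 : 3 / 4 * (μ * X) ≤ y := by rw [hy]; gcongr
        have e4 : (n : ℝ) / M * (3 / 4 * (μ * X)) ≤ (1 + |Q| / M) * y := by gcongr
        have e5 : 0 ≤ |Q| / M := by positivity
        rw [e2]
        linarith
      have e1 : ((1 + |Q| / M) * (1 + y)) ^ (1 - M) ≤
          (1 + 3 / 2 * (μ * n) / (2 * M) * X) ^ (1 - M) :=
        Real.rpow_le_rpow_of_nonpos (by linarith) e0 (by linarith)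
      rw [Real.mul_rpow (by positivity) (by positivity)] at e1
      have e2 : Real.exp (-|Q|) ≤ (1 + |Q| / M) ^ (1 - M) := by
        have e3 : (1 + |Q| / M) ≤ Real.exp (|Q| / M) := by
          linarith [Real.add_one_le_exp (|Q| / M)]
        have e4 : Real.exp (|Q| / M) ^ (1 - M) ≤ (1 + |Q| / M) ^ (1 - M) :=
          Real.rpow_le_rpow_of_nonpos (by positivity) e3 (by linarith)
        refine le_trans ?_ e4
        rw [← Real.exp_mul]
        refine Real.exp_le_exp.2 ?_
        have : |Q| / M * (1 - M) = |Q| / M - |Q| := by field_simp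
        rw [this]
        have : 0 ≤ |Q| / M := by positivity
        linarith
      calc (1 + y) ^ (1 - M) = Real.exp |Q| * (Real.exp (-|Q|) * (1 + y) ^ (1 - M)) := by
            rw [← mul_assoc, ← Real.exp_add]; simp
        _ ≤ Real.exp |Q| * ((1 + |Q| / M) ^ (1 - M) * (1 + y) ^ (1 - M)) := by gcongr
        _ ≤ _ := by gcongr
    have h4 : 9 * μ * y⁻¹ ≤ 24 * Real.exp (-q * |u|) := by
      rw [neg_mul, Real.exp_neg, ← div_eq_mul_inv, ← div_eq_mul_inv,
        div_le_div_iff₀ hy0 (Real.exp_pos _), hy]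
      nlinarith
    have hbp : 0 < (1 + 3 / 2 * (μ * n) / (2 * M) * X) ^ (1 - M) :=
      Real.rpow_pos_of_pos (by linarith) _
    rw [Real.mul_rpow (by norm_num) (by positivity)]
    calc (7 / 6 : ℝ) ^ (-M) * (1 + y) ^ (-M)
        ≤ ((7 / 6) ^ |Q| * (9 * μ)) * ((1 + y) ^ (1 - M) * y⁻¹) := by gcongr
      _ ≤ ((7 / 6) ^ |Q| * (9 * μ)) * ((Real.exp |Q| *
          (1 + 3 / 2 * (μ * n) / (2 * M) * X) ^ (1 - M)) * y⁻¹) := by gcongr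
      _ = (7 / 6) ^ |Q| * Real.exp |Q| * (1 + 3 / 2 * (μ * n) / (2 * M) * X) ^ (1 - M) *
          (9 * μ * y⁻¹) := by ring
      _ ≤ (7 / 6) ^ |Q| * Real.exp |Q| * (1 + 3 / 2 * (μ * n) / (2 * M) * X) ^ (1 - M) *
          (24 * Real.exp (-q * |u|)) := by gcongr
      _ = ((7 / 6) ^ |Q| * 24 * Real.exp |Q|) * Real.exp (-q * |u|) *
          (1 + 3 / 2 * (μ * n) / (2 * M) * X) ^ (1 - M) := by ring
      _ ≤ _ := by
          gcongr
          have : 0 ≤ 4 * (|Q| + 1) := by positivity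
          linarith
  · have h1 : (1 : ℝ) ≤ (1 + 3 / 2 * (μ * n) / (2 * M) * X) ^ (1 - M) :=
      Real.one_le_rpow hbase (by linarith)
    have h2 : (7 / 6 * (1 + y)) ^ (-M) ≤ 4 * (|Q| + 1) * Real.exp (-q * |u|) := by
      have e0 : (n : ℝ) ≤ |Q| + 1 := by linarith [le_abs_self Q]
      have e1 : Real.exp |u| / (4 * (|Q| + 1)) ≤ 7 / 6 * (1 + y) := by
        have : 0 < 4 * (|Q| + 1) := by positivity
        rw [div_le_iff₀ this]
        have e2 : 1 ≤ 3 / 2 * (μ * (|Q| + 1)) := hs.trans (by gcongr)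
        calc Real.exp |u| ≤ 2 * x * 1 := by linarith
          _ ≤ 2 * x * (3 / 2 * (μ * (|Q| + 1))) := by gcongr
          _ = y * (4 * (|Q| + 1)) := by rw [hy]; ring
          _ ≤ _ := by gcongr; linarith
      calc (7 / 6 * (1 + y)) ^ (-M) ≤ (7 / 6 * (1 + y)) ^ (-q) :=
            Real.rpow_le_rpow_of_exponent_le (by linarith) (by linarith)
        _ ≤ (Real.exp |u| / (4 * (|Q| + 1))) ^ (-q) :=
            Real.rpow_le_rpow_of_nonpos (by positivity) e1 (by linarith)
        _ = (4 * (|Q| + 1)) ^ q * Real.exp (-q * |u|) := by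
            rw [Real.div_rpow (Real.exp_pos _).le (by positivity), ← Real.exp_mul,
              Real.rpow_neg (by positivity), div_inv_eq_mul, mul_comm]
            congr 2
            ring
        _ ≤ (4 * (|Q| + 1)) ^ (1 : ℝ) * Real.exp (-q * |u|) := by
            gcongr
            · linarith [abs_nonneg Q]
        _ = _ := by rw [Real.rpow_one]
    calc _ ≤ 4 * (|Q| + 1) * Real.exp (-q * |u|) * 1 := by rw [mul_one]; exact h2
      _ ≤ ((7 / 6) ^ |Q| * 24 * Real.exp |Q| + 4 * (|Q| + 1)) * Real.exp (-q * |u|) *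
          (1 + 3 / 2 * (μ * n) / (2 * M) * X) ^ (1 - M) := by
        gcongr
        have : 0 ≤ (7 / 6 : ℝ) ^ |Q| * 24 * Real.exp |Q| := by positivity
        linarith

/-! ### Uniform decay and truncation -/

/-- The integrand of the contour representation of `ω_n`, for `τ = 1`. -/
def integrand (Φ : ℂ → ℂ) (μ ψ σ : ℝ) (n : ℕ) (w : ℂ) : ℂ :=
  deriv (hyperbola μ ψ σ) w * (1 - hyperbola μ ψ σ w) ^ (-1 - (n : ℤ)) * Φ (hyperbola μ ψ σ w)

/-- The sum of the two truncation terms of the error bound, as a function of `X = cosh (N h)`. -/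
def truncationBound (a₂ Q μ : ℝ) (n : ℕ) (X : ℝ) : ℝ :=
  Real.exp ((8 - a₂ * X) * (μ * n) / 2) + Real.exp (8 * (μ * n) / 2) *
    (1 + 3 / 2 * (μ * n) / (2 * (n - Q)) * X) ^ (1 - (n : ℝ) + Q)

/-- `⌊Q⌋ + 1 - Q` is a lower bound, uniform in `n`, for `n - Q`. -/
lemma floor_add_one_sub_le {Q : ℝ} {n : ℕ} (h : Q < n) : (⌊Q⌋ : ℝ) + 1 - Q ≤ n - Q := by
  have h1 : ⌊Q⌋ < (n : ℤ) := Int.floor_lt.2 (by exact_mod_cast h)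
  have h2 : ((⌊Q⌋ + 1 : ℤ) : ℝ) ≤ ((n : ℤ) : ℝ) := by exact_mod_cast h1
  push_cast at h2
  linarith

/-- Decay of the integrand in the strip: the bound holds with any `X ≤ cosh u`, so that with
`X = 1` it controls the whole line and with `X = cosh (N h)` the part that is cut off. -/
lemma exists_norm_integrand_le {ψ d k C₀ Q K : ℝ} (hψd : 0 < ψ - d) (hd : 0 < d)
    (hψd2 : ψ + d < π / 2) (hk : k = Real.sin (ψ + d)) {Φ : ℂ → ℂ} (hC₀ : 0 < C₀)
    (hΦ : ∀ z ∈ cone k, z ≠ 0 → ‖z‖ * ‖Φ z‖ ≤ C₀ * (1 + ‖z‖) ^ (1 + Q)) :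
    ∃ C : ℝ, 0 < C ∧ ∀ (μ σ : ℝ) (n : ℕ), 0 < μ → μ ≤ 2 / 3 → 0 ≤ σ → σ ≤ 1 / 12 →
      1 ≤ 3 / 2 * (μ * n) → n * σ ≤ K → Q < n → ∀ (X : ℝ) (w : ℂ), |w.im| ≤ d → 0 ≤ X →
      X ≤ Real.cosh w.re →
      ‖integrand Φ μ ψ σ n w‖ ≤
        C * truncationBound (Real.sin (ψ - d) / (1 + 12 * Real.sin (ψ - d))) Q μ n X *
          Real.exp (-((⌊Q⌋ : ℝ) + 1 - Q) * |w.re|) := by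
  set a := Real.sin (ψ - d) with ha
  have ha0 : 0 < a := Real.sin_pos_of_pos_of_lt_pi hψd (by linarith)
  have ha1 : a ≤ 1 := Real.sin_le_one _
  have hk0 : 0 ≤ k := hk ▸ Real.sin_nonneg_of_nonneg_of_le_pi (by linarith) (by linarith)
  have hk1 : k < 1 := by
    rw [hk, ← Real.sin_pi_div_two]
    exact Real.sin_lt_sin_of_lt_of_le_pi_div_two (by linarith) le_rfl hψd2
  set q := (⌊Q⌋ : ℝ) + 1 - Q with hq
  have hq0 : 0 < q := by linarith [Int.lt_floor_add_one Q]
  have hq1 : q ≤ 1 := by linarith [Int.floor_le Q]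
  have hB : 1 ≤ 5 / a := by
    rw [le_div_iff₀ ha0]
    linarith
  set C₁ := (1 + 2 * (1 + k) / (1 - k)) / (1 - k) * C₀ * (5 / a) ^ |1 + Q| with hC₁
  have hC₁0 : 0 < C₁ := by
    have : 0 < 1 - k := by linarith
    positivity
  set C₂ := Real.exp (4 * (|K| + |Q|) + 12 * |Q|) * (6 * (1 + 12 * a) / a) with hC₂
  set C₃ := (7 / 6 : ℝ) ^ |Q| * 24 * Real.exp |Q| + 4 * (|Q| + 1) with hC₃
  have hC₂0 : 0 < C₂ := by positivity
  have hC₃0 : 0 < C₃ := by positivity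
  refine ⟨C₁ * (C₂ + C₃), by positivity, ?_⟩
  intro μ σ n hμ hμ1 hσ hσ1 hs hK hQ X w hw hX0 hX
  have hw' := abs_le.1 hw
  have hwk : Real.sin (ψ - w.im) ≤ k := by
    rw [hk]
    exact Real.sin_le_sin_of_le_of_le_pi_div_two (by linarith) (by linarith) (by linarith)
  have h1 := norm_integrand_le hμ hσ hk0 hk1 hΦ hC₀.le hB hwk
    (one_add_norm_le_strip hμ hμ1 hσ hσ1 hψd hψd2 hw) n
  obtain ⟨h2, h3⟩ := strip_bounds hμ hμ1 hσ1 hψd hψd2 hw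
  have hx := Real.one_le_cosh w.re
  have hA : 1 - μ - σ + a * (μ * Real.cosh w.re) ≤ ‖1 - hyperbola μ ψ σ w‖ :=
    h2.trans (Complex.re_le_norm _)
  have hA0 : 0 < ‖1 - hyperbola μ ψ σ w‖ := by
    have : 0 < a * (μ * Real.cosh w.re) := by positivity
    linarith
  have hqM : q ≤ n - Q := floor_add_one_sub_le hQ
  set A := ‖1 - hyperbola μ ψ σ w‖ with hAdef
  have hP1 : 0 < Real.exp ((8 - a / (1 + 12 * a) * X) * (μ * n) / 2) := Real.exp_pos _
  have hP2 : 0 < (1 + 3 / 2 * (μ * n) / (2 * (n - Q)) * X) ^ (1 - (n : ℝ) + Q) := by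
    refine Real.rpow_pos_of_pos ?_ _
    have : 0 ≤ 3 / 2 * (μ * n) / (2 * (n - Q)) * X := by
      have : 0 < (n : ℝ) - Q := by linarith
      positivity
    linarith
  have hE : 1 ≤ Real.exp (8 * (μ * n) / 2) := by
    refine Real.one_le_exp ?_
    positivity
  have key : A ^ (-((n : ℝ) - Q)) ≤ (C₂ + C₃) * truncationBound (a / (1 + 12 * a)) Q μ n X *
      Real.exp (-q * |w.re|) := by
    rw [truncationBound]
    set P₁ := Real.exp ((8 - a / (1 + 12 * a) * X) * (μ * n) / 2)
    set P₂ := (1 + 3 / 2 * (μ * n) / (2 * (n - Q)) * X) ^ (1 - (n : ℝ) + Q)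
    set e := Real.exp (8 * (μ * n) / 2)
    set r := Real.exp (-q * |w.re|)
    have hr : 0 < r := Real.exp_pos _
    have hePos : P₂ ≤ e * P₂ := le_mul_of_one_le_left hP2.le hE
    rcases le_or_gt (μ * Real.cosh w.re) 12 with hL | hL
    · have h4 := rpow_neg_le_near ha0 hq1 hμ hμ1 hσ hσ1 hs hK hQ hX hx
        (exp_abs_le_two_mul_cosh w.re) hA hL
      calc _ ≤ C₂ * r * P₁ := h4
        _ = C₂ * P₁ * r := by ring
        _ ≤ (C₂ + C₃) * (P₁ + e * P₂) * r := by
          gcongr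
          · linarith
          · linarith
    · have h4 := rpow_neg_le_far hq0 hq1 hμ hs hqM hX0 hX
        (exp_abs_le_two_mul_cosh w.re) hA0 h3 hL
      calc _ ≤ C₃ * r * P₂ := h4
        _ = C₃ * P₂ * r := by ring
        _ ≤ (C₂ + C₃) * (P₁ + e * P₂) * r := by
          gcongr
          · linarith
          · linarith
  calc _ ≤ C₁ * A ^ (-((n : ℝ) - Q)) := h1
    _ ≤ C₁ * ((C₂ + C₃) * truncationBound (a / (1 + 12 * a)) Q μ n X *
      Real.exp (-q * |w.re|)) := by gcongr
    _ = _ := by ring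

lemma truncationBound_one_le {a₂ Q μ : ℝ} {n : ℕ} (ha₂ : 0 ≤ a₂) (hμ : 0 < μ)
    (hμ1 : μ ≤ 2 / 3) (hQ : Q < n) : truncationBound a₂ Q μ n 1 ≤
      (2 + (|Q| + 1) / (2 * ((⌊Q⌋ : ℝ) + 1 - Q))) * Real.exp (8 * (μ * n) / 2) := by
  have hqM := floor_add_one_sub_le hQ
  set q := (⌊Q⌋ : ℝ) + 1 - Q with hq
  have hq0 : 0 < q := by linarith [Int.lt_floor_add_one Q]
  have hM : 0 < (n : ℝ) - Q := by linarith
  have h1 : Real.exp ((8 - a₂ * 1) * (μ * n) / 2) ≤ Real.exp (8 * (μ * n) / 2) := by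
    refine Real.exp_le_exp.2 ?_
    have : 0 ≤ a₂ * (μ * n) := by positivity
    linarith
  have hz : 0 ≤ 3 / 2 * (μ * n) / (2 * (n - Q)) := by positivity
  have h2 : (1 + 3 / 2 * (μ * n) / (2 * (n - Q)) * 1) ^ (1 - (n : ℝ) + Q) ≤
      1 + (|Q| + 1) / (2 * q) := by
    have h0 : 0 ≤ (|Q| + 1) / (2 * q) := by positivity
    rcases le_or_gt 1 ((n : ℝ) - Q) with h | h
    · refine (Real.rpow_le_one_of_one_le_of_nonpos (by linarith) (by linarith)).trans ?_
      linarith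
    · refine (Real.rpow_le_rpow_of_exponent_le (by linarith)
        (by linarith : 1 - (n : ℝ) + Q ≤ 1)).trans ?_
      rw [Real.rpow_one, mul_one]
      gcongr
      have : (n : ℝ) ≤ |Q| + 1 := by linarith [le_abs_self Q]
      have h3 : 0 ≤ (n : ℝ) := n.cast_nonneg
      nlinarith
  rw [truncationBound]
  calc _ ≤ Real.exp (8 * (μ * n) / 2) + Real.exp (8 * (μ * n) / 2) *
        (1 + (|Q| + 1) / (2 * q)) := by gcongr
    _ = _ := by ring

lemma abs_nodeParam_natCast {h : ℝ} (hh : 0 < h) (j : ℕ) :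
    |nodeParam h (j : ℤ)| = ((j : ℝ) + 1 / 2) * h := by
  rw [nodeParam, Int.cast_natCast, abs_of_nonneg (by positivity)]

lemma abs_nodeParam_neg {h : ℝ} (hh : 0 < h) (j : ℕ) :
    |nodeParam h (-((j : ℤ) + 1))| = ((j : ℝ) + 1 / 2) * h := by
  rw [nodeParam]
  have : (((-((j : ℤ) + 1) : ℤ) : ℝ) + 1 / 2) * h = -(((j : ℝ) + 1 / 2) * h) := by
    push_cast
    ring
  rw [this, abs_neg, abs_of_nonneg (by positivity)]

lemma mul_natCast_le_abs_nodeParam {h : ℝ} (hh : 0 < h) {N : ℕ} {k : ℤ}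
    (hk : k ∉ Finset.Ico (-(N : ℤ)) N) : N * h ≤ |nodeParam h k| := by
  rw [Finset.mem_Ico, not_and_or, not_le, not_lt] at hk
  rcases hk with hk | hk
  · have h1 : ((k + 1 : ℤ) : ℝ) ≤ ((-(N : ℤ) : ℤ) : ℝ) := by exact_mod_cast hk
    push_cast at h1
    rw [nodeParam, abs_of_nonpos]
    · nlinarith
    · have : (0 : ℝ) ≤ N := N.cast_nonneg
      nlinarith
  · have h1 : (((N : ℤ) : ℤ) : ℝ) ≤ (k : ℝ) := by exact_mod_cast hk
    push_cast at h1
    rw [nodeParam]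
    refine le_trans ?_ (le_abs_self _)
    nlinarith

/-- The step sum of `exp (-q |θ_k|)` is, like its integral, at most `2 / q`, whatever the step. -/
lemma hasSum_exp_nodeParam {h q : ℝ} (hh : 0 < h) (hq : 0 < q) :
    ∃ S : ℝ, HasSum (fun k : ℤ => Real.exp (-q * |nodeParam h k|)) S ∧ h * S ≤ 2 / q := by
  set ρ := Real.exp (-(q * h)) with hρ
  have hρ0 : 0 < ρ := Real.exp_pos _
  have hqh : 0 < q * h := by positivity
  have hρ1 : ρ < 1 := by
    rw [hρ, Real.exp_lt_one_iff]
    linarith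
  have hgeo : HasSum (fun j : ℕ => Real.exp (-q * (((j : ℝ) + 1 / 2) * h)))
      (Real.exp (-(q * h / 2)) * (1 - ρ)⁻¹) := by
    have := (hasSum_geometric_of_lt_one hρ0.le hρ1).mul_left (Real.exp (-(q * h / 2)))
    refine this.congr_fun ?_
    intro j
    rw [hρ, ← Real.exp_nat_mul, ← Real.exp_add]
    congr 1
    ring
  refine ⟨_, HasSum.of_nat_of_neg_add_one (f := fun k : ℤ => Real.exp (-q * |nodeParam h k|))
    (by simpa only [abs_nodeParam_natCast hh] using hgeo)
    (by simpa only [abs_nodeParam_neg hh] using hgeo), ?_⟩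
  have h1 := Real.self_le_sinh_iff.2 (by positivity : 0 ≤ q * h / 2)
  rw [Real.sinh_eq] at h1
  have h2 : q * h * Real.exp (-(q * h / 2)) ≤ 1 - ρ := by
    have h3 : Real.exp (q * h / 2) * Real.exp (-(q * h / 2)) = 1 := by
      rw [← Real.exp_add]; simp
    have h4 : Real.exp (-(q * h / 2)) * Real.exp (-(q * h / 2)) = ρ := by
      rw [hρ, ← Real.exp_add]; congr 1; ring
    have h5 := Real.exp_pos (-(q * h / 2))
    nlinarith
  have h3 : 0 < 1 - ρ := by linarith
  rw [le_div_iff₀ hq]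
  calc h * (Real.exp (-(q * h / 2)) * (1 - ρ)⁻¹ + Real.exp (-(q * h / 2)) * (1 - ρ)⁻¹) * q
      = 2 * ((q * h * Real.exp (-(q * h / 2))) / (1 - ρ)) := by
        field_simp
        ring
    _ ≤ 2 * 1 := by
        gcongr
        rwa [div_le_one h3]
    _ = 2 := by norm_num

lemma norm_truncation_le {g : ℤ → ℂ} {h q E T : ℝ} {N : ℕ} (hh : 0 < h) (hq : 0 < q)
    (hT : 0 ≤ T) (hb : ∀ k, ‖g k‖ ≤ E * Real.exp (-q * |nodeParam h k|))
    (hb' : ∀ k ∉ Finset.Ico (-(N : ℤ)) N, ‖g k‖ ≤ T * Real.exp (-q * |nodeParam h k|)) :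
    ‖h * ∑' k : ℤ, g k - h * ∑ k ∈ Finset.Ico (-(N : ℤ)) N, g k‖ ≤ 2 * T / q := by
  obtain ⟨S, hS, hS'⟩ := hasSum_exp_nodeParam hh hq
  have hsum : Summable g := Summable.of_norm_bounded (hS.summable.mul_left E) hb
  have h1 := hsum.sum_add_tsum_compl (s := Finset.Ico (-(N : ℤ)) N)
  rw [← h1, mul_add, add_sub_cancel_left, norm_mul, Complex.norm_real,
    Real.norm_of_nonneg hh.le, tsum_subtype]
  have h2 := tsum_of_norm_bounded (hS.mul_left T)
    (f := (((Finset.Ico (-(N : ℤ)) N : Finset ℤ) : Set ℤ)ᶜ).indicator g) (fun k => by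
      by_cases hk : k ∈ Finset.Ico (-(N : ℤ)) N
      · rw [Set.indicator_of_notMem (by simpa using hk), norm_zero]
        positivity
      · rw [Set.indicator_of_mem (by simpa using hk)]
        exact hb' k hk)
  calc _ ≤ h * (T * S) := mul_le_mul_of_nonneg_left h2 hh.le
    _ = T * (h * S) := by ring
    _ ≤ T * (2 / q) := mul_le_mul_of_nonneg_left hS' hT
    _ = _ := by ring

/-! ### The error bound -/

lemma exists_norm_integrand_le_side {μ ψ σ k Q C : ℝ} (hμ : 0 < μ) (hσ : 0 ≤ σ) (hψ2 : ψ < π / 2)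
    (hk0 : 0 ≤ k) (hk1 : k < 1) (hk : Real.sin ψ ≤ k) {Φ : ℂ → ℂ}
    (hΦ : ∀ z ∈ cone k, z ≠ 0 → ‖z‖ * ‖Φ z‖ ≤ C * (1 + ‖z‖) ^ (1 + Q)) (hC : 0 ≤ C)
    {n : ℕ} (hQ : Q < n) : ∃ E R₀ : ℝ, ∀ w : ℂ, 0 ≤ w.im → w.im ≤ ψ + π / 2 → R₀ ≤ |w.re| →
      ‖integrand Φ μ ψ σ n w‖ ≤ E * Real.exp (-((n : ℝ) - Q) * |w.re|) := by
  have hk2 : 0 < 1 - k := by linarith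
  set c := (1 - k) / (1 + 2 * (1 + k) / (1 - k)) with hc
  have hc0 : 0 < c := by positivity
  set C₁ := (1 + 2 * (1 + k) / (1 - k)) / (1 - k) * C * 3 ^ |1 + Q| with hC₁
  refine ⟨C₁ * (c * μ / 6) ^ (-((n : ℝ) - Q)), Real.log (4 / (c * μ)), ?_⟩
  intro w h0 h1 hR
  have hsin : Real.sin (ψ - w.im) ≤ k :=
    (Real.sin_le_sin_of_le_of_le_pi_div_two (by linarith) hψ2.le (by linarith)).trans hk
  have h2 : c * μ * Real.exp |w.re| / 2 ≤ ‖hyperbola μ ψ σ w‖ := by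
    have h3 := norm_hyperbola_ge hμ.le hσ hk0 hk1 hsin (μ := μ) (σ := σ)
    have h4 := exp_abs_le_two_mul_cosh w.re
    have h5 : c * (μ * Real.cosh w.re) ≤ ‖hyperbola μ ψ σ w‖ := by
      rw [hc, div_mul_eq_mul_div, div_le_iff₀ (by positivity), mul_comm ‖_‖]
      nlinarith
    have h6 : 0 < c * μ := by positivity
    nlinarith
  have h3 : 4 ≤ c * μ * Real.exp |w.re| := by
    have h4 := Real.exp_le_exp.2 hR
    rw [Real.exp_log (by positivity), div_le_iff₀' (by positivity)] at h4
    exact h4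
  have h4 : ‖hyperbola μ ψ σ w‖ - 1 ≤ ‖1 - hyperbola μ ψ σ w‖ := by
    have := norm_sub_norm_le (hyperbola μ ψ σ w) 1
    rwa [norm_one, norm_sub_rev] at this
  have h5 := norm_integrand_le hμ hσ hk0 hk1 hΦ hC (by norm_num : (1 : ℝ) ≤ 3) hsin
    (by linarith) n
  have hC₁0 : 0 ≤ C₁ := by positivity
  calc _ ≤ C₁ * ‖1 - hyperbola μ ψ σ w‖ ^ (-((n : ℝ) - Q)) := h5
    _ ≤ C₁ * (c * μ / 6 * Real.exp |w.re|) ^ (-((n : ℝ) - Q)) := by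
        refine mul_le_mul_of_nonneg_left ?_ hC₁0
        exact Real.rpow_le_rpow_of_nonpos (by positivity) (by linarith) (by linarith)
    _ = _ := by
        rw [Real.mul_rpow (by positivity) (Real.exp_pos _).le, ← Real.exp_mul, ← mul_assoc,
          mul_comm |w.re|]

lemma approxWeight_eq {m : Scheme} {p : ℕ} (hp : 1 ≤ p) (α : ℝ) {τ : ℝ} (hτ : 0 < τ)
    (μ ψ σ h : ℝ) (N n : ℕ) : approxWeight m p α τ μ ψ σ h N n =
      τ ^ (-α) * (-((h / (2 * π) : ℝ) : ℂ) * ∑ k ∈ Finset.Ico (-(N : ℤ)) (N : ℤ),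
        integrand (rootSymbol α (schemeRoots m p α) (schemeExp m α)) (τ * μ) ψ (τ * σ) n
          (nodeParam h k : ℝ)).im := by
  rw [approxWeight, ← Complex.im_ofReal_mul, Finset.mul_sum, Finset.mul_sum, Finset.mul_sum]
  congr 1
  refine Finset.sum_congr rfl fun k _ => ?_
  rw [Fomega_eq_rootSymbol hp α hτ, quadWeight, quadPoint, integrand, ← smul_hyperbola,
    ← smul_deriv_hyperbola, mul_comm (hyperbola μ ψ σ _) (τ : ℂ)]
  ring

/-- Quadrature and truncation error together, for `τ = 1`. -/
lemma norm_sum_integrand_sub_le {Φ : ℂ → ℂ} {μ ψ σ d φ k Q C₀ C h X a₂ : ℝ} {N n : ℕ}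
    (hψd : 0 < ψ - d) (hd : 0 < d) (hψd2 : ψ + d < π / 2) (hφ0 : 0 ≤ φ) (hφ : φ < π / 2)
    (hk : k = Real.sin (ψ + d)) (hkφ : k < Real.cos φ)
    (hΦd : DifferentiableOn ℂ Φ (sector φ)) (hC₀ : 0 < C₀)
    (hΦ : ∀ z ∈ cone k, z ≠ 0 → ‖z‖ * ‖Φ z‖ ≤ C₀ * (1 + ‖z‖) ^ (1 + Q))
    (hμ : 0 < μ) (hμ1 : μ ≤ 2 / 3) (hσ : 0 ≤ σ) (hσ1 : σ ≤ 1 / 12) (hQ : Q < n) (hh : 0 < h)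
    (hC : 0 < C) (hX : X = Real.cosh (N * h)) (hb : ∀ (X : ℝ) (w : ℂ), |w.im| ≤ d → 0 ≤ X →
      X ≤ Real.cosh w.re → ‖integrand Φ μ ψ σ n w‖ ≤ C * truncationBound a₂ Q μ n X *
          Real.exp (-((⌊Q⌋ : ℝ) + 1 - Q) * |w.re|))
    (him : (iteratedDeriv n (fun ξ => Φ (1 - ξ)) 0 / (n.factorial : ℂ)).im = 0) :
    ‖(((-((h / (2 * π) : ℝ) : ℂ) * ∑ k ∈ Finset.Ico (-(N : ℤ)) (N : ℤ),
        integrand Φ μ ψ σ n (nodeParam h k : ℝ)).im : ℝ) : ℂ) -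
      iteratedDeriv n (fun ξ => Φ (1 - ξ)) 0 / (n.factorial : ℂ)‖ ≤
      4 * (C * truncationBound a₂ Q μ n 1) / ((⌊Q⌋ : ℝ) + 1 - Q) /
          (Real.exp (2 * d * π / h) - 1) +
        2 * (C * truncationBound a₂ Q μ n X) / ((⌊Q⌋ : ℝ) + 1 - Q) := by
  set q := (⌊Q⌋ : ℝ) + 1 - Q with hq
  have hq0 : 0 < q := by linarith [Int.lt_floor_add_one Q]
  have hM : 0 < (n : ℝ) - Q := by linarith
  set G := integrand Φ μ ψ σ n with hG
  set ω := iteratedDeriv n (fun ξ => Φ (1 - ξ)) 0 / (n.factorial : ℂ) with hω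
  have hk0 : 0 ≤ k := hk ▸ Real.sin_nonneg_of_nonneg_of_le_pi (by linarith) (by linarith)
  have hk1 : k < 1 := hkφ.trans_le (Real.cos_le_one φ)
  have hmem : ∀ w : ℂ, Real.sin (ψ - w.im) ≤ k → hyperbola μ ψ σ w ∈ sector φ := by
    intro w hw
    refine mem_sector_of_mem_cone hφ0 hφ hkφ (hyperbola_mem_cone hμ.le hσ hk0 hk1.le hw) ?_
    intro h0
    have h1 := norm_hyperbola_ge hμ.le hσ hk0 hk1 hw (μ := μ) (σ := σ)
    rw [h0, norm_zero, mul_zero] at h1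
    have : 0 < (1 - k) * (σ + μ * Real.cosh w.re) := by
      have : 0 < μ * Real.cosh w.re := mul_pos hμ (Real.cosh_pos _)
      exact mul_pos (by linarith) (by linarith)
    linarith
  have hS := isOpen_sector φ hφ0 hφ
  have hGd : ∀ w : ℂ, |w.im| ≤ d → DifferentiableAt ℂ G w := by
    intro w hw
    have hw' := abs_le.1 hw
    have hs : Real.sin (ψ - w.im) ≤ k := by
      rw [hk]
      exact Real.sin_le_sin_of_le_of_le_pi_div_two (by linarith) (by linarith) (by linarith)
    have h1 : 1 - hyperbola μ ψ σ w ≠ 0 := by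
      intro h0
      have h2 := one_add_norm_le_strip hμ hμ1 hσ hσ1 hψd hψd2 hw
      rw [h0, norm_zero, mul_zero] at h2
      linarith [norm_nonneg (hyperbola μ ψ σ w)]
    have h2 := differentiable_hyperbola μ ψ σ w
    refine DifferentiableAt.mul (DifferentiableAt.mul
      (differentiable_deriv_hyperbola μ ψ σ w) ?_) ?_
    · exact (h2.const_sub 1).zpow (Or.inl h1)
    · exact (hΦd.differentiableAt (hS.mem_nhds (hmem w hs))).comp w h2
  have hb1 : ∀ w : ℂ, |w.im| ≤ d →
      ‖G w‖ ≤ (C * truncationBound a₂ Q μ n 1) * Real.exp (-q * |w.re|) := fun w hw =>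
    hb 1 w hw zero_le_one (Real.one_le_cosh _)
  have hint : MeasureTheory.Integrable fun u : ℝ => G u := by
    refine ((integrable_exp_neg_mul_abs hq0).const_mul _).mono' ?_
      (Filter.Eventually.of_forall fun u => by simpa using hb1 u (by simpa using hd.le))
    refine Continuous.aestronglyMeasurable (continuous_iff_continuousAt.2 fun u => ?_)
    exact ((hGd u (by simpa using hd.le)).continuousAt).comp (f := fun u : ℝ => (u : ℂ))
      Complex.continuous_ofReal.continuousAt
  have hψk : Real.sin ψ ≤ k := by
    rw [hk]
    exact Real.sin_le_sin_of_le_of_le_pi_div_two (by linarith) hψd2.le (by linarith)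
  obtain ⟨E, R₀, hside⟩ := exists_norm_integrand_le_side hμ hσ (by linarith) hk0 hk1 hψk hΦ
    hC₀.le hQ
  have hcontour : ∫ u : ℝ, G u = -(2 * π * Complex.I * ω) :=
    integral_hyperbola_eq hμ (by linarith) (by linarith) (by linarith) hS
      ⟨one_ne_zero, by rw [Complex.arg_one, abs_zero]; linarith⟩ hΦd
      (fun w h0 h1 => hmem w ((Real.sin_le_sin_of_le_of_le_pi_div_two (by linarith)
        (by linarith) (by linarith)).trans hψk)) n hint hM hside
  have htrap := norm_integral_sub_trapezoid_le hd hh hq0 hGd hb1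
  have htail := norm_truncation_le (g := fun k : ℤ => G (nodeParam h k : ℝ)) (N := N)
    (E := C * truncationBound a₂ Q μ n 1) (T := C * truncationBound a₂ Q μ n X) hh hq0 (by
      have : 0 ≤ truncationBound a₂ Q μ n X := by
        have h1 : 0 < 1 + 3 / 2 * (μ * n) / (2 * (n - Q)) * X := by
          have : 0 < X := hX ▸ Real.cosh_pos _
          positivity
        exact add_nonneg (Real.exp_pos _).le
          (mul_nonneg (Real.exp_pos _).le (Real.rpow_pos_of_pos h1 _).le)
      positivity)
    (fun k => by simpa using hb1 (nodeParam h k : ℝ) (by simpa using hd.le))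
    (fun k hk => by
      have h1 : X ≤ Real.cosh (nodeParam h k) := by
        rw [hX, Real.cosh_le_cosh, abs_of_nonneg (by positivity)]
        exact mul_natCast_le_abs_nodeParam hh hk
      simpa using hb X (nodeParam h k : ℝ) (by simpa using hd.le)
        (hX ▸ (Real.cosh_pos _).le) (by simpa using h1))
  set s₁ := ∑ k ∈ Finset.Ico (-(N : ℤ)) (N : ℤ), G (nodeParam h k : ℝ) with hs₁
  set s₂ := ∑' k : ℤ, G (nodeParam h k : ℝ) with hs₂
  have hπ : 0 < π := Real.pi_pos
  have hω' : ω = (((-(1 / (2 * π) : ℝ) : ℂ) * ∫ u : ℝ, G u).im : ℝ) := by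
    have h1 : (-(1 / (2 * π) : ℝ) : ℂ) * ∫ u : ℝ, G u = ω * Complex.I := by
      rw [hcontour]
      have : (π : ℂ) ≠ 0 := Complex.ofReal_ne_zero.2 hπ.ne'
      push_cast
      field_simp
    rw [h1, Complex.mul_I_im]
    exact Complex.ext rfl (by simpa using him)
  have hdiff : (((-((h / (2 * π) : ℝ) : ℂ) * s₁).im : ℝ) : ℂ) - ω =
      ((((1 / (2 * π) : ℝ) : ℂ) * (((∫ u : ℝ, G u) - h * s₂) + (h * s₂ - h * s₁))).im : ℝ) := by
    conv_lhs => rw [hω']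
    rw [← Complex.ofReal_sub, ← Complex.sub_im]
    congr 2
    push_cast
    ring
  rw [hdiff, Complex.norm_real]
  refine (Complex.abs_im_le_norm _).trans ?_
  rw [norm_mul, Complex.norm_real, Real.norm_of_nonneg (by positivity)]
  have h1 : 1 / (2 * π) ≤ 1 := by
    rw [div_le_one (by positivity)]
    linarith [Real.pi_gt_three]
  calc _ ≤ 1 * ‖((∫ u : ℝ, G u) - h * s₂) + (h * s₂ - h * s₁)‖ := by gcongr
    _ ≤ ‖(∫ u : ℝ, G u) - h * s₂‖ + ‖h * s₂ - h * s₁‖ := by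
        rw [one_mul]
        exact norm_add_le _ _
    _ ≤ _ := add_le_add htrap htail

end

theorem theorem3p1 (m : Scheme) (p : ℕ) (hp : 1 ≤ p) (hp6 : p ≤ 6) (α ψ d φ : ℝ)
    (hα : -1 ≤ α) (hφ0 : 0 ≤ φ) (hφ : φ < π / 2) (hψ : 0 < ψ) (hd : 0 < d)
    (hψd : 0 < ψ - d) (hψdφ : ψ + d < π / 2 - φ)
    (hF : ∀ τ : ℝ, 0 < τ → DifferentiableOn ℂ (Fomega m p α τ) (sector φ)) :
    ∃ a₀ a₁ a₂ b c : ℝ, 0 < a₀ ∧ 0 < a₁ ∧ 0 < a₂ ∧ 0 < b ∧ 0 < c ∧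
      ∀ Q K : ℝ, ∃ C : ℝ, 0 < C ∧
        ∀ (τ σ h t : ℝ) (μ : ℕ → ℝ) (B ℓ N n : ℕ),
          0 < τ → 0 ≤ σ → 0 < h → (∀ l, 0 < μ l) → 2 ≤ B → 1 ≤ ℓ → 1 ≤ N →
          t = n * τ → n ∈ Set.Ico (B ^ (ℓ - 1)) (2 * B ^ ℓ) →
          b * μ ℓ * t ≤ n → 1 ≤ b * μ ℓ * t →
          σ * τ ≤ c → σ * t ≤ K →
          Q < n → QBounded m p α τ (μ ℓ) ψ σ d Q →
          ‖(approxWeight m p α τ (μ ℓ) ψ σ h N n : ℂ) - convWeight m p α τ n‖ ≤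
            C * τ ^ (-α) *
              (Real.exp (a₀ * μ ℓ * t / 2) / (Real.exp (2 * d * π / h) - 1)
                + Real.exp ((a₁ - a₂ * Real.cosh (N * h)) * μ ℓ * t / 2)
                + Real.exp (a₁ * μ ℓ * t / 2) *
                    (1 + b * μ ℓ * t / (2 * (n - Q)) * Real.cosh (N * h)) ^ (1 - n + Q)) := by
  have hψd2 : ψ + d < π / 2 := by linarith
  have ha0 : 0 < Real.sin (ψ - d) := Real.sin_pos_of_pos_of_lt_pi hψd (by linarith)
  set a₂ := Real.sin (ψ - d) / (1 + 12 * Real.sin (ψ - d)) with ha₂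
  have ha₂0 : 0 < a₂ := by positivity
  -- The factor `b / 2 = 3 / 4` has to be below `1`, the growth of `‖1 - λ‖` relative to `μ cosh u`,
  -- and `1 / b + c = 3 / 4` below `1`, so that the contour passes to the left of the pole.
  refine ⟨8, 8, a₂, 3 / 2, 1 / 12, by norm_num, by norm_num, ha₂0, by norm_num, by norm_num, ?_⟩
  intro Q K
  set k := Real.sin (ψ + d) with hk
  have hk0 : 0 ≤ k := Real.sin_nonneg_of_nonneg_of_le_pi (by linarith) (by linarith)
  have hkφ : k < Real.cos φ := by
    rw [hk, ← Real.sin_pi_div_two_sub]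
    exact Real.sin_lt_sin_of_lt_of_le_pi_div_two (by linarith) (by linarith) hψdφ
  have hF1 := hF 1 one_pos
  by_cases hQe : α + schemeExp m α * (schemeRoots m p α).card ≤ Q
  swap
  · refine ⟨1, one_pos, ?_⟩
    intro τ σ h t μ B ℓ N n hτ hσ hh hμ _ _ _ _ _ _ _ _ _ _ hQb
    exact absurd (exponent_le_of_qBounded hp hτ (hμ ℓ) hψ (by linarith) hσ hd.le hQb) hQe
  obtain ⟨C₀, hC₀, hΦ⟩ := norm_mul_rootSymbol_le hα hk0 hkφ (schemeRoots m p α)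
    (fun r hr => ne_zero_of_mem_schemeRoots hp hr)
    (schemeExp_nonneg_or_roots hp hφ0 hφ hF1) hQe
  obtain ⟨C, hC, hb⟩ := exists_norm_integrand_le (K := K) hψd hd hψd2 hk hC₀ hΦ
  have hΦd := differentiableOn_rootSymbol hp hF1
  set Φ := rootSymbol α (schemeRoots m p α) (schemeExp m α) with hΦdef
  set q := (⌊Q⌋ : ℝ) + 1 - Q with hq
  have hq0 : 0 < q := by linarith [Int.lt_floor_add_one Q]
  set C₁ := 2 + (|Q| + 1) / (2 * q) with hC₁
  have hC₁1 : 1 ≤ C₁ := by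
    have : 0 ≤ (|Q| + 1) / (2 * q) := by positivity
    linarith
  refine ⟨4 * C * C₁ / q, by positivity, ?_⟩
  intro τ σ h t μ B ℓ N n hτ hσ hh hμ _ _ _ ht _ hbn hb1 hστ hσt hQn _
  have hs : τ * μ ℓ * n = μ ℓ * t := by rw [ht]; ring
  have hn : 0 < (n : ℝ) := by linarith
  have hμ' : 0 < τ * μ ℓ := mul_pos hτ (hμ ℓ)
  have hμ1 : τ * μ ℓ ≤ 2 / 3 := by
    have h1 : 3 / 2 * (τ * μ ℓ) * n ≤ 1 * n := by
      rw [one_mul, mul_assoc, hs]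
      linarith
    have h2 := le_of_mul_le_mul_right h1 hn
    linarith
  have hσ' : 0 ≤ τ * σ := by positivity
  have hσ1 : τ * σ ≤ 1 / 12 := by linarith
  have hb' := hb (τ * μ ℓ) (τ * σ) n hμ' hμ1 hσ' hσ1 (by rw [hs]; linarith)
    (by rw [ht] at hσt; linarith) hQn
  have hconv := convWeight_eq (m := m) hp α hτ n
  rw [← hΦdef] at hconv
  have hτα : 0 < τ ^ (-α) := Real.rpow_pos_of_pos hτ _
  have him : (iteratedDeriv n (fun ξ => Φ (1 - ξ)) 0 / (n.factorial : ℂ)).im = 0 := by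
    have h1 := convWeight_im (m := m) hp α hτ n
    rw [hconv, Complex.im_ofReal_mul] at h1
    exact (mul_eq_zero.1 h1).resolve_left hτα.ne'
  have herr := norm_sum_integrand_sub_le (N := N) hψd hd hψd2 hφ0 hφ hk hkφ hΦd hC₀ hΦ hμ' hμ1
    hσ' hσ1 hQn hh hC rfl hb' him
  have hT1 := truncationBound_one_le (n := n) ha₂0.le hμ' hμ1 hQn
  rw [← hq, ← hC₁] at hT1
  rw [approxWeight_eq hp α hτ, ← hΦdef, hconv, Complex.ofReal_mul, ← mul_sub, norm_mul,
    Complex.norm_real, Real.norm_of_nonneg hτα.le, mul_comm (4 * C * C₁ / q), mul_assoc]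
  refine mul_le_mul_of_nonneg_left (herr.trans ?_) hτα.le
  have hD : 0 < Real.exp (2 * d * π / h) - 1 := by
    have : 0 < 2 * d * π / h := by positivity
    linarith [Real.one_lt_exp_iff.2 this]
  have hTX : truncationBound a₂ Q (τ * μ ℓ) n (Real.cosh (N * h)) =
      Real.exp ((8 - a₂ * Real.cosh (N * h)) * μ ℓ * t / 2) +
        Real.exp (8 * μ ℓ * t / 2) *
          (1 + 3 / 2 * μ ℓ * t / (2 * (n - Q)) * Real.cosh (N * h)) ^ (1 - (n : ℝ) + Q) := by
    rw [truncationBound, hs]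
    simp only [mul_assoc]
  have hTX0 : 0 ≤ truncationBound a₂ Q (τ * μ ℓ) n (Real.cosh (N * h)) := by
    have h1 : 0 < 1 + 3 / 2 * (τ * μ ℓ * n) / (2 * (n - Q)) * Real.cosh (N * h) := by
      have : 0 < (n : ℝ) - Q := by linarith
      have := Real.cosh_pos (N * h)
      positivity
    exact add_nonneg (Real.exp_pos _).le
      (mul_nonneg (Real.exp_pos _).le (Real.rpow_pos_of_pos h1 _).le)
  rw [add_assoc, ← hTX, mul_add]
  refine add_le_add ?_ ?_
  · rw [hs, ← mul_assoc 8] at hT1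
    calc _ ≤ 4 * (C * (C₁ * Real.exp (8 * μ ℓ * t / 2))) / q /
          (Real.exp (2 * d * π / h) - 1) := by gcongr
      _ = _ := by ring
  · calc _ = 2 * C * 1 / q * truncationBound a₂ Q (τ * μ ℓ) n (Real.cosh (N * h)) := by ring
      _ ≤ _ := by
          gcongr
          norm_num
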